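/- Let $k$ be a field of characteristic different from $2$ that contains an element $i$ with $i^2=-1$, and let $n\ge 2$ be an integer. Let $E$ be the elliptic curve over $k$ given by $y^2=x^3-x$ (that is, the plane projective cubic $Y^2Z=X^3-XZ^2$), with the automorphism $\tau\colon (x,y)\mapsto(-x,iy)$. Let $E^n$ be the product over $k$ of $n$ copies of $E$, and let $$H_1=\langle(\tau,1,\dots,1,\tau),\ (1,\tau,1,\dots,1,\tau),\ \dots,\ (1,\dots,1,\tau,\tau)\rangle\subset \operatorname{Aut}_k(E^n)$$ be the group generated by the $n-1$ automorphisms that act by $\tau$ on the $j$-th and on the last factor and trivially on the others, $1\le j\le n-1$. Then $H_1\simeq(\mathbb Z/4\mathbb Z)^{n-1}$, the quotient $Z_n=E^n/H_1$ exists, and $Z_n$ is a variety over $k$ which is rational, i.e. birational over $k$ to $n$-dimensional affine (equivalently, projective) space. Here the quotient of $E^n$ by $H_1$ is a $k$-scheme $Z_n$ with an affine $H_1$-invariant $k$-morphism $\pi\colon E^n\to Z_n$ such that, as a topological space, $Z_n$ is the space of $H_1$-orbits in $E^n$, and for every open $U\subset Z_n$ the functions on $U$ are, via $\pi$, the $H_1$-invariant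 functions on $\pi^{-1}(U)$; a variety over $k$ is an integral scheme that is separated and of finite type over $k$. -/

import Mathlib

open CategoryTheory CategoryTheory.Limits AlgebraicGeometry

universe u

noncomputable section

namespace ZQuot

section QuotientGrading

variable {R A : Type u} [CommRing R] [CommRing A] [Algebra R A]
  (𝒜 : ℕ → Submodule R A) (I : Ideal A)

/-- The degree `d` part of `A ⧸ I`: the image of the degree `d` part of `A`. -/
def quotGrading (d : ℕ) : Submodule R (A ⧸ I) :=
  (𝒜 d).map (Ideal.Quotient.mkₐ R I).toLinearMap

variable {𝒜 I}

theorem mk_mem_quotGrading {d : ℕ} {a : A} (ha : a ∈ 𝒜 d) :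
    Ideal.Quotient.mk I a ∈ quotGrading 𝒜 I d :=
  Submodule.mem_map_of_mem (f := (Ideal.Quotient.mkₐ R I).toLinearMap) ha

variable (𝒜 I)

/-- The quotient map in degree `d`. -/
def quotGradingMk (d : ℕ) : 𝒜 d →ₗ[R] quotGrading 𝒜 I d :=
  ((Ideal.Quotient.mkₐ R I).toLinearMap.comp (𝒜 d).subtype).codRestrict _
    fun a => mk_mem_quotGrading a.2

variable [GradedAlgebra 𝒜]

/-- Split an element of `A` into components and reduce each of them modulo `I`. -/
def preDecompose : A →ₗ[R] DirectSum ℕ fun d => quotGrading 𝒜 I d :=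
  (DirectSum.lmap (quotGradingMk 𝒜 I)).comp (DirectSum.decomposeLinearEquiv 𝒜).toLinearMap

variable {𝒜 I}

theorem preDecompose_of_mem {d : ℕ} {a : A} (ha : a ∈ 𝒜 d) :
    preDecompose 𝒜 I a =
      DirectSum.of (fun d => quotGrading 𝒜 I d) d ⟨_, mk_mem_quotGrading ha⟩ := by
  simp only [preDecompose, LinearMap.comp_apply, LinearEquiv.coe_coe,
    DirectSum.decomposeLinearEquiv_apply, DirectSum.decompose_of_mem 𝒜 ha, DirectSum.lmap_of]
  rfl

theorem preDecompose_eq_zero (hI : I.IsHomogeneous 𝒜) {a : A} (ha : a ∈ I) :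
    preDecompose 𝒜 I a = 0 := by
  refine DFinsupp.ext fun d => Subtype.ext ?_
  exact Ideal.Quotient.eq_zero_iff_mem.mpr (hI d ha)

/-- The decomposition of an element of `A ⧸ I` into homogeneous components. -/
def quotDecompose (hI : I.IsHomogeneous 𝒜) :
    (A ⧸ I) →ₗ[R] DirectSum ℕ fun d => quotGrading 𝒜 I d where
  toFun := fun x => Quotient.liftOn' x (preDecompose 𝒜 I) fun a b hab => by
    have h := preDecompose_eq_zero hI ((Submodule.quotientRel_def I).mp hab)
    have h' : preDecompose 𝒜 I (a - b + b) = preDecompose 𝒜 I (a - b) + preDecompose 𝒜 I b :=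
      LinearMap.map_add _ _ _
    rwa [h, sub_add_cancel, zero_add] at h'
  map_add' x y := by
    obtain ⟨a, rfl⟩ := Ideal.Quotient.mk_surjective x
    obtain ⟨b, rfl⟩ := Ideal.Quotient.mk_surjective y
    exact map_add (preDecompose 𝒜 I) a b
  map_smul' r x := by
    obtain ⟨a, rfl⟩ := Ideal.Quotient.mk_surjective x
    exact map_smul (preDecompose 𝒜 I) r a

theorem quotDecompose_mk (hI : I.IsHomogeneous 𝒜) (a : A) :
    quotDecompose hI (Ideal.Quotient.mk I a) = preDecompose 𝒜 I a := rfl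

/-- The quotient of a graded algebra by a homogeneous ideal is graded. -/
@[reducible] def quotGradedAlgebra (hI : I.IsHomogeneous 𝒜) :
    GradedAlgebra (quotGrading 𝒜 I) where
  one_mem := mk_mem_quotGrading SetLike.GradedOne.one_mem
  mul_mem := by
    rintro i j _ _ ⟨a, ha, rfl⟩ ⟨b, hb, rfl⟩
    exact ⟨a * b, SetLike.mul_mem_graded ha hb, map_mul (Ideal.Quotient.mk I) a b⟩
  toDecomposition := DirectSum.Decomposition.ofLinearMap _ (quotDecompose hI)
    (by
      refine LinearMap.ext fun x => ?_
      obtain ⟨a, rfl⟩ := Ideal.Quotient.mk_surjective x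
      rw [LinearMap.comp_apply, quotDecompose_mk, LinearMap.id_apply]
      induction a using DirectSum.Decomposition.inductionOn 𝒜 with
      | zero => simp
      | homogeneous a =>
        rw [preDecompose_of_mem a.2]
        exact DirectSum.coeLinearMap_lof (quotGrading 𝒜 I) _ _
      | add a b ha hb => rw [map_add, map_add, ha, hb, map_add])
    (by
      refine DirectSum.linearMap_ext _ fun d => LinearMap.ext ?_
      rintro ⟨_, a, ha, rfl⟩
      simp only [LinearMap.comp_apply, DirectSum.coeLinearMap_lof, LinearMap.id_apply]
      exact preDecompose_of_mem ha)

end QuotientGrading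

section Curve

open MvPolynomial

variable (k : Type u) [Field k]

/-- The standard grading of `k[X, Y, Z]`, with `X = X 0`, `Y = X 1`, `Z = X 2`. -/
abbrev polyGrading : ℕ → Submodule k (MvPolynomial (Fin 3) k) :=
  homogeneousSubmodule (Fin 3) k

instance : GradedAlgebra (polyGrading k) := MvPolynomial.gradedAlgebra

/-- The form `Y²Z - X³ + XZ²`, whose dehomogenization is `y² - (x³ - x)`. -/
def cubic : MvPolynomial (Fin 3) k :=
  X 1 ^ 2 * X 2 - X 0 ^ 3 + X 0 * X 2 ^ 2

theorem cubic_mem : cubic k ∈ polyGrading k 3 := by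
  have h (j : Fin 3) : (X j : MvPolynomial (Fin 3) k).IsHomogeneous 1 := isHomogeneous_X k j
  have h1 : (X 1 ^ 2 * X 2 : MvPolynomial (Fin 3) k).IsHomogeneous 3 := ((h 1).pow 2).mul (h 2)
  have h2 : (X 0 ^ 3 : MvPolynomial (Fin 3) k).IsHomogeneous 3 := (h 0).pow 3
  have h3 : (X 0 * X 2 ^ 2 : MvPolynomial (Fin 3) k).IsHomogeneous 3 := (h 0).mul ((h 2).pow 2)
  exact (h1.sub h2).add h3

/-- The ideal `(Y²Z - X³ + XZ²)` of `k[X, Y, Z]`. -/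
abbrev cubicIdeal : Ideal (MvPolynomial (Fin 3) k) := Ideal.span {cubic k}

theorem cubicIdeal_isHomogeneous : (cubicIdeal k).IsHomogeneous (polyGrading k) :=
  Ideal.homogeneous_span _ _ (by rintro _ rfl; exact ⟨3, cubic_mem k⟩)

/-- The homogeneous coordinate ring `k[X, Y, Z] / (Y²Z - X³ + XZ²)`. -/
abbrev CoordRing : Type u := MvPolynomial (Fin 3) k ⧸ cubicIdeal k

/-- The grading of the homogeneous coordinate ring by degree. -/
abbrev grading : ℕ → Submodule k (CoordRing k) := quotGrading (polyGrading k) (cubicIdeal k)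

instance : GradedAlgebra (grading k) := quotGradedAlgebra (cubicIdeal_isHomogeneous k)

/-- The structure morphism of `Proj (k[X, Y, Z] / (Y²Z - X³ + XZ²))` over `Spec k`. -/
def curveToSpec : Proj (grading k) ⟶ Spec (.of k) :=
  Proj.toSpecZero (grading k) ≫ Spec.map (CommRingCat.ofHom (algebraMap k (grading k 0)))

/-- The elliptic curve `y² = x³ - x` over `k`, as the plane projective cubic
`Y²Z = X³ - XZ²`. -/
def curve : Over (Spec (CommRingCat.of k)) := Over.mk (curveToSpec k)

variable {k}

/-- The substitution `X ↦ -X`, `Y ↦ c Y`, `Z ↦ Z`. -/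
def substHom (c : k) : MvPolynomial (Fin 3) k →ₐ[k] MvPolynomial (Fin 3) k :=
  aeval ![-X 0, C c * X 1, X 2]

theorem substHom_mem (c : k) {d : ℕ} {p : MvPolynomial (Fin 3) k} (hp : p ∈ polyGrading k d) :
    substHom c p ∈ polyGrading k d := by
  have hg (j : Fin 3) : ((![-X 0, C c * X 1, X 2] : Fin 3 → MvPolynomial (Fin 3) k) j).IsHomogeneous
      1 := by
    fin_cases j
    · simpa using (isHomogeneous_X k (0 : Fin 3)).neg
    · simpa using isHomogeneous_C_mul_X c (1 : Fin 3)
    · simpa using isHomogeneous_X k (2 : Fin 3)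
  have h := ((mem_homogeneousSubmodule d p).mp hp).aeval _ hg
  rw [one_mul] at h
  exact (mem_homogeneousSubmodule d _).mpr h

theorem substHom_cubic {c : k} (hc : c ^ 2 = -1) : substHom c (cubic k) = -cubic k := by
  have hC : (C c : MvPolynomial (Fin 3) k) ^ 2 = -1 := by
    rw [← C_pow, hc, C_neg, C_1]
  simp only [substHom, cubic, map_add, map_sub, map_mul, map_pow, aeval_X]
  simp only [Matrix.cons_val_zero, Matrix.cons_val_one, Matrix.cons_val]
  linear_combination (X 1 ^ 2 * X 2) * hC

/-- The graded endomorphism `X ↦ -X`, `Y ↦ c Y`, `Z ↦ Z` of the homogeneous coordinate ring,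
for `c² = -1`. -/
def coordHom (c : k) (hc : c ^ 2 = -1) : grading k →+*ᵍ grading k where
  toRingHom := Ideal.quotientMap (cubicIdeal k) (substHom c).toRingHom (by
    rw [Ideal.span_le, Set.singleton_subset_iff]
    change substHom c (cubic k) ∈ cubicIdeal k
    rw [substHom_cubic hc]
    exact neg_mem (Ideal.mem_span_singleton_self _))
  map_mem := by
    rintro d _ ⟨p, hp, rfl⟩
    exact mk_mem_quotGrading (substHom_mem c hp)

theorem coordHom_mk (c : k) (hc : c ^ 2 = -1) (p : MvPolynomial (Fin 3) k) :
    coordHom c hc (Ideal.Quotient.mk _ p) = Ideal.Quotient.mk _ (substHom c p) := rfl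

theorem substHom_substHom {c d : k} (h : c * d = 1) (p : MvPolynomial (Fin 3) k) :
    substHom c (substHom d p) = p := by
  have : (substHom c).comp (substHom d) = AlgHom.id k _ := by
    ext1 j
    have h' : (C c * C d : MvPolynomial (Fin 3) k) = 1 := by rw [← C_mul, h, C_1]
    fin_cases j
    · simp [substHom]
    · simp only [substHom, AlgHom.comp_apply, aeval_X, Fin.mk_one, Matrix.cons_val_one,
        Matrix.cons_val_zero, map_mul, algHom_C, algebraMap_eq, AlgHom.id_apply]
      linear_combination X 1 * h'
    · simp [substHom]
  exact DFunLike.congr_fun this p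

theorem coordHom_comp {c d : k} (hc : c ^ 2 = -1) (hd : d ^ 2 = -1) (h : c * d = 1) :
    (coordHom c hc).comp (coordHom d hd) = GradedRingHom.id (grading k) := by
  refine DFunLike.ext _ _ fun x => ?_
  obtain ⟨p, rfl⟩ := Ideal.Quotient.mk_surjective x
  change coordHom c hc (coordHom d hd (Ideal.Quotient.mk _ p)) = Ideal.Quotient.mk _ p
  rw [coordHom_mk, coordHom_mk, substHom_substHom h]

theorem neg_sq_eq {c : k} (hc : c ^ 2 = -1) : (-c) ^ 2 = -1 := by rw [neg_sq, hc]

theorem mul_neg_eq {c : k} (hc : c ^ 2 = -1) : c * -c = 1 := by linear_combination -hc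

theorem neg_mul_eq {c : k} (hc : c ^ 2 = -1) : -c * c = 1 := by linear_combination -hc

theorem irrelevant_le (c : k) (hc : c ^ 2 = -1) :
    HomogeneousIdeal.irrelevant (grading k) ≤
      (HomogeneousIdeal.irrelevant (grading k)).map (coordHom c hc) := by
  rw [HomogeneousIdeal.irrelevant_le]
  intro d hd x hx
  have h : coordHom c hc (coordHom (-c) (neg_sq_eq hc) x) = x :=
    DFunLike.congr_fun (coordHom_comp hc (neg_sq_eq hc) (mul_neg_eq hc)) x
  rw [← h]
  exact Ideal.mem_map_of_mem _ (HomogeneousIdeal.mem_irrelevant_of_mem _ hd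
    ((coordHom (-c) (neg_sq_eq hc)).map_mem hx))

/-- The endomorphism `(x, y) ↦ (-x, c y)` of the projective curve. -/
def tauProj (c : k) (hc : c ^ 2 = -1) : Proj (grading k) ⟶ Proj (grading k) :=
  Proj.map (coordHom c hc) (irrelevant_le c hc)

theorem tauProj_comp {c d : k} (hc : c ^ 2 = -1) (hd : d ^ 2 = -1) (h : c * d = 1) :
    tauProj c hc ≫ tauProj d hd = 𝟙 _ := by
  rw [tauProj, tauProj, ← Proj.map_comp, ← Proj.map_id]
  congr 1
  exact coordHom_comp hc hd h

theorem awayι_tauProj_curveToSpec (c : k) (hc : c ^ 2 = -1) {d : ℕ} (hd : 0 < d)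
    (a : CoordRing k) (ha : a ∈ grading k d) :
    Proj.awayι (grading k) (coordHom c hc a) ((coordHom c hc).map_mem ha) hd ≫
        tauProj c hc ≫ curveToSpec k =
      Proj.awayι (grading k) (coordHom c hc a) ((coordHom c hc).map_mem ha) hd ≫
        curveToSpec k := by
  have h := Proj.awayι_comp_map (coordHom c hc) (irrelevant_le c hc) hd a ha
  rw [tauProj, curveToSpec, reassoc_of% h, Proj.awayι_toSpecZero_assoc,
    Proj.awayι_toSpecZero_assoc, ← Spec.map_comp, ← Spec.map_comp, ← Spec.map_comp]
  congr 1
  ext r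
  have hr : coordHom c hc (algebraMap k (CoordRing k) r) = algebraMap k (CoordRing k) r := by
    change coordHom c hc (Ideal.Quotient.mk _ (algebraMap k _ r)) = _
    rw [coordHom_mk, AlgHom.commutes]
    rfl
  change Localization.mk (coordHom c hc (algebraMap k (CoordRing k) r))
      ⟨coordHom c hc 1, Submonoid.mem_powers_iff _ _ |>.mpr ⟨0, by rw [pow_zero, map_one]⟩⟩ =
    Localization.mk (algebraMap k (CoordRing k) r) ⟨1, one_mem _⟩
  congr 1
  exact Subtype.ext (map_one (coordHom c hc))

theorem tauProj_curveToSpec (c : k) (hc : c ^ 2 = -1) :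
    tauProj c hc ≫ curveToSpec k = curveToSpec k :=
  (Proj.mapAffineOpenCover _ (irrelevant_le c hc)).openCover.hom_ext _ _ fun s =>
    awayι_tauProj_curveToSpec c hc s.1.2 s.2.1 s.2.2

/-- The automorphism `τ : (x, y) ↦ (-x, c y)` of the elliptic curve `y² = x³ - x` over `k`,
for `c` a square root of `-1`. -/
def tau (c : k) (hc : c ^ 2 = -1) : Aut (curve k) :=
  Over.isoMk
    { hom := tauProj c hc
      inv := tauProj (-c) (neg_sq_eq hc)
      hom_inv_id := tauProj_comp hc (neg_sq_eq hc) (mul_neg_eq hc)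
      inv_hom_id := tauProj_comp (neg_sq_eq hc) hc (neg_mul_eq hc) }
    (tauProj_curveToSpec c hc)

end Curve

section Product

variable (k : Type u) [Field k]

instance hasFiniteProducts_over (S : Scheme.{u}) : HasFiniteProducts (Over S) :=
  Over.ConstructProducts.over_finiteProducts_of_finiteWidePullbacks

/-- The product `E × ⋯ × E` of `n` copies of the curve, as a `k`-scheme. -/
def curvePow (n : ℕ) : Over (Spec (CommRingCat.of k)) := ∏ᶜ fun _ : Fin n => curve k

variable {k}

/-- The automorphism `(f 0, …, f (n - 1))` of the product, acting factor by factor. -/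
def factorwise {n : ℕ} (f : Fin n → Aut (curve k)) : Aut (curvePow k n) := Pi.mapIso f

/-- The subgroup `⟨(τ, 1, …, 1, τ), (1, τ, 1, …, 1, τ), …, (1, …, 1, τ, τ)⟩` of the automorphism
group of the product of `n` copies of the curve. -/
def groupH (n : ℕ) (c : k) (hc : c ^ 2 = -1) : Subgroup (Aut (curvePow k n)) :=
  Subgroup.closure {g | ∃ j : Fin n, (j : ℕ) + 1 < n ∧
    g = factorwise fun l => if l = j ∨ (l : ℕ) + 1 = n then tau c hc else 1}

end Product

section Quotient

variable {S : Scheme.{u}}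

/-- `π : X ⟶ Z` is the quotient of the `S`-scheme `X` by the group `H` of `S`-automorphisms:
`π` is an affine `H`-invariant morphism which makes `Z`, as a topological space, the space of
`H`-orbits in `X`, and the functions on an open `U` in `Z` are exactly the `H`-invariant functions
on `π⁻¹(U)`. -/
structure IsQuotient {X Z : Over S} (H : Subgroup (Aut X)) (π : X ⟶ Z) : Prop where
  affine : IsAffineHom π.left
  invariant : ∀ h ∈ H, h.hom ≫ π = π
  quotientMap : Topology.IsQuotientMap π.left
  orbit : ∀ x y : X.left, π.left x = π.left y → ∃ h ∈ H, h.hom.left x = y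
  injective : ∀ U : Z.left.Opens, Function.Injective (π.left.app U)
  sections : ∀ (U : Z.left.Opens) (s : Γ(X.left, π.left ⁻¹ᵁ U)),
    (∀ (h : Aut X) (hh : h ∈ H),
      h.hom.left.appLE (π.left ⁻¹ᵁ U) (π.left ⁻¹ᵁ U)
        (by rw [← Scheme.Hom.comp_preimage, ← Over.comp_left, invariant h hh]) s = s) →
    ∃ t : Γ(Z.left, U), π.left.app U t = s

/-- A variety over `S` (to be used for the spectrum of a field): an integral scheme, separated
and of finite type over `S`. -/
structure IsVariety (Z : Over S) : Prop where
  integral : IsIntegral Z.left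
  separated : IsSeparated Z.hom
  locallyOfFiniteType : LocallyOfFiniteType Z.hom
  quasiCompact : QuasiCompact Z.hom

end Quotient

end ZQuot

end

noncomputable section


/-! Put n = m + 2. Let x_j, y_j (0 ≤ j ≤ m) be the coordinates on the first n - 1 factors of E^n and
x', y' those on the last one. The j-th generator multiplies x_j and x' by -1, multiplies y_j and y'
by c (with c² = -1), and fixes the other coordinates. Hence s = x'/∏ x_j, w = y'/∏ y_j and all x_j²
are invariant. Substituting x' = s ∏ x_j and y' = w ∏ y_j in y'² = x'³ - x', using y_j² = x_j (x_j²
- 1) and cancelling ∏ x_j gives w² ∏ (x_j² - 1) = s (s² ∏ x_j² - 1). This has degree one in x_0², so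
x_0² is a rational function of the n parameters s, w, x_1², …, x_m² (`relation_of_curve`,
`denom_mul_of_relation`).

There are no other invariants. Where the function `discriminant` is invertible, let B be the ring of
fractions in the parameters, for a suitable denominator. It contains y_j⁴ = x_j² (x_j² - 1)², and
all functions are generated over B by the y_j, because x_j = y_j²/(x_j² - 1). The y_j are
eigenvectors separated by the generators, so averaging over the group, whose order 4^(n-1) is
invertible, kills every monomial in the y_j unless all exponents are divisible by 4, when it lies in
B (`mem_of_invariant`). The parameters are algebraically independent: over an algebraic closure of
the field of rational functions in n variables, there is a point of E^n whose parameters are these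
variables (`exists_generic_point`). `exists_isInvariantChart` collects this, and
`IsQuotient.birationalOver` transfers it to any quotient.

The quotient exists because the charts Y ≠ 0 and Z ≠ 0 of E are affine, τ-stable and cover E;
products of them cover E^n by invariant affine opens, and the spectra of their rings of invariants
glue (`exists_isQuotient`). A quotient map is integral, surjective and injective on functions, so
being a variety descends from E^n to the quotient (`IsQuotient.isVariety`). E^n is integral since E
is geometrically integral: over any extension K the chart Z ≠ 0 has a coordinate ring that embeds in
a Weierstrass coordinate ring over K, which is a domain (`isDomain_tensor_away`).

The group is the image of (ℤ/4)^(n-1) under a ↦ (τ^a_1, …, τ^a_(n-1), τ^(a_1 + ⋯ + a_(n-1))), which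
is injective because τ has order 4 (`groupH_eq_range`, `orderOf_tau`). -/

namespace ZQuot

/-! ### Functions and orbits on an invariant open -/

section Action

variable {S : Scheme.{u}} {X : Over S} {H : Subgroup (Aut X)} {V W : X.left.Opens}

/-- An open subset of `X` which is stable under the group `H` of automorphisms. -/
def IsInvariantOpen (H : Subgroup (Aut X)) (V : X.left.Opens) : Prop :=
  ∀ h ∈ H, h.hom.left ⁻¹ᵁ V = V

/-- Pullback of functions on an invariant open along an element of `H`. -/
def pull (hV : IsInvariantOpen H V) (h : H) : Γ(X.left, V) →+* Γ(X.left, V) :=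
  (h.1.hom.left.appLE V V (hV h.1 h.2).ge).hom

theorem pull_one (hV : IsInvariantOpen H V) (s : Γ(X.left, V)) : pull hV 1 s = s := by
  simp only [pull, Scheme.Hom.appLE]
  exact congr($(X.left.presheaf.map_id _) s)

/-- Pullback reverses composition, so `pull` is an action from the right; this is why
`sectionAction` inserts an inverse. -/
theorem pull_mul (hV : IsInvariantOpen H V) (g h : H) (s : Γ(X.left, V)) :
    pull hV (g * h) s = pull hV h (pull hV g s) := by
  have h1 : (g * h : H).1.hom.left = h.1.hom.left ≫ g.1.hom.left := rfl
  simp only [pull, h1]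
  rw [← Scheme.Hom.appLE_comp_appLE _ _ V V V (hV g.1 g.2).ge (hV h.1 h.2).ge]
  rfl

/-- The left action of `H` on the functions on an invariant open. -/
@[reducible] def sectionAction (hV : IsInvariantOpen H V) :
    MulSemiringAction H Γ(X.left, V) where
  smul h s := pull hV h⁻¹ s
  one_smul s := (congrArg (fun g => pull hV g s) inv_one).trans (pull_one hV s)
  mul_smul g h s :=
    (congrArg (fun g => pull hV g s) (mul_inv_rev g h)).trans (pull_mul hV h⁻¹ g⁻¹ s)
  smul_zero h := map_zero (pull hV h⁻¹)
  smul_add h := map_add (pull hV h⁻¹)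
  smul_one h := map_one (pull hV h⁻¹)
  smul_mul h := map_mul (pull hV h⁻¹)

/-- The subring of functions on an invariant open fixed by `H`. -/
def invariants (hV : IsInvariantOpen H V) : Subring Γ(X.left, V) where
  carrier := {s | ∀ h : H, pull hV h s = s}
  mul_mem' ha hb h := by rw [map_mul, ha h, hb h]
  one_mem' h := map_one _
  add_mem' ha hb h := by rw [map_add, ha h, hb h]
  zero_mem' h := map_zero _
  neg_mem' ha h := by rw [map_neg, ha h]

theorem mem_invariants {hV : IsInvariantOpen H V} {s : Γ(X.left, V)} :
    s ∈ invariants hV ↔ ∀ h : H, pull hV h s = s := Iff.rfl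

theorem pull_res (hV : IsInvariantOpen H V) (hW : IsInvariantOpen H W) (e : W ≤ V) (h : H)
    (s : Γ(X.left, V)) :
    pull hW h (X.left.presheaf.map (homOfLE e).op s) =
      X.left.presheaf.map (homOfLE e).op (pull hV h s) := by
  simp only [pull]
  rw [← CommRingCat.comp_apply, ← CommRingCat.comp_apply, Scheme.Hom.map_appLE,
    Scheme.Hom.appLE_map]

theorem res_mem_invariants (hV : IsInvariantOpen H V) (hW : IsInvariantOpen H W) (e : W ≤ V)
    {s : Γ(X.left, V)} (hs : s ∈ invariants hV) :
    X.left.presheaf.map (homOfLE e).op s ∈ invariants hW := fun h => by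
  rw [pull_res hV hW e, hs h]

theorem IsInvariantOpen.inf (hV : IsInvariantOpen H V) (hW : IsInvariantOpen H W) :
    IsInvariantOpen H (V ⊓ W) := fun h hh => by
  rw [Scheme.Hom.preimage_inf, hV h hh, hW h hh]

theorem preimage_basicOpen_pull (hV : IsInvariantOpen H V) (h : H) (s : Γ(X.left, V)) :
    h.1.hom.left ⁻¹ᵁ X.left.basicOpen s = X.left.basicOpen (pull hV h s) := by
  have := Scheme.basicOpen_appLE h.1.hom.left V V (hV h.1 h.2).ge s
  rw [pull, this, right_eq_inf]
  conv_rhs => rw [← hV h.1 h.2]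
  exact Scheme.Hom.preimage_mono _ (X.left.basicOpen_le s)

theorem IsInvariantOpen.basicOpen (hV : IsInvariantOpen H V) {s : Γ(X.left, V)}
    (hs : s ∈ invariants hV) : IsInvariantOpen H (X.left.basicOpen s) := fun h hh => by
  rw [preimage_basicOpen_pull hV ⟨h, hh⟩, hs]

theorem IsInvariantOpen.mem_iff (hV : IsInvariantOpen H V) {h : Aut X} (hh : h ∈ H) {x : X.left} :
    h.hom.left x ∈ V ↔ x ∈ V := by
  conv_rhs => rw [← hV h hh]
  rfl

theorem mem_primeIdealOf_iff {Y : Scheme.{u}} {U : Y.Opens} (hU : IsAffineOpen U) {x : Y}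
    (hx : x ∈ U) (s : Γ(Y, U)) :
    s ∈ (hU.primeIdealOf ⟨x, hx⟩).asIdeal ↔ x ∉ Y.basicOpen s := by
  have h1 : hU.primeIdealOf ⟨x, hx⟩ ∈ PrimeSpectrum.basicOpen s ↔ x ∈ Y.basicOpen s := by
    have h3 : hU.primeIdealOf ⟨x, hx⟩ ∈ hU.fromSpec ⁻¹ᵁ Y.basicOpen s ↔ x ∈ Y.basicOpen s := by
      change hU.fromSpec (hU.primeIdealOf ⟨x, hx⟩) ∈ Y.basicOpen s ↔ _
      rw [hU.fromSpec_primeIdealOf]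
    rwa [hU.fromSpec_preimage_basicOpen] at h3
  rw [← h1, PrimeSpectrum.mem_basicOpen, not_not]

theorem algebra_isInvariant (hV : IsInvariantOpen H V) :
    letI := sectionAction hV
    Algebra.IsInvariant (invariants hV) Γ(X.left, V) H :=
  let := sectionAction hV
  ⟨fun b hb => ⟨⟨b, fun h => by simpa using! hb h⁻¹⟩, rfl⟩⟩

theorem isIntegral_subtype [Finite H] (hV : IsInvariantOpen H V) :
    (invariants hV).subtype.IsIntegral := by
  let := sectionAction hV
  have := algebra_isInvariant hV
  have := Algebra.IsInvariant.isIntegral (invariants hV) Γ(X.left, V) H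
  exact fun x => Algebra.IsIntegral.isIntegral x

/-- Two points of an invariant affine open which are not separated by invariant functions lie in
the same orbit. -/
theorem exists_apply_eq [Finite H] (hV : IsInvariantOpen H V) (hVa : IsAffineOpen V) {x y : X.left}
    (hx : x ∈ V) (hy : y ∈ V)
    (hxy : ∀ s ∈ invariants hV, x ∈ X.left.basicOpen s ↔ y ∈ X.left.basicOpen s) :
    ∃ h ∈ H, h.hom.left x = y := by
  let := sectionAction hV
  have := algebra_isInvariant hV
  have : SMulCommClass H (invariants hV) Γ(X.left, V) := ⟨fun h a b => by
    change pull hV h⁻¹ (a.1 * b) = a.1 * pull hV h⁻¹ b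
    rw [map_mul, a.2]⟩
  -- A finite group permutes transitively the primes over a given prime of the ring of invariants,
  -- and `hxy` says that the primes of `x` and `y` have the same contraction.
  obtain ⟨g, hg⟩ := Algebra.IsInvariant.exists_smul_of_under_eq (invariants hV) Γ(X.left, V) H
    (hVa.primeIdealOf ⟨x, hx⟩).asIdeal (hVa.primeIdealOf ⟨y, hy⟩).asIdeal (by
      ext s
      change s.1 ∈ (hVa.primeIdealOf ⟨x, hx⟩).asIdeal ↔ s.1 ∈ (hVa.primeIdealOf ⟨y, hy⟩).asIdeal
      rw [mem_primeIdealOf_iff, mem_primeIdealOf_iff, hxy _ s.2])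
  have hgx : g.1.hom.left x ∈ V := (hV.mem_iff g.2).mpr hx
  refine ⟨g, g.2, ?_⟩
  suffices h : hVa.primeIdealOf ⟨_, hgx⟩ = hVa.primeIdealOf ⟨y, hy⟩ by
    exact (hVa.fromSpec_primeIdealOf ⟨_, hgx⟩).symm.trans
      ((congrArg hVa.fromSpec h).trans (hVa.fromSpec_primeIdealOf ⟨y, hy⟩))
  refine PrimeSpectrum.ext (Ideal.ext fun s => ?_)
  rw [mem_primeIdealOf_iff, hg, Ideal.mem_pointwise_smul_iff_inv_smul_mem]
  have : g⁻¹ • s = pull hV g s := congrArg (fun g => pull hV g s) (inv_inv g)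
  rw [this, mem_primeIdealOf_iff, ← preimage_basicOpen_pull]
  rfl

end Action

end ZQuot

namespace ZQuot

/-! ### Localization at an invariant function -/

section Localization

variable {Y : Scheme.{u}} {V W : Y.Opens}

/-- The open `W` is a variable with an equation because the lemma is applied to preimages of basic
opens, which are basic opens only up to a propositional equality. -/
theorem exists_res_eq_pow_mul (hV : IsAffineOpen V) (f : Γ(Y, V)) (hW : W = Y.basicOpen f)
    (e : W ≤ V) (t : Γ(Y, W)) :
    ∃ (n : ℕ) (s : Γ(Y, V)),
      Y.presheaf.map (homOfLE e).op s = Y.presheaf.map (homOfLE e).op f ^ n * t := by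
  subst hW
  exact exists_eq_pow_mul_of_isAffineOpen Y V hV f t

theorem exists_pow_mul_eq_zero (hV : IsAffineOpen V) (f : Γ(Y, V)) (hW : W = Y.basicOpen f)
    (e : W ≤ V) (s : Γ(Y, V)) (hs : Y.presheaf.map (homOfLE e).op s = 0) :
    ∃ n : ℕ, f ^ n * s = 0 := by
  subst hW
  exact exists_pow_mul_eq_zero_of_res_basicOpen_eq_zero_of_isAffineOpen Y hV s f hs

theorem isUnit_res_basicOpen (f : Γ(Y, V)) (hW : W = Y.basicOpen f) (e : W ≤ V) :
    IsUnit (Y.presheaf.map (homOfLE e).op f) := by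
  subst hW
  exact RingedSpace.isUnit_res_basicOpen _ f

end Localization

section Lift

variable {S : Scheme.{u}} {X : Over S} {H : Subgroup (Aut X)} {V W : X.left.Opens}

/-- An invariant function on `D(f)`, for `f` invariant, extends as an invariant function after
multiplication by a power of `f`. -/
theorem exists_invariant_res_eq_pow_mul [Finite H] (hV : IsInvariantOpen H V)
    (hVa : IsAffineOpen V) {f : Γ(X.left, V)} (hf : f ∈ invariants hV)
    (hWf : W = X.left.basicOpen f) (hW : IsInvariantOpen H W) (e : W ≤ V)
    {t : Γ(X.left, W)} (ht : t ∈ invariants hW) :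
    ∃ (n : ℕ) (s : Γ(X.left, V)), s ∈ invariants hV ∧
      X.left.presheaf.map (homOfLE e).op s = X.left.presheaf.map (homOfLE e).op f ^ n * t := by
  obtain ⟨n, s, hs⟩ := exists_res_eq_pow_mul hVa f hWf e t
  have hfW := res_mem_invariants hV hW e hf
  -- On D(f) the extension `s` restricts to an invariant function, so each difference h s - s is
  -- killed by a power of `f`. As `H` is finite, one power of `f` serves for all `h`, and
  -- multiplying `s` by it gives an invariant.
  have key (h : H) : ∃ m : ℕ, f ^ m * (pull hV h s - s) = 0 := by
    refine exists_pow_mul_eq_zero hVa f hWf e _ ?_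
    rw [map_sub, ← pull_res hV hW e, hs, map_mul, map_pow, ht h, hfW h, sub_self]
  choose m hm using key
  cases nonempty_fintype H
  refine ⟨(∑ h, m h) + n, f ^ (∑ h, m h) * s, fun h => ?_, ?_⟩
  · rw [map_mul, map_pow, hf h, ← sub_eq_zero, ← mul_sub,
      ← Nat.sub_add_cancel (Finset.single_le_sum (f := m) (fun _ _ => Nat.zero_le _)
        (Finset.mem_univ h)), pow_add, mul_assoc, hm, mul_zero]
  · rw [map_mul, map_pow, hs, pow_add, mul_assoc]

end Lift

/-! ### Being a quotient is local on the target -/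

section Criterion

variable {S : Scheme.{u}} {X Z : Over S} {H : Subgroup (Aut X)} {π : X ⟶ Z} {U : Z.left.Opens}

theorem isInvariantOpen_preimage (hπ : ∀ h ∈ H, h.hom ≫ π = π) (U : Z.left.Opens) :
    IsInvariantOpen H (π.left ⁻¹ᵁ U) := fun h hh => by
  rw [← Scheme.Hom.comp_preimage, ← Over.comp_left, hπ h hh]

theorem app_mem_invariants (hπ : ∀ h ∈ H, h.hom ≫ π = π) (U : Z.left.Opens) (t : Γ(Z.left, U)) :
    π.left.app U t ∈ invariants (isInvariantOpen_preimage hπ U) := fun h => by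
  have h1 : h.1.hom.left ≫ π.left = π.left := by rw [← Over.comp_left, hπ h.1 h.2]
  simp only [pull, Scheme.Hom.app_eq_appLE]
  rw [← CommRingCat.comp_apply, Scheme.Hom.appLE_comp_appLE]
  simp only [h1]

variable (H π U) in
/-- An affine open `U` in `Z` with affine preimage, over which the functions are the invariant
functions on the preimage. -/
structure IsQuotientOpen (hπ : ∀ h ∈ H, h.hom ≫ π = π) : Prop where
  isAffineOpen : IsAffineOpen U
  isAffineOpen_preimage : IsAffineOpen (π.left ⁻¹ᵁ U)
  injective : Function.Injective (π.left.app U)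
  sections : ∀ s ∈ invariants (isInvariantOpen_preimage hπ U), ∃ t, π.left.app U t = s

namespace IsQuotientOpen

variable {hπ : ∀ h ∈ H, h.hom ≫ π = π}

theorem isIntegral [Finite H] (hU : IsQuotientOpen H π U hπ) : (π.left.app U).hom.IsIntegral := by
  have h1 : (π.left.app U).hom = (invariants (isInvariantOpen_preimage hπ U)).subtype.comp
    ((π.left.app U).hom.codRestrict _ (app_mem_invariants hπ U)) := rfl
  rw [h1]
  refine RingHom.IsIntegral.trans _ _ (RingHom.isIntegral_of_surjective _ fun s => ?_)
    (isIntegral_subtype _)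
  obtain ⟨t, ht⟩ := hU.sections s.1 s.2
  exact ⟨t, Subtype.ext ht⟩

theorem app_res {U' : Z.left.Opens} (e : U' ≤ U) (t : Γ(Z.left, U)) :
    π.left.app U' (Z.left.presheaf.map (homOfLE e).op t) =
      X.left.presheaf.map (homOfLE (π.left.preimage_mono e)).op (π.left.app U t) := by
  rw [← CommRingCat.comp_apply, ← CommRingCat.comp_apply, Scheme.Hom.naturality]
  rfl

/-- Invariants of a finite group commute with inverting an invariant element. -/
theorem basicOpen [Finite H] (hU : IsQuotientOpen H π U hπ) (f : Γ(Z.left, U)) :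
    IsQuotientOpen H π (Z.left.basicOpen f) hπ := by
  have e := Z.left.basicOpen_le f
  have hpre : π.left ⁻¹ᵁ Z.left.basicOpen f = X.left.basicOpen (π.left.app U f) :=
    Scheme.preimage_basicOpen ..
  refine ⟨hU.isAffineOpen.basicOpen f, hpre ▸ hU.isAffineOpen_preimage.basicOpen _, ?_, ?_⟩
  · refine (injective_iff_map_eq_zero _).mpr fun t ht => ?_
    obtain ⟨n, s, hs⟩ := exists_res_eq_pow_mul hU.isAffineOpen f rfl e t
    obtain ⟨m, hm⟩ := exists_pow_mul_eq_zero hU.isAffineOpen_preimage (π.left.app U f) hpre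
      (π.left.preimage_mono e) (π.left.app U s) (by
        rw [← app_res e, hs, map_mul, ht, mul_zero])
    have h0 : f ^ m * s = 0 := hU.injective (by rw [map_mul, map_pow, hm, map_zero])
    have h1 := congr(Z.left.presheaf.map (homOfLE e).op $h0)
    rw [map_mul, hs, ← mul_assoc, map_pow, ← pow_add, map_zero] at h1
    exact (((isUnit_res_basicOpen f rfl e).pow _).mul_right_eq_zero).mp h1
  · intro t ht
    obtain ⟨n, s, hs, hst⟩ := exists_invariant_res_eq_pow_mul (isInvariantOpen_preimage hπ U)
      hU.isAffineOpen_preimage (app_mem_invariants hπ U f) hpre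
      (isInvariantOpen_preimage hπ _) (π.left.preimage_mono e) ht
    obtain ⟨s, rfl⟩ := hU.sections s hs
    obtain ⟨v, hv⟩ := (isUnit_res_basicOpen f rfl e).pow n
    refine ⟨v⁻¹ * Z.left.presheaf.map (homOfLE e).op s, ?_⟩
    rw [map_mul, app_res e, hst, ← app_res e, ← map_pow, ← hv, ← mul_assoc, ← map_mul,
      Units.inv_mul, map_one, one_mul]

end IsQuotientOpen

theorem isIntegral_morphismRestrict_app {X Y : Scheme.{u}} (f : X ⟶ Y) {U : Y.Opens}
    (h : (f.app U).hom.IsIntegral) : ((f ∣_ U).app ⊤).hom.IsIntegral := by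
  have h1 : (f.app (U.ι ''ᵁ ⊤)).hom.IsIntegral := by rwa [Scheme.Opens.ι_image_top]
  have h2 := morphismRestrict_app f U ⊤
  have h3 {A B : X.Opens} (e : A = B) : (X.presheaf.map (eqToHom e).op).hom.IsIntegral := by
    subst e
    exact RingHom.isIntegral_of_surjective _ (ConcreteCategory.bijective_of_isIso _).surjective
  exact (congrArg (fun g => (CommRingCat.Hom.hom g).IsIntegral) h2).mpr
    (RingHom.IsIntegral.trans _ _ h1 (h3 _))

theorem isIntegralHom_of_isQuotientOpen [Finite H] (hπ : ∀ h ∈ H, h.hom ≫ π = π)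
    (hZ : ∀ z : Z.left, ∃ U, z ∈ U ∧ IsQuotientOpen H π U hπ) : IsIntegralHom π.left := by
  choose U hzU hU using hZ
  have hcov : ⨆ z, U z = ⊤ := top_le_iff.mp fun z _ =>
    TopologicalSpace.Opens.mem_iSup.mpr ⟨z, hzU z⟩
  refine (@HasAffineProperty.iff_of_iSup_eq_top _ _ IsIntegralHom.hasAffineProperty _ _ π.left _
    (fun z => (⟨U z, (hU z).isAffineOpen⟩ : Z.left.affineOpens)) hcov).mpr ?_
  refine fun z => ⟨(hU z).isAffineOpen_preimage, ?_⟩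
  exact isIntegral_morphismRestrict_app π.left (hU z).isIntegral

theorem surjective_of_isQuotientOpen [Finite H] (hπ : ∀ h ∈ H, h.hom ≫ π = π)
    (hZ : ∀ z : Z.left, ∃ U, z ∈ U ∧ IsQuotientOpen H π U hπ) :
    Function.Surjective π.left := by
  have := isIntegralHom_of_isQuotientOpen hπ hZ
  intro z
  obtain ⟨U, hzU, hU⟩ := hZ z
  have hsur := RingHom.IsIntegral.comap_surjective hU.isIntegral hU.injective
  obtain ⟨p, hp⟩ := hsur (hU.isAffineOpen.primeIdealOf ⟨z, hzU⟩)
  refine ⟨hU.isAffineOpen_preimage.fromSpec p, ?_⟩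
  have h1 := IsAffineOpen.SpecMap_appLE_fromSpec π.left hU.isAffineOpen hU.isAffineOpen_preimage
    le_rfl
  simp only [Scheme.Hom.appLE_eq_app] at h1
  exact (congr($h1 p)).symm.trans
    ((congrArg _ hp).trans (hU.isAffineOpen.fromSpec_primeIdealOf ⟨z, hzU⟩))

/-- A morphism which is a quotient locally on the target is a quotient. -/
theorem isQuotient_of_isQuotientOpen [Finite H] (hπ : ∀ h ∈ H, h.hom ≫ π = π)
    (hZ : ∀ z : Z.left, ∃ U, z ∈ U ∧ IsQuotientOpen H π U hπ) : IsQuotient H π := by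
  have := isIntegralHom_of_isQuotientOpen hπ hZ
  have hbasis (U : Z.left.Opens) (z : Z.left) (hz : z ∈ U) :
      ∃ W ≤ U, z ∈ W ∧ IsQuotientOpen H π W hπ := by
    obtain ⟨W, hzW, hW⟩ := hZ z
    obtain ⟨f, hfU, hzf⟩ := hW.isAffineOpen.exists_basicOpen_le ⟨z, hz⟩ hzW
    exact ⟨_, hfU, hzf, hW.basicOpen f⟩
  choose W hWU hzW hW using hbasis
  have hinj (U : Z.left.Opens) : Function.Injective (π.left.app U) := by
    refine fun s t hst => ?_
    refine Z.left.sheaf.eq_of_locally_eq' (fun z : U => W U z.1 z.2) U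
      (fun z => homOfLE (hWU U z.1 z.2))
      (fun z hz => TopologicalSpace.Opens.mem_iSup.mpr ⟨⟨z, hz⟩, hzW U z hz⟩) s t fun z => ?_
    refine (hW U z.1 z.2).injective ?_
    exact (IsQuotientOpen.app_res _ s).trans
      ((congrArg _ hst).trans (IsQuotientOpen.app_res _ t).symm)
  refine ⟨inferInstance, hπ, ?_, fun x y hxy => ?_, hinj, fun U s hs => ?_⟩
  -- Integral morphisms are closed, and a closed continuous surjection is a quotient map.
  · exact π.left.isClosedMap.isQuotientMap π.left.continuous (surjective_of_isQuotientOpen hπ hZ)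
  · obtain ⟨U, hzU, hU⟩ := hZ (π.left x)
    refine exists_apply_eq (isInvariantOpen_preimage hπ U) hU.isAffineOpen_preimage
      (show x ∈ π.left ⁻¹ᵁ U from hzU) (show π.left y ∈ U from hxy ▸ hzU) fun s hs => ?_
    obtain ⟨t, rfl⟩ := hU.sections s hs
    rw [← Scheme.preimage_basicOpen]
    change π.left x ∈ Z.left.basicOpen t ↔ π.left y ∈ Z.left.basicOpen t
    rw [hxy]
  · have hs' : s ∈ invariants (isInvariantOpen_preimage hπ U) := fun h => hs h.1 h.2
    have hloc (z : U) : ∃ t, π.left.app (W U z.1 z.2) t =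
        X.left.presheaf.map (homOfLE (π.left.preimage_mono (hWU U z.1 z.2))).op s :=
      (hW U z.1 z.2).sections _ (res_mem_invariants _ _ _ hs')
    choose t ht using hloc
    -- The local functions agree on overlaps because their pullbacks to X do; this uses injectivity
    -- of pullback over all opens, since the overlaps need not be among the chosen affine ones.
    obtain ⟨t', ht', -⟩ := Z.left.sheaf.existsUnique_gluing' (fun z : U => W U z.1 z.2) U
      (fun z => homOfLE (hWU U z.1 z.2))
      (fun z hz => TopologicalSpace.Opens.mem_iSup.mpr ⟨⟨z, hz⟩, hzW U z hz⟩) t (fun z z' => by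
        refine hinj _ ?_
        refine (IsQuotientOpen.app_res inf_le_left (t z)).trans
          (Eq.trans ?_ (IsQuotientOpen.app_res inf_le_right (t z')).symm)
        rw [ht, ht, ← CommRingCat.comp_apply, ← CommRingCat.comp_apply, ← Functor.map_comp,
          ← Functor.map_comp]
        rfl)
    refine ⟨t', ?_⟩
    refine X.left.sheaf.eq_of_locally_eq' (fun z : U => π.left ⁻¹ᵁ W U z.1 z.2) (π.left ⁻¹ᵁ U)
      (fun z => homOfLE (π.left.preimage_mono (hWU U z.1 z.2)))
      (fun x hx => TopologicalSpace.Opens.mem_iSup.mpr ⟨⟨π.left x, hx⟩, hzW U _ hx⟩)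
      _ _ fun z => ?_
    exact (IsQuotientOpen.app_res _ t').symm.trans ((congrArg _ (ht' z)).trans (ht z))

theorem IsQuotient.isQuotientOpen (hq : IsQuotient H π) (hU : IsAffineOpen U) :
    IsQuotientOpen H π U hq.invariant :=
  have := hq.affine
  ⟨hU, hU.preimage _, hq.injective U, fun s hs => hq.sections U s fun h hh => hs ⟨h, hh⟩⟩

theorem IsQuotient.exists_isQuotientOpen (hq : IsQuotient H π) (z : Z.left) :
    ∃ U, z ∈ U ∧ IsQuotientOpen H π U hq.invariant := by
  obtain ⟨U, hU, hz, -⟩ := exists_isAffineOpen_mem_and_subset (x := z) (U := ⊤) trivial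
  exact ⟨U, hz, hq.isQuotientOpen hU⟩

theorem IsQuotient.isIntegralHom [Finite H] (hq : IsQuotient H π) : IsIntegralHom π.left :=
  isIntegralHom_of_isQuotientOpen hq.invariant hq.exists_isQuotientOpen

end Criterion

end ZQuot

namespace ZQuot

/-! ### Two criteria for open immersions and localizations -/

section OpenImmersion

/-- An injective morphism which is locally on the source an open immersion is an open immersion. -/
theorem isOpenImmersion_of_injective_of_local {Y Y' : Scheme.{u}} (f : Y' ⟶ Y)
    (hf : Function.Injective f)
    (h : ∀ x : Y', ∃ (T : Scheme.{u}) (g : T ⟶ Y'), IsOpenImmersion g ∧ IsOpenImmersion (g ≫ f) ∧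
      x ∈ Set.range g) : IsOpenImmersion f := by
  have hopen : IsOpenMap f := by
    refine isOpenMap_iff_nhds_le.mpr fun x => ?_
    obtain ⟨T, g, hg, hgf, t, rfl⟩ := h x
    have h1 : nhds (g t) = Filter.map g (nhds t) := (g.isOpenEmbedding.map_nhds_eq t).symm
    rw [h1, Filter.map_map]
    exact ((g ≫ f).isOpenEmbedding.map_nhds_eq t).ge
  refine IsOpenImmersion.iff_isIso_stalkMap.mpr
    ⟨.of_continuous_injective_isOpenMap f.continuous hf hopen, fun x => ?_⟩
  obtain ⟨T, g, hg, hgf, t, rfl⟩ := h x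
  have h1 := Scheme.Hom.stalkMap_comp g f t
  have h2 : IsIso ((g ≫ f).stalkMap t) := inferInstance
  have h3 : IsIso (g.stalkMap t) := inferInstance
  have h2 : IsIso (f.stalkMap (g t) ≫ g.stalkMap t) := h1 ▸ h2
  exact IsIso.of_isIso_comp_right (f.stalkMap (g t)) (g.stalkMap t)

/-- The hypotheses say that the kernel and the cokernel of B → B' are `f`-power torsion, so B and B'
have the same localization at `f`. -/
theorem isLocalization_away_comp {B B' : Type u} [CommRing B] [CommRing B'] [Algebra B B'] (f : B)
    (hinj : ∀ b : B, algebraMap B B' b = 0 → ∃ n : ℕ, f ^ n * b = 0)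
    (hsurj : ∀ b' : B', ∃ (n : ℕ) (b : B), algebraMap B B' b = algebraMap B B' f ^ n * b') :
    IsLocalization.Away f (Localization.Away (algebraMap B B' f)) := by
  set L := Localization.Away (algebraMap B B' f)
  have hu : IsUnit (algebraMap B L f) := by
    rw [IsScalarTower.algebraMap_apply B B' L]
    exact IsLocalization.Away.algebraMap_isUnit _
  refine ⟨⟨?_, ?_, ?_⟩⟩
  · rintro ⟨_, n, rfl⟩
    rw [map_pow]
    exact hu.pow n
  · intro z
    obtain ⟨⟨b', ⟨_, m, rfl⟩⟩, hz⟩ := IsLocalization.surj (Submonoid.powers (algebraMap B B' f)) z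
    obtain ⟨n, b, hb⟩ := hsurj b'
    refine ⟨(b, ⟨f ^ (n + m), n + m, rfl⟩), ?_⟩
    simp only at hz ⊢
    rw [IsScalarTower.algebraMap_apply B B' L, IsScalarTower.algebraMap_apply B B' L, hb, map_pow,
      pow_add, map_mul (algebraMap B' L), map_mul, ← hz]
    ring
  · intro x y hxy
    rw [IsScalarTower.algebraMap_apply B B' L, IsScalarTower.algebraMap_apply B B' L] at hxy
    obtain ⟨⟨_, m, rfl⟩, hm⟩ := IsLocalization.exists_of_eq
      (M := Submonoid.powers (algebraMap B B' f)) hxy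
    obtain ⟨n, hn⟩ := hinj (f ^ m * (x - y)) (by
      rw [map_mul, map_pow, map_sub, mul_sub, sub_eq_zero]; exact hm)
    refine ⟨⟨f ^ (n + m), n + m, rfl⟩, ?_⟩
    simp only
    linear_combination hn

end OpenImmersion

/-! ### The diagram of spectra of rings of invariants -/

section Charts

variable {S : Scheme.{u}} {X : Over S} {H : Subgroup (Aut X)}

variable (H) in
/-- The invariant affine opens of `X`. -/
structure InvariantAffine : Type u where
  /-- The underlying open subset. -/
  opens : X.left.Opens
  isInvariant : IsInvariantOpen H opens
  isAffine : IsAffineOpen opens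

instance : PartialOrder (InvariantAffine H) :=
  PartialOrder.lift InvariantAffine.opens fun V W h => by
    cases V; cases W; congr

namespace InvariantAffine

/-- Restriction of invariant functions. -/
def res {V W : InvariantAffine H} (e : V ≤ W) :
    invariants W.isInvariant →+* invariants V.isInvariant :=
  ((X.left.presheaf.map (homOfLE (show V.opens ≤ W.opens from e)).op).hom.comp
    (invariants W.isInvariant).subtype).codRestrict _ fun s => res_mem_invariants _ _ _ s.2

variable (H) in
/-- The diagram of the spectra of the rings of invariant functions. -/
def diagram : InvariantAffine H ⥤ Scheme.{u} where
  obj V := Spec (.of (invariants V.isInvariant))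
  map e := Spec.map (CommRingCat.ofHom (res (leOfHom e)))
  map_id V := by
    rw [← Spec.map_id]
    congr 1
    ext s
    exact congr($(X.left.presheaf.map_id _) s.1)
  map_comp {U V W} e f := by
    rw [← Spec.map_comp]
    congr 1
    ext s
    exact congr($(X.left.presheaf.map_comp (homOfLE (show V.opens ≤ W.opens from leOfHom f)).op
      (homOfLE (show U.opens ≤ V.opens from leOfHom e)).op) s.1)

/-- The quotient map of an invariant affine open. -/
def proj (V : InvariantAffine H) : V.opens.toScheme ⟶ (diagram H).obj V :=
  V.opens.toSpecΓ ≫ Spec.map (CommRingCat.ofHom (invariants V.isInvariant).subtype)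

theorem mem_proj (V : InvariantAffine H) (x : V.opens) (s : invariants V.isInvariant) :
    s ∈ PrimeSpectrum.asIdeal (V.proj x) ↔ x.1 ∉ X.left.basicOpen s.1 :=
  mem_primeIdealOf_iff V.isAffine x.2 s.1

theorem proj_eq_iff [Finite H] (V : InvariantAffine H) (x y : V.opens) :
    V.proj x = V.proj y ↔ ∃ h ∈ H, h.hom.left x.1 = y.1 := by
  constructor
  · intro hxy
    refine exists_apply_eq V.isInvariant V.isAffine x.2 y.2 fun s hs => ?_
    rw [← not_iff_not, ← mem_proj V x ⟨s, hs⟩, ← mem_proj V y ⟨s, hs⟩, hxy]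
  · rintro ⟨h, hh, hxy⟩
    refine PrimeSpectrum.ext (Ideal.ext fun s => ?_)
    rw [mem_proj, mem_proj, ← hxy]
    have := V.isInvariant.basicOpen s.2
    rw [this.mem_iff hh]

theorem proj_surjective [Finite H] (V : InvariantAffine H) : Function.Surjective V.proj := by
  have h1 : Function.Surjective V.opens.toSpecΓ := by
    rw [← V.isAffine.isoSpec_hom]
    exact V.isAffine.isoSpec.hom.surjective
  exact (RingHom.IsIntegral.comap_surjective (isIntegral_subtype V.isInvariant)
    Subtype.val_injective).comp h1

theorem isClosedMap_proj [Finite H] (V : InvariantAffine H) : IsClosedMap V.proj := by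
  have h1 : IsClosedMap V.opens.toSpecΓ := by
    rw [← V.isAffine.isoSpec_hom]
    exact V.isAffine.isoSpec.hom.isClosedMap
  have : IsIntegralHom (Spec.map (CommRingCat.ofHom (invariants V.isInvariant).subtype)) :=
    IsIntegralHom.SpecMap_iff.mpr (isIntegral_subtype V.isInvariant)
  exact (Spec.map (CommRingCat.ofHom (invariants V.isInvariant).subtype)).isClosedMap.comp h1

theorem homOfLE_proj {V W : InvariantAffine H} (e : V ⟶ W) :
    X.left.homOfLE (leOfHom e) ≫ W.proj = V.proj ≫ (diagram H).map e := by
  simp only [proj, diagram, Category.assoc]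
  rw [← Scheme.Opens.toSpecΓ_SpecMap_presheaf_map_assoc, ← Spec.map_comp, ← Spec.map_comp]
  rfl

theorem map_proj {V W : InvariantAffine H} (e : V ⟶ W) (x : V.opens) :
    (diagram H).map e (V.proj x) = W.proj ⟨x.1, leOfHom e x.2⟩ :=
  (Scheme.Hom.comp_apply ..).symm.trans (congr($(homOfLE_proj e) x).symm.trans
    ((Scheme.Hom.comp_apply ..).trans (congrArg W.proj (Subtype.ext (by
      exact congr($(X.left.homOfLE_ι (leOfHom e)) x))))))

/-- The complement of V in W is closed and stable under H. Its image under the closed map `proj` is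
therefore closed and misses the image of `x`, as fibres of `proj` are orbits; a basic open separates
the two. -/
theorem exists_basicOpen_le [Finite H] {V W : InvariantAffine H} (e : V ≤ W) (x : V.opens) :
    ∃ s : invariants W.isInvariant, x.1 ∈ X.left.basicOpen s.1 ∧
      X.left.basicOpen s.1 ≤ V.opens := by
  let C : Set W.opens.toScheme := {y | y.1 ∉ V.opens}
  have hC : IsClosed C := by
    refine ⟨?_⟩
    have : Cᶜ = W.opens.ι ⁻¹ᵁ V.opens := Set.ext fun y => not_not
    rw [this]
    exact (W.opens.ι ⁻¹ᵁ V.opens).isOpen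
  have h1 := W.isClosedMap_proj C hC
  have h2 : W.proj ⟨x.1, e x.2⟩ ∈ (W.proj '' C)ᶜ := by
    rintro ⟨y, hy, hxy⟩
    obtain ⟨h, hh, hyx⟩ := (W.proj_eq_iff _ _).mp hxy
    exact hy ((V.isInvariant.mem_iff hh).mp (hyx ▸ x.2))
  obtain ⟨_, ⟨s, rfl⟩, hxs, hs⟩ :=
    PrimeSpectrum.isTopologicalBasis_basic_opens.exists_subset_of_mem_open h2 h1.isOpen_compl
  refine ⟨s, not_not.mp fun h => hxs ((W.mem_proj _ _).mpr h), fun y hy => ?_⟩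
  have hyW : y ∈ W.opens := X.left.basicOpen_le _ hy
  by_contra hyV
  exact hs (show W.proj ⟨y, hyW⟩ ∈ PrimeSpectrum.basicOpen s from
    fun h => (W.mem_proj ⟨y, hyW⟩ s).mp h hy) ⟨⟨y, hyW⟩, hyV, rfl⟩

theorem isLocalization_away_res [Finite H] {V W : InvariantAffine H} (e : V ≤ W)
    (f : invariants W.isInvariant) (hfV : X.left.basicOpen f.1 ≤ V.opens) :
    letI := (res e).toAlgebra
    IsLocalization.Away f (Localization.Away (algebraMap (invariants W.isInvariant)
      (invariants V.isInvariant) f)) := by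
  let := (res e).toAlgebra
  have hf' : X.left.basicOpen (res e f).1 = X.left.basicOpen f.1 :=
    (Scheme.basicOpen_res ..).trans (inf_eq_right.mpr hfV)
  have hD := W.isInvariant.basicOpen f.2
  have hDW := X.left.basicOpen_le f.1
  have e' : V.opens ≤ W.opens := e
  have hresres (s : Γ(X.left, W.opens)) : X.left.presheaf.map (homOfLE hfV).op
      (X.left.presheaf.map (homOfLE e').op s) = X.left.presheaf.map (homOfLE hDW).op s := by
    rw [← CommRingCat.comp_apply, ← Functor.map_comp]
    rfl
  refine isLocalization_away_comp f (fun b hb => ?_) (fun b' => ?_)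
  · obtain ⟨n, hn⟩ := exists_pow_mul_eq_zero W.isAffine f.1 rfl hDW b.1 (by
      rw [← hresres, show X.left.presheaf.map (homOfLE e').op b.1 = 0 from congr($(hb).1),
        map_zero])
    exact ⟨n, Subtype.ext hn⟩
  · obtain ⟨n, s, hs, hsb⟩ := exists_invariant_res_eq_pow_mul W.isInvariant W.isAffine f.2 rfl hD
      hDW (res_mem_invariants V.isInvariant hD hfV b'.2)
    obtain ⟨m, hm⟩ := exists_pow_mul_eq_zero V.isAffine (res e f).1 hf'.symm hfV
      (X.left.presheaf.map (homOfLE e').op s - (res e f).1 ^ n * b'.1)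
      (by rw [map_sub, map_mul, map_pow, hresres, hsb, sub_eq_zero]
          congr 2
          exact (hresres f.1).symm)
    refine ⟨m + n, f ^ m * ⟨s, hs⟩, Subtype.ext ?_⟩
    have h1 : (res e (f ^ m * ⟨s, hs⟩)).1 = (res e f).1 ^ m *
        X.left.presheaf.map (homOfLE e').op s := by
      rw [map_mul, map_pow]; rfl
    change (res e (f ^ m * ⟨s, hs⟩)).1 = (res e f).1 ^ (m + n) * b'.1
    rw [h1]
    linear_combination hm

/-- Injectivity holds because the points of both spectra are orbits. Locally the map is an open
immersion because, for an invariant `f` with D(f) ⊆ V, the invariants on V and on W have the same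
localization at `f`. -/
theorem isOpenImmersion_map [Finite H] {V W : InvariantAffine H} (e : V ⟶ W) :
    IsOpenImmersion ((diagram H).map e) := by
  have e' := leOfHom e
  refine isOpenImmersion_of_injective_of_local _ ?_ fun p => ?_
  · intro p q hpq
    obtain ⟨x, rfl⟩ := V.proj_surjective p
    obtain ⟨y, rfl⟩ := V.proj_surjective q
    have h := (map_proj e x).symm.trans (hpq.trans (map_proj e y))
    exact (V.proj_eq_iff x y).mpr ((W.proj_eq_iff _ _).mp h)
  · obtain ⟨x, rfl⟩ := V.proj_surjective p
    obtain ⟨f, hxf, hfV⟩ := exists_basicOpen_le e' x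
    let := (res e').toAlgebra
    have hloc := isLocalization_away_res e' f hfV
    let R := Localization.Away (algebraMap (invariants W.isInvariant) (invariants V.isInvariant) f)
    refine ⟨_, Spec.map (CommRingCat.ofHom (algebraMap (invariants V.isInvariant) R)),
      IsOpenImmersion.of_isLocalization (algebraMap (invariants W.isInvariant) _ f), ?_, ?_⟩
    · have h1 : Spec.map (CommRingCat.ofHom (algebraMap (invariants V.isInvariant) R)) ≫
          (diagram H).map e =
          Spec.map (CommRingCat.ofHom (algebraMap (invariants W.isInvariant) R)) := by
        refine (Spec.map_comp ..).symm.trans (congrArg Spec.map ?_)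
        rfl
      exact (congrArg (fun g => IsOpenImmersion g) h1).mpr (IsOpenImmersion.of_isLocalization f)
    · have h1 := PrimeSpectrum.localization_away_comap_range R
        (algebraMap (invariants W.isInvariant) (invariants V.isInvariant) f)
      refine h1.ge fun h => (V.mem_proj x _).mp h ?_
      exact (Scheme.basicOpen_res ..).ge ⟨x.2, hxf⟩

end InvariantAffine
end Charts

end ZQuot

namespace ZQuot

/-! ### Charts of the glued scheme -/

section Chart

theorem exists_appLE_eq_of_chart {X Z : Scheme.{u}} (π : X ⟶ Z) {U : Z.Opens} {V : X.Opens}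
    (e : V ≤ π ⁻¹ᵁ U) {B : CommRingCat.{u}} (ρ : B ⟶ Γ(X, V)) (i : Spec B ⟶ Z)
    [IsOpenImmersion i] (hi : i.opensRange = U)
    (hc : V.ι ≫ π = V.toSpecΓ ≫ Spec.map ρ ≫ i) :
    ∃ ε : Γ(Z, U) ⟶ B, IsIso ε ∧ π.appLE U V e = ε ≫ ρ := by
  have hi' : (⊤ : (Spec B).Opens) ≤ i ⁻¹ᵁ U := by
    rw [← hi, Scheme.Hom.preimage_opensRange]
  have hiso : IsIso (i.appLE U ⊤ hi') := by
    have h1 : IsIso (i.app U) := i.isIso_app U hi.ge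
    have h2 : ⊤ = i ⁻¹ᵁ U := top_le_iff.mp hi' |>.symm
    rw [Scheme.Hom.appLE]
    have : IsIso ((Spec B).presheaf.map (homOfLE hi').op) := by
      have : homOfLE hi' = eqToHom h2 := rfl
      rw [this]
      infer_instance
    infer_instance
  refine ⟨i.appLE U ⊤ hi' ≫ (Scheme.ΓSpecIso B).hom, inferInstance, ?_⟩
  have h1 : (⊤ : V.toScheme.Opens) ≤ V.ι ⁻¹ᵁ V := by simp
  have h2 : V.ι.appLE V ⊤ h1 = V.topIso.inv := by
    rw [Scheme.Opens.ι_appLE]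
    rfl
  rw [← cancel_mono V.topIso.inv, Category.assoc, Category.assoc,
    ← Scheme.ΓSpecIso_naturality_assoc, ← Scheme.Opens.toSpecΓ_appTop]
  have h3 := Scheme.Hom.appLE_comp_appLE V.ι π U V ⊤ e h1
  have h4 := Scheme.Hom.appLE_comp_appLE (V.toSpecΓ ≫ Spec.map ρ) i U ⊤ ⊤ hi' le_top
  simp only [hc, h2] at h3
  simp only [Category.assoc] at h4
  rw [h3, ← h4]
  congr 1
  rw [← Scheme.Hom.appLE_comp_appLE V.toSpecΓ (Spec.map ρ) ⊤ ⊤ ⊤ le_top le_top]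
  simp [Scheme.Hom.appLE]
  rfl

variable {S : Scheme.{u}} {X Z : Over S} {H : Subgroup (Aut X)} {π : X ⟶ Z}

theorem isQuotientOpen_of_chart (hπ : ∀ h ∈ H, h.hom ≫ π = π) {U : Z.left.Opens}
    {V : X.left.Opens} (hUV : π.left ⁻¹ᵁ U = V) (hV : IsInvariantOpen H V) (hVa : IsAffineOpen V)
    (i : Spec (.of (invariants hV)) ⟶ Z.left) [IsOpenImmersion i] (hi : i.opensRange = U)
    (hc : V.ι ≫ π.left = V.toSpecΓ ≫ Spec.map (CommRingCat.ofHom (invariants hV).subtype) ≫ i) :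
    IsQuotientOpen H π U hπ := by
  subst hUV
  obtain ⟨ε, hε, h⟩ := exists_appLE_eq_of_chart π.left le_rfl _ i hi hc
  rw [Scheme.Hom.appLE_eq_app] at h
  refine ⟨hi ▸ isAffineOpen_opensRange i, hVa, ?_, fun s hs => ?_⟩
  · rw [h]
    exact Function.Injective.comp (g := (invariants hV).subtype) Subtype.val_injective
      (ConcreteCategory.bijective_of_isIso ε).injective
  · obtain ⟨t, ht⟩ := (ConcreteCategory.bijective_of_isIso ε).surjective ⟨s, hs⟩
    refine ⟨t, ?_⟩
    rw [h]
    exact congrArg Subtype.val ht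

end Chart

/-! ### Gluing the local quotients -/

section Existence

variable {S : Scheme.{u}} {X : Over S} {H : Subgroup (Aut X)}

open InvariantAffine

instance (V W : InvariantAffine H) [Finite H] (e : V ⟶ W) :
    IsOpenImmersion ((diagram H).map e) := isOpenImmersion_map e

theorem resLE_toSpecΓ_of_appLE_eq {Y : Scheme.{u}} (f : Y ⟶ Y) {V : Y.Opens} (e : V ≤ f ⁻¹ᵁ V)
    {B : CommRingCat.{u}} (ρ : B ⟶ Γ(Y, V)) (h : ρ ≫ f.appLE V V e = ρ) :
    f.resLE V V e ≫ V.toSpecΓ ≫ Spec.map ρ = V.toSpecΓ ≫ Spec.map ρ := by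
  rw [← Scheme.Opens.toSpecΓ_SpecMap_appLE_assoc, ← Spec.map_comp, h]

theorem InvariantAffine.resLE_proj (V : InvariantAffine H) {h : Aut X} (hh : h ∈ H) :
    h.hom.left.resLE V.opens V.opens (V.isInvariant h hh).ge ≫ V.proj = V.proj :=
  resLE_toSpecΓ_of_appLE_eq _ _ _ (by ext s; exact s.2 ⟨h, hh⟩)

theorem le_preimage_top {Y Y' : Scheme.{u}} (f : Y ⟶ Y') (V : Y.Opens) : V ≤ f ⁻¹ᵁ ⊤ := le_top

theorem hom_appLE_mem_invariants {V : X.left.Opens} (hV : IsInvariantOpen H V) (t : Γ(S, ⊤)) :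
    X.hom.appLE ⊤ V (le_preimage_top _ _) t ∈ invariants hV := fun h => by
  have h1 : h.1.hom.left ≫ X.hom = X.hom := Over.w h.1.hom
  simp only [pull]
  rw [← CommRingCat.comp_apply, Scheme.Hom.appLE_comp_appLE]
  simp only [h1]

/-- Functions on the base, as invariant functions. -/
def baseToInvariants {V : X.left.Opens} (hV : IsInvariantOpen H V) : Γ(S, ⊤) →+* invariants hV :=
  (X.hom.appLE ⊤ V (le_preimage_top _ _)).hom.codRestrict _ (hom_appLE_mem_invariants _)

/-- The structure morphism of the spectrum of the ring of invariant functions. -/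
def InvariantAffine.toBase [IsAffine S] (V : InvariantAffine H) : (diagram H).obj V ⟶ S :=
  Spec.map (CommRingCat.ofHom (baseToInvariants V.isInvariant)) ≫ S.isoSpec.inv

theorem InvariantAffine.map_toBase [IsAffine S] {V W : InvariantAffine H} (e : V ⟶ W) :
    (diagram H).map e ≫ W.toBase = V.toBase := by
  simp only [toBase, diagram]
  rw [← Category.assoc, ← Spec.map_comp]
  congr 2
  ext t
  exact congr($(X.hom.appLE_map (U := ⊤) (le_preimage_top _ _) (homOfLE (leOfHom e)).op) t)

theorem toSpecΓ_comp_isoSpec_inv [IsAffine S] {Y : Scheme.{u}} (f : Y ⟶ S) (V : Y.Opens)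
    {B : CommRingCat.{u}} (ρ : B ⟶ Γ(Y, V)) (β : Γ(S, ⊤) ⟶ B)
    (h : β ≫ ρ = f.appLE ⊤ V (le_preimage_top _ _)) :
    (V.toSpecΓ ≫ Spec.map ρ) ≫ Spec.map β ≫ S.isoSpec.inv = V.ι ≫ f := by
  rw [Category.assoc, ← Spec.map_comp_assoc, h, Scheme.Opens.toSpecΓ_SpecMap_appLE_assoc,
    Scheme.Opens.toSpecΓ_top, Category.assoc, Scheme.toSpecΓ_isoSpec_inv, Category.comp_id,
    Scheme.Hom.resLE_comp_ι]

theorem InvariantAffine.proj_toBase [IsAffine S] (V : InvariantAffine H) :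
    V.proj ≫ V.toBase = V.opens.ι ≫ X.hom :=
  toSpecΓ_comp_isoSpec_inv X.hom V.opens _ _ rfl

/-- Two points with the same image in the chart of T come from points `v`, `w` of one orbit. As W is
invariant, `v` already lies in V ∩ W, which is again an invariant affine open by `hinf`. -/
theorem isLocallyDirected_diagram [Finite H] (hinf : ∀ V W : X.left.Opens, IsAffineOpen V →
    IsAffineOpen W → IsAffineOpen (V ⊓ W)) :
    (diagram H ⋙ Scheme.forget).IsLocallyDirected where
  cond {V W T} f g xi xj h := by
    obtain ⟨v, rfl⟩ := V.proj_surjective xi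
    obtain ⟨w, rfl⟩ := W.proj_surjective xj
    have h1 := (map_proj f v).symm.trans (Eq.trans h (map_proj g w))
    obtain ⟨a, ha, hvw⟩ := (T.proj_eq_iff _ _).mp h1
    have hv : v.1 ∈ W.opens := (W.isInvariant.mem_iff ha).mp (by rw [hvw]; exact w.2)
    let L : InvariantAffine H :=
      ⟨V.opens ⊓ W.opens, V.isInvariant.inf W.isInvariant, hinf _ _ V.isAffine W.isAffine⟩
    have hLV : L ≤ V := show V.opens ⊓ W.opens ≤ V.opens from inf_le_left
    have hLW : L ≤ W := show V.opens ⊓ W.opens ≤ W.opens from inf_le_right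
    refine ⟨L, homOfLE hLV, homOfLE hLW, L.proj ⟨v.1, v.2, hv⟩,
      map_proj (homOfLE hLV) _, ?_⟩
    exact (map_proj (homOfLE hLW) _).trans ((W.proj_eq_iff _ _).mpr ⟨a, ha, hvw⟩)

/-- A scheme over an affine base which is covered by affine opens stable under a finite group `H`
has a quotient by `H`. -/
theorem exists_isQuotient [IsAffine S] [Finite H]
    (hinf : ∀ V W : X.left.Opens, IsAffineOpen V → IsAffineOpen W → IsAffineOpen (V ⊓ W))
    (hcov : ∀ x : X.left, ∃ V : X.left.Opens, x ∈ V ∧ IsInvariantOpen H V ∧ IsAffineOpen V) :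
    ∃ (Z : Over S) (π : X ⟶ Z), IsQuotient H π := by
  have hld := isLocallyDirected_diagram (H := H) hinf
  let Z₀ := colimit (diagram H)
  let ι (V : InvariantAffine H) : (diagram H).obj V ⟶ Z₀ := colimit.ι (diagram H) V
  have hιo (V : InvariantAffine H) : IsOpenImmersion (ι V) :=
    inferInstanceAs (IsOpenImmersion (colimit.ι (diagram H) V))
  have hιw {V W : InvariantAffine H} (e : V ⟶ W) : (diagram H).map e ≫ ι W = ι V :=
    colimit.w (diagram H) e
  have hopen : TopologicalSpace.IsOpenCover (fun V : InvariantAffine H => V.opens) :=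
    top_le_iff.mp fun x _ => by
      obtain ⟨V, hx, hV, hVa⟩ := hcov x
      exact TopologicalSpace.Opens.mem_iSup.mpr ⟨⟨V, hV, hVa⟩, hx⟩
  let 𝒰 := X.left.openCoverOfIsOpenCover (fun V : InvariantAffine H => V.opens) hopen
  have hcompat (V W : InvariantAffine H) :
      pullback.fst V.opens.ι W.opens.ι ≫ V.proj ≫ ι V =
        pullback.snd V.opens.ι W.opens.ι ≫ W.proj ≫ ι W := by
    let L : InvariantAffine H :=
      ⟨V.opens ⊓ W.opens, V.isInvariant.inf W.isInvariant, hinf _ _ V.isAffine W.isAffine⟩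
    have hLV : L ≤ V := show V.opens ⊓ W.opens ≤ V.opens from inf_le_left
    have hLW : L ≤ W := show V.opens ⊓ W.opens ≤ W.opens from inf_le_right
    let g : pullback V.opens.ι W.opens.ι ⟶ L.opens.toScheme :=
      IsOpenImmersion.lift L.opens.ι (pullback.fst _ _ ≫ V.opens.ι) (by
        rintro _ ⟨x, rfl⟩
        rw [Scheme.Opens.range_ι]
        refine ⟨(pullback.fst V.opens.ι W.opens.ι x).2, ?_⟩
        rw [pullback.condition]
        exact (pullback.snd V.opens.ι W.opens.ι x).2)
    have hg : g ≫ L.opens.ι = pullback.fst _ _ ≫ V.opens.ι := IsOpenImmersion.lift_fac ..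
    have h1 : pullback.fst V.opens.ι W.opens.ι = g ≫ X.left.homOfLE hLV := by
      rw [← cancel_mono V.opens.ι, Category.assoc, Scheme.homOfLE_ι, hg]
    have h2 : pullback.snd V.opens.ι W.opens.ι = g ≫ X.left.homOfLE hLW := by
      rw [← cancel_mono W.opens.ι, Category.assoc, Scheme.homOfLE_ι, hg, pullback.condition]
    have h3 := homOfLE_proj (homOfLE hLV)
    have h4 := homOfLE_proj (homOfLE hLW)
    rw [h1, h2, Category.assoc, Category.assoc, reassoc_of% h3, reassoc_of% h4, hιw, hιw]
  have hext {T : Scheme.{u}} (f g : X.left ⟶ T)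
      (h : ∀ V : InvariantAffine H, V.opens.ι ≫ f = V.opens.ι ≫ g) : f = g :=
    Scheme.Cover.hom_ext 𝒰 f g h
  let p : X.left ⟶ Z₀ := 𝒰.glueMorphisms (fun V => V.proj ≫ ι V) hcompat
  have hp (V : InvariantAffine H) : V.opens.ι ≫ p = V.proj ≫ ι V :=
    𝒰.ι_glueMorphisms (fun V => V.proj ≫ ι V) hcompat V
  have hstr {V W : InvariantAffine H} (e : V ⟶ W) :
      (diagram H).map e ≫ W.toBase = V.toBase := map_toBase e
  let toS : Z₀ ⟶ S := colimit.desc (diagram H)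
    { pt := S
      ι := { app := toBase, naturality := fun V W e => by
               rw [hstr e]; exact (Category.comp_id _).symm } }
  have htoS (V : InvariantAffine H) : ι V ≫ toS = V.toBase := colimit.ι_desc _ _
  have hpS : p ≫ toS = X.hom := by
    refine hext _ _ fun V => ?_
    have h1 := hp V
    rw [reassoc_of% h1, htoS, proj_toBase]
  let π : X ⟶ Over.mk toS := Over.homMk p hpS
  have hπ : ∀ h ∈ H, h.hom ≫ π = π := by
    intro h hh
    refine Over.OverMorphism.ext ?_
    change h.hom.left ≫ p = p
    refine hext _ _ fun V => ?_
    have h1 := Scheme.Hom.resLE_comp_ι h.hom.left (V.isInvariant h hh).ge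
    rw [← reassoc_of% h1, hp, ← Category.assoc, resLE_proj V hh]
  refine ⟨Over.mk toS, π, isQuotient_of_isQuotientOpen hπ fun z => ?_⟩
  obtain ⟨V, z, rfl⟩ := Scheme.IsLocallyDirected.ι_jointly_surjective (diagram H) z
  refine ⟨(ι V).opensRange, ⟨z, rfl⟩, @isQuotientOpen_of_chart _ _ _ _ _ hπ _ _ ?_ V.isInvariant
    V.isAffine (ι V) (hιo V) rfl ?_⟩
  -- The preimage of the chart of V is V itself: if `x` has its image in that chart, then both come
  -- from a smaller chart L ⊆ V, so the orbit of `x` meets V and V contains it.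
  · refine TopologicalSpace.Opens.ext (Set.ext fun x => ⟨?_, fun hx => ?_⟩)
    · rintro ⟨y, hy : ι V y = p x⟩
      obtain ⟨W', hxW', hW', hWa'⟩ := hcov x
      let W : InvariantAffine H := ⟨W', hW', hWa'⟩
      have h1 : p x = ι W (W.proj ⟨x, hxW'⟩) := congr($(hp W) ⟨x, hxW'⟩)
      rw [h1] at hy
      obtain ⟨L, fV, fW, l, hl, hl'⟩ := Scheme.IsLocallyDirected.ι_eq_ι_iff (diagram H) |>.mp hy
      obtain ⟨l, rfl⟩ := L.proj_surjective l
      obtain ⟨h, hh, hlx⟩ := (W.proj_eq_iff _ _).mp ((map_proj fW l).symm.trans hl')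
      have h2 : h.hom.left l.1 = x := hlx
      exact h2 ▸ (V.isInvariant.mem_iff hh).mpr (leOfHom fV l.2)
    · exact ⟨V.proj ⟨x, hx⟩, congr($(hp V) ⟨x, hx⟩).symm⟩
  · exact (hp V).trans (Category.assoc ..)

end Existence

end ZQuot

namespace ZQuot

/-! ### A quotient of a variety is a variety -/

section Variety

/-- As `f` is surjective, the diagonal of `g` has the same range as its composite with `f`. This
composite is the closed diagonal of f ≫ g followed by the universally closed map f × f, so the range
is closed. -/
theorem isSeparated_of_comp_of_surjective {X Z S : Scheme.{u}} (f : X ⟶ Z) (g : Z ⟶ S)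
    [UniversallyClosed f] [Surjective f] [IsSeparated (f ≫ g)] : IsSeparated g := by
  refine ⟨.of_isPreimmersion _ ?_⟩
  let m : pullback (f ≫ g) (f ≫ g) ⟶ pullback g g :=
    pullback.map _ _ _ _ f f (𝟙 S) (by simp) (by simp)
  have hm : UniversallyClosed m :=
    MorphismProperty.pullbackMap (P := @UniversallyClosed) ‹_› ‹_› rfl rfl
  have h1 : m ≫ pullback.fst g g = pullback.fst _ _ ≫ f := pullback.lift_fst ..
  have h2 : m ≫ pullback.snd g g = pullback.snd _ _ ≫ f := pullback.lift_snd ..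
  have h : f ≫ pullback.diagonal g = pullback.lift (𝟙 _) (𝟙 _) rfl ≫ m := by
    refine pullback.hom_ext ?_ ?_
    · rw [Category.assoc, Category.assoc, pullback.diagonal_fst, h1, pullback.lift_fst_assoc,
        Category.comp_id, Category.id_comp]
    · rw [Category.assoc, Category.assoc, pullback.diagonal_snd, h2, pullback.lift_snd_assoc,
        Category.comp_id, Category.id_comp]
  rw [← range_eq_range_of_surjective (f ≫ pullback.diagonal g) _ f rfl, h]
  exact Scheme.Hom.comp_base _ m ▸
    ((m.isClosedMap).comp (Scheme.Hom.isClosedMap (pullback.diagonal (f ≫ g)))).isClosed_range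

/-- The Artin–Tate lemma: C is of finite type over A and integral over B, hence finite over B. -/
theorem finiteType_of_comp_of_isIntegral {A B C : Type*} [CommRing A] [CommRing B] [CommRing C]
    [IsNoetherianRing A] (f : A →+* B) (g : B →+* C) (hgf : (g.comp f).FiniteType)
    (hg : g.IsIntegral) (hi : Function.Injective g) : f.FiniteType := by
  have hfin : g.Finite := hg.to_finite (.of_comp_finiteType hgf)
  algebraize [f, g, g.comp f]
  exact ⟨fg_of_fg_of_fg A B C hgf.1 hfin.1 hi⟩

theorem locallyOfFiniteType_of_comp {X Z S : Scheme.{u}} [IsAffine S] [IsLocallyNoetherian S]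
    (f : X ⟶ Z) (g : Z ⟶ S) [IsIntegralHom f] (hf : ∀ U, Function.Injective (f.app U))
    [LocallyOfFiniteType (f ≫ g)] : LocallyOfFiniteType g := by
  refine (HasRingHomProperty.iff_of_iSup_eq_top (P := @LocallyOfFiniteType)
    (fun U : Z.affineOpens => U) (iSup_affineOpens_eq_top Z)).mpr fun U => ?_
  have h1 : ((f ≫ g).appLE ⊤ (f ⁻¹ᵁ U) le_top).hom.FiniteType :=
    HasRingHomProperty.appLE (P := @LocallyOfFiniteType) (f ≫ g) ‹_› ⟨⊤, isAffineOpen_top S⟩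
      ⟨f ⁻¹ᵁ U, U.2.preimage f⟩ le_top
  have : IsNoetherianRing Γ(S, ⊤) :=
    IsLocallyNoetherian.component_noetherian ⟨⊤, isAffineOpen_top S⟩
  refine finiteType_of_comp_of_isIntegral _ (f.app U).hom ?_
    (IsIntegralHom.isIntegral_app f U.1 U.2) (hf U)
  have h2 : g.appLE ⊤ U (le_preimage_top g U) ≫ f.app U =
      (f ≫ g).appLE ⊤ (f ⁻¹ᵁ U) (le_preimage_top (f ≫ g) _) := by
    rw [Scheme.Hom.app_eq_appLE, Scheme.Hom.appLE_comp_appLE]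
  exact congrArg (fun e => (CommRingCat.Hom.hom e).FiniteType) h2 |>.mpr h1

theorem isIntegral_of_app_injective {X Z : Scheme.{u}} (f : X ⟶ Z) [Surjective f]
    (hf : ∀ U, Function.Injective (f.app U)) [IsIntegral X] : IsIntegral Z where
  nonempty := ⟨f (Nonempty.some inferInstance)⟩
  component_integral U hU := by
    obtain ⟨z, hz⟩ := hU
    obtain ⟨x, rfl⟩ := f.surjective z
    have : Nonempty (f ⁻¹ᵁ U) := ⟨x, hz⟩
    exact (hf U).isDomain (f.app U).hom

theorem compactSpace_of_surjective {X Z : Scheme.{u}} (f : X ⟶ Z) [Surjective f] [CompactSpace X] :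
    CompactSpace Z :=
  ⟨(range_eq_univ f) ▸ isCompact_range f.continuous⟩

variable {S : Scheme.{u}} [IsAffine S] [IsLocallyNoetherian S] {X Z : Over S} {π : X ⟶ Z}
  {H : Subgroup (Aut X)}

theorem IsQuotient.isVariety [Finite H] (hq : IsQuotient H π) (hX : IsVariety X) :
    IsVariety Z := by
  have := hq.isIntegralHom
  have : Surjective π.left := ⟨hq.quotientMap.surjective⟩
  have h := Over.w π
  have := hX.integral
  refine ⟨isIntegral_of_app_injective π.left hq.injective,
    @isSeparated_of_comp_of_surjective _ _ _ π.left Z.hom _ _ ?_,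
    @locallyOfFiniteType_of_comp _ _ _ _ _ π.left Z.hom _ hq.injective ?_,
    (quasiCompact_iff_compactSpace Z.hom).mpr ?_⟩
  · exact congrArg (fun f => IsSeparated f) h |>.mpr hX.separated
  · exact congrArg (fun f => LocallyOfFiniteType f) h |>.mpr hX.locallyOfFiniteType
  · have : CompactSpace X.left := (quasiCompact_iff_compactSpace X.hom).mp hX.quasiCompact
    exact compactSpace_of_surjective π.left

end Variety

end ZQuot

namespace ZQuot

/-! ### From a chart of invariants to a birational map -/

section Birational

variable {S : Scheme.{u}} {X Z : Over S} {H : Subgroup (Aut X)} {V W : X.left.Opens}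

/-- The ring homomorphism `θ` identifies the ring of invariant functions on `V` with the
localization `R[1/h]`. -/
structure IsInvariantChart {R : Type u} [CommRing R] (hV : IsInvariantOpen H V)
    (θ : R →+* Γ(X.left, V)) (h : R) : Prop where
  mem_invariants : ∀ r, θ r ∈ invariants hV
  injective : Function.Injective θ
  isUnit : IsUnit (θ h)
  exists_pow_mul_eq : ∀ s ∈ invariants hV, ∃ (n : ℕ) (r : R), θ h ^ n * s = θ r

/-- If θ(h)^n f = θ(p), then inverting the invariant f amounts to inverting p in addition to h. -/
theorem IsInvariantChart.basicOpen [Finite H] [IsIntegral X.left] {R : Type u} [CommRing R]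
    {hV : IsInvariantOpen H V} {θ : R →+* Γ(X.left, V)} {h : R} (hθ : IsInvariantChart hV θ h)
    (hVa : IsAffineOpen V) {f : Γ(X.left, V)} (hf : f ∈ invariants hV)
    (hWf : W = X.left.basicOpen f) (hW : IsInvariantOpen H W) (e : W ≤ V) [Nonempty W] :
    ∃ h' : R, IsInvariantChart hW ((X.left.presheaf.map (homOfLE e).op).hom.comp θ) h' := by
  obtain ⟨n, p, hp⟩ := hθ.exists_pow_mul_eq f hf
  have hinj : Function.Injective (X.left.presheaf.map (homOfLE e).op) :=
    map_injective_of_isIntegral X.left (homOfLE e)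
  let ρ := (X.left.presheaf.map (homOfLE e).op).hom
  have hu : IsUnit (ρ f) := isUnit_res_basicOpen f hWf e
  refine ⟨h * p, fun r => res_mem_invariants hV hW e (hθ.mem_invariants r),
    hinj.comp hθ.injective, ?_, fun s hs => ?_⟩
  · change IsUnit (ρ (θ (h * p)))
    rw [map_mul, ← hp, map_mul, map_mul, map_pow]
    exact (hθ.isUnit.map ρ).mul (((hθ.isUnit.map ρ).pow n).mul hu)
  · obtain ⟨m, t, ht, hts⟩ := exists_invariant_res_eq_pow_mul hV hVa hf hWf hW e hs
    obtain ⟨l, q, hq⟩ := hθ.exists_pow_mul_eq t ht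
    change ρ t = ρ f ^ m * s at hts
    change ∃ (j : ℕ) (r : R), ρ (θ (h * p)) ^ j * s = ρ (θ r)
    -- Replace p^m by h^(nm) f^m, then f^m s by t, then h^l t by q; the factors h^(m + nm) p^l
    -- remain.
    refine ⟨l + m, q * h ^ (m + n * m) * p ^ l, ?_⟩
    simp only [map_mul, map_pow, ← hq, ← hp, hts]
    ring

theorem isDominant_of_isOpenImmersion {U Y : Scheme.{u}} (f : U ⟶ Y) [IsOpenImmersion f]
    [Nonempty U] [IrreducibleSpace Y] : IsDominant f :=
  ⟨f.isOpenEmbedding.isOpen_range.dense (Set.range_nonempty _)⟩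

theorem fromSpec_comp_eq_specMap {k R : CommRingCat.{u}} {Y : Scheme.{u}} (f : Y ⟶ Spec k)
    {U : Y.Opens} (hU : IsAffineOpen U) (ψ : k ⟶ R) (φ : R ⟶ Γ(Y, U))
    (h : (Scheme.ΓSpecIso k).inv ≫ f.appLE ⊤ U (le_preimage_top f U) = ψ ≫ φ) :
    hU.fromSpec ≫ f = Spec.map φ ≫ Spec.map ψ := by
  rw [← Spec.map_comp, ← h, Spec.map_comp, ← IsAffineOpen.SpecMap_appLE_fromSpec f
    (isAffineOpen_top (Spec k)) hU (le_preimage_top f U), IsAffineOpen.fromSpec_top,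
    Scheme.isoSpec_Spec_inv]

/-- An affine open in an integral scheme whose ring of functions is a localization of a domain `R`
makes the scheme birational to the spectrum of `R`. -/
theorem birationalOver_of_isLocalization {k R : CommRingCat.{u}} [IsDomain R] {Y : Scheme.{u}}
    [IsIntegral Y] (f : Y ⟶ Spec k) {U : Y.Opens} [Nonempty U] (hU : IsAffineOpen U)
    (ψ : k ⟶ R) (φ : R ⟶ Γ(Y, U))
    (h : (Scheme.ΓSpecIso k).inv ≫ f.appLE ⊤ U (le_preimage_top f U) = ψ ≫ φ) (r : R)
    (hφ : letI := φ.hom.toAlgebra; IsLocalization.Away r Γ(Y, U)) :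
    Scheme.BirationalOver f (Spec.map ψ) := by
  let := φ.hom.toAlgebra
  have : IsOpenImmersion (Spec.map φ) := IsOpenImmersion.of_isLocalization r
  have : Nonempty (Spec Γ(Y, U)) := inferInstance
  have := isDominant_of_isOpenImmersion (Spec.map φ)
  have := isDominant_of_isOpenImmersion hU.fromSpec
  exact (Scheme.Hom.birationalOver hU.fromSpec f _ rfl).symm.trans
    (Scheme.Hom.birationalOver (Spec.map φ) (Spec.map ψ) _
      (fromSpec_comp_eq_specMap f hU ψ φ h).symm)

theorem isLocalization_of_injective_comp {R A B : Type u} [CommRing R] [CommRing A] [CommRing B]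
    (θ : R →+* B) (ι : A →+* B) (φ : R →+* A) (h : R) (hι : Function.Injective ι)
    (hφ : ∀ r, ι (φ r) = θ r) (hθ : Function.Injective θ) (hu : IsUnit (φ h))
    (hs : ∀ a, ∃ (n : ℕ) (r : R), θ h ^ n * ι a = θ r) :
    letI := φ.toAlgebra; IsLocalization.Away h A := by
  let := φ.toAlgebra
  refine IsLocalization.Away.mk h hu (fun a => ?_) (fun a b hab => ⟨1, ?_⟩)
  · obtain ⟨n, r, hr⟩ := hs a
    refine ⟨n, r, hι ?_⟩
    change ι (a * φ h ^ n) = ι (φ r)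
    rw [map_mul, map_pow, hφ, hφ, ← hr, mul_comm]
  · rw [hθ ((hφ a).symm.trans ((congrArg ι hab).trans (hφ b)))]

/-- The invariant open V is not known to be the preimage of an affine open. It is shrunk twice: to
D(f) inside V ∩ π⁻¹(U₀) with f invariant on V, then to D(g) inside D(f) with g invariant on π⁻¹(U₀).
The function g descends to U₀, so D(g) is a preimage. -/
theorem exists_isInvariantChart_preimage [Finite H] [IsIntegral X.left] {π : X ⟶ Z}
    (hq : IsQuotient H π)
    (hinf : ∀ V W : X.left.Opens, IsAffineOpen V → IsAffineOpen W → IsAffineOpen (V ⊓ W))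
    {R : Type u} [CommRing R]
    {hV : IsInvariantOpen H V} {θ : R →+* Γ(X.left, V)} {h : R} (hθ : IsInvariantChart hV θ h)
    (hVa : IsAffineOpen V) [Nonempty V] :
    ∃ (U : Z.left.Opens) (_ : Nonempty U) (_ : IsAffineOpen U) (e : π.left ⁻¹ᵁ U ≤ V) (h' : R),
      IsInvariantChart (isInvariantOpen_preimage hq.invariant U)
        ((X.left.presheaf.map (homOfLE e).op).hom.comp θ) h' := by
  obtain ⟨x, hxV⟩ := Nonempty.some ‹Nonempty V›
  obtain ⟨U₀, hxU, hU₀⟩ := hq.exists_isQuotientOpen (π.left x)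
  let P : InvariantAffine H :=
    ⟨π.left ⁻¹ᵁ U₀, isInvariantOpen_preimage hq.invariant U₀, hU₀.isAffineOpen_preimage⟩
  let V₀ : InvariantAffine H := ⟨V, hV, hVa⟩
  let I : InvariantAffine H := ⟨V ⊓ P.opens, hV.inf P.isInvariant, hinf _ _ hVa P.isAffine⟩
  obtain ⟨f, hxf, hf⟩ := InvariantAffine.exists_basicOpen_le (V := I) (W := V₀)
    (show V ⊓ P.opens ≤ V from inf_le_left) ⟨x, hxV, hxU⟩
  let W : InvariantAffine H := ⟨X.left.basicOpen f.1, hV.basicOpen f.2, hVa.basicOpen f.1⟩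
  obtain ⟨g, hxg, hg⟩ := InvariantAffine.exists_basicOpen_le (V := W) (W := P)
    (hf.trans inf_le_right) ⟨x, hxf⟩
  obtain ⟨d, hd⟩ := hU₀.sections g.1 g.2
  have hpre : π.left ⁻¹ᵁ Z.left.basicOpen d = X.left.basicOpen g.1 :=
    (Scheme.preimage_basicOpen ..).trans (congrArg X.left.basicOpen hd)
  have eW : W.opens ≤ V := X.left.basicOpen_le f.1
  have e1 : π.left ⁻¹ᵁ Z.left.basicOpen d ≤ W.opens := hpre.trans_le hg
  have : Nonempty W.opens := ⟨x, hxf⟩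
  have : Nonempty (π.left ⁻¹ᵁ Z.left.basicOpen d) := ⟨x, hpre.ge hxg⟩
  obtain ⟨h₁, hθ₁⟩ := hθ.basicOpen hVa f.2 rfl W.isInvariant eW
  have hWP : W.opens ≤ P.opens := hf.trans inf_le_right
  obtain ⟨h₂, hθ₂⟩ := hθ₁.basicOpen (f := X.left.presheaf.map (homOfLE hWP).op g.1) W.isAffine
    (res_mem_invariants P.isInvariant W.isInvariant hWP g.2)
    (by rw [hpre, Scheme.basicOpen_res]; exact (inf_eq_right.mpr hg).symm)
    (isInvariantOpen_preimage hq.invariant (Z.left.basicOpen d)) e1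
  refine ⟨Z.left.basicOpen d, ⟨π.left x, hpre.ge hxg⟩, hU₀.isAffineOpen.basicOpen d,
    e1.trans eW, h₂, ?_⟩
  convert hθ₂ using 1
  rw [← RingHom.comp_assoc, ← CommRingCat.hom_comp, ← Functor.map_comp]
  rfl

theorem app_appLE_eq_res_appLE {X Z S : Scheme.{u}} (f : X ⟶ Z) {g : Z ⟶ S} {h : X ⟶ S}
    (w : f ≫ g = h) {U : Z.Opens} {V : X.Opens} (e : f ⁻¹ᵁ U ≤ V) (s : Γ(S, ⊤)) :
    f.app U (g.appLE ⊤ U (le_preimage_top g U) s) =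
      X.presheaf.map (homOfLE e).op (h.appLE ⊤ V (le_preimage_top h V) s) := by
  subst w
  rw [← CommRingCat.comp_apply, ← CommRingCat.comp_apply, Scheme.Hom.app_eq_appLE,
    Scheme.Hom.appLE_comp_appLE, Scheme.Hom.appLE_map]

/-- If the invariant functions on an invariant affine open are a localization of a domain `R`, then
the quotient is birational to the spectrum of `R`. -/
theorem IsQuotient.birationalOver {k : CommRingCat.{u}} {X Z : Over (Spec k)}
    {H : Subgroup (Aut X)} {V : X.left.Opens} [Finite H] [IsIntegral X.left] {π : X ⟶ Z}
    (hq : IsQuotient H π)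
    (hinf : ∀ V W : X.left.Opens, IsAffineOpen V → IsAffineOpen W → IsAffineOpen (V ⊓ W))
    {R : Type u} [CommRing R] [IsDomain R] (ψ : k →+* R)
    {hV : IsInvariantOpen H V} {θ : R →+* Γ(X.left, V)} {h : R} (hθ : IsInvariantChart hV θ h)
    (hψ : ∀ a, θ (ψ a) = X.hom.appLE ⊤ V (le_preimage_top X.hom V) ((Scheme.ΓSpecIso k).inv a))
    (hVa : IsAffineOpen V) [Nonempty V] :
    Scheme.BirationalOver Z.hom (Spec.map (CommRingCat.ofHom ψ)) := by
  obtain ⟨U, _, hU, e, h', hc⟩ := exists_isInvariantChart_preimage hq hinf hθ hVa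
  have : Surjective π.left := ⟨hq.quotientMap.surjective⟩
  have : IsIntegral Z.left := isIntegral_of_app_injective π.left hq.injective
  have hQ := hq.isQuotientOpen hU
  -- Each θ(r) is invariant and descends to U; since pullback along π is injective, the descended
  -- functions depend on r as a ring homomorphism.
  choose φ hφ using fun r => hQ.sections _ (hc.mem_invariants r)
  let θ' := (X.left.presheaf.map (homOfLE e).op).hom.comp θ
  let φ' : R →+* Γ(Z.left, U) :=
    { toFun := φ
      map_zero' := hq.injective U ((hφ 0).trans ((map_zero θ').trans (map_zero _).symm))
      map_one' := hq.injective U ((hφ 1).trans ((map_one θ').trans (map_one _).symm))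
      map_add' := fun a b => hq.injective U ((hφ _).trans ((map_add θ' a b).trans
        ((congrArg₂ _ (hφ a) (hφ b)).symm.trans (map_add _ _ _).symm)))
      map_mul' := fun a b => hq.injective U ((hφ _).trans ((map_mul θ' a b).trans
        ((congrArg₂ _ (hφ a) (hφ b)).symm.trans (map_mul _ _ _).symm))) }
  refine birationalOver_of_isLocalization (R := .of R) Z.hom hU (CommRingCat.ofHom ψ)
    (CommRingCat.ofHom φ') ?_ h'
    (isLocalization_of_injective_comp θ' (π.left.app U).hom φ' h' (hq.injective U) hφ
      hc.injective ?_ fun a => hc.exists_pow_mul_eq _ (app_mem_invariants hq.invariant U a))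
  · ext a
    refine hq.injective U (Eq.trans ?_ (hφ (ψ a)).symm)
    refine Eq.trans ?_ (congrArg (X.left.presheaf.map (homOfLE e).op) (hψ a)).symm
    exact app_appLE_eq_res_appLE π.left (Over.w π) e _
  · obtain ⟨t, ht⟩ := hc.isUnit.exists_right_inv
    have htm : t ∈ invariants (isInvariantOpen_preimage hq.invariant U) := fun g => by
      have h1 := congrArg (pull (isInvariantOpen_preimage hq.invariant U) g) ht
      rw [map_mul, map_one, hc.mem_invariants h' g] at h1
      exact hc.isUnit.mul_left_cancel (h1.trans ht.symm)
    obtain ⟨t', rfl⟩ := hQ.sections t htm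
    refine IsUnit.of_mul_eq_one t' (hq.injective U ?_)
    exact (map_mul _ _ _).trans ((congrArg (· * _) (hφ h')).trans (ht.trans (map_one _).symm))

end Birational

end ZQuot

namespace ZQuot

/-! ### The homogeneous coordinate ring and the chart Z ≠ 0 -/

section CoordRing

open MvPolynomial HomogeneousLocalization

variable (k : Type u) [Field k]

/-- Up to sign this is X³ - Z² X - Y² Z, an Eisenstein polynomial in X over k[Y, Z] at the prime Z.
-/
theorem irreducible_cubic : Irreducible (cubic k) := by
  let e := finSuccEquiv k 2
  let q : Polynomial (MvPolynomial (Fin 2) k) :=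
    Polynomial.X ^ 3 - Polynomial.C (X 1 ^ 2) * Polynomial.X - Polynomial.C (X 0 ^ 2 * X 1)
  have hq : e (cubic k) = -q := by
    have h1 : e (X 1) = Polynomial.C (X 0) := finSuccEquiv_X_succ (j := 0)
    have h2 : e (X 2) = Polynomial.C (X 1) := finSuccEquiv_X_succ (j := 1)
    have h0 : e (X 0) = Polynomial.X := finSuccEquiv_X_zero
    simp only [cubic, map_add, map_sub, map_mul, map_pow, h0, h1, h2, q]
    ring
  rw [← MulEquiv.irreducible_iff e, hq, (Associated.refl q).neg_left.irreducible_iff]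
  have hdeg : q.natDegree = 3 := by
    simp only [q]
    compute_degree!
  have hmon : q.Monic := by
    simp only [q]
    monicity!
  have hP : (Ideal.span {(X 1 : MvPolynomial (Fin 2) k)}).IsPrime :=
    (Ideal.span_singleton_prime (X_ne_zero 1)).mpr (X_prime)
  refine Polynomial.irreducible_of_eisenstein_criterion hP ?_ ?_ ?_ ?_ hmon.isPrimitive
  · rw [hmon.leadingCoeff]
    exact (Ideal.ne_top_iff_one _).mp hP.ne_top
  · intro n hn
    rw [Polynomial.degree_eq_natDegree hmon.ne_zero, hdeg] at hn
    have hn : n < 3 := by exact_mod_cast hn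
    rw [Ideal.mem_span_singleton]
    interval_cases n <;> simp [q, Polynomial.coeff_X, Polynomial.coeff_C, pow_two]
  · rw [Polynomial.degree_eq_natDegree hmon.ne_zero, hdeg]
    norm_num
  · have h0 : q.coeff 0 = -(X 0 ^ 2 * X 1) := by
      simp [q, -map_mul, -map_pow]
    rw [h0, neg_mem_iff, Ideal.span_singleton_pow, Ideal.mem_span_singleton]
    intro h
    rw [mul_comm, pow_two (X 1), mul_dvd_mul_iff_left (X_ne_zero 1)] at h
    have := X_dvd_X.mp ((X_prime).dvd_of_dvd_pow h)
    simp at this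

instance isDomain_coordRing : IsDomain (CoordRing k) := by
  have : (cubicIdeal k).IsPrime :=
    (Ideal.span_singleton_prime (irreducible_cubic k).ne_zero).mpr (irreducible_cubic k).prime
  infer_instance

/-- The homogeneous coordinates of the curve. -/
def coord (j : Fin 3) : CoordRing k := Ideal.Quotient.mk _ (X j)

theorem coord_mem (j : Fin 3) : coord k j ∈ grading k 1 :=
  mk_mem_quotGrading (isHomogeneous_X k j)

theorem coord_ne_zero (j : Fin 3) : coord k j ≠ 0 := by
  rw [coord, Ne, Ideal.Quotient.eq_zero_iff_mem, Ideal.mem_span_singleton]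
  intro h
  -- The points [1 : 0 : 1] and [0 : 1 : 0] lie on the cubic, and each coordinate is nonzero at one
  -- of them.
  have h1 := map_dvd (eval ![(1 : k), 0, 1]) h
  have h2 := map_dvd (eval ![(0 : k), 1, 0]) h
  fin_cases j <;> simp [cubic] at h1 h2

theorem isDomain_away (f : CoordRing k) (hf : f ≠ 0) : IsDomain (Away (grading k) f) := by
  have := IsLocalization.isDomain_of_le_nonZeroDivisors
    (M := Submonoid.powers f) (Localization.Away f)
    (powers_le_nonZeroDivisors_of_noZeroDivisors hf)
  exact (val_injective (𝒜 := grading k) (.powers f)).isDomain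
    (algebraMap (Away (grading k) f) (Localization.Away f))

/-- The scalars in a chart of the curve. -/
def scalarAway (f : CoordRing k) : k →+* Away (grading k) f :=
  (algebraMap (grading k 0) (Away (grading k) f)).comp (algebraMap k (grading k 0))

/-- The affine coordinates `X / Z`, `Y / Z`, `Z / Z` of the curve. -/
def affCoord (j : Fin 3) : Away (grading k) (coord k 2) :=
  Away.mk (grading k) (coord_mem k 2) 1 (coord k j) (coord_mem k j)

variable {k}

theorem eval₂_mul_of_isHomogeneous {R C : Type*} [CommRing R] [CommRing C] (f : R →+* C)
    {n : ℕ} {p : MvPolynomial (Fin 3) R} (hp : p.IsHomogeneous n) (z : C) (v : Fin 3 → C) :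
    eval₂ f (fun j => z * v j) p = z ^ n * eval₂ f v p := by
  rw [eval₂_eq', eval₂_eq', Finset.mul_sum]
  refine Finset.sum_congr rfl fun d hd => ?_
  have h := hp (mem_support_iff.mp hd)
  simp only [mul_pow, Finset.prod_mul_distrib, Finset.prod_pow_eq_pow_sum]
  have h' : ∑ i, d i = n := by
    rw [← h]; simp [Finsupp.weight_apply, Finsupp.sum_fintype]
  rw [h']
  ring

theorem ringHom_eq_eval₂ {σ R C : Type*} [CommRing R] [CommRing C] (φ : MvPolynomial σ R →+* C)
    (f : R →+* C) (hf : ∀ a, φ (MvPolynomial.C a) = f a) (p : MvPolynomial σ R) :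
    φ p = eval₂ f (fun j => φ (X j)) p := by
  have h : φ = eval₂Hom f fun j => φ (X j) :=
    ringHom_ext (fun r => by rw [hf, eval₂Hom_C]) fun j => by rw [eval₂Hom_X']
  exact DFunLike.congr_fun h p

theorem val_scalarAway (f : CoordRing k) (a : k) :
    (scalarAway k f a).val =
      algebraMap (CoordRing k) (Localization.Away f) (algebraMap k _ a) := rfl

theorem coord_eq_mul_val_affCoord (j : Fin 3) :
    algebraMap (CoordRing k) (Localization.Away (coord k 2)) (coord k j) =
      algebraMap _ _ (coord k 2) * (affCoord k j).val := by
  rw [affCoord, Away.val_mk, ← Localization.mk_one_eq_algebraMap,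
    ← Localization.mk_one_eq_algebraMap,
    Localization.mk_mul, Localization.mk_eq_mk_iff, Localization.r_iff_exists]
  exact ⟨1, by simp⟩

/-- Dehomogenization: both sides, multiplied by Z^n, become the class of `p`, by homogeneity. -/
theorem away_mk_eq_eval₂ {n : ℕ} {p : MvPolynomial (Fin 3) k} (hp : p.IsHomogeneous n)
    (h : Ideal.Quotient.mk _ p ∈ grading k (n • 1)) :
    Away.mk (grading k) (coord_mem k 2) n (Ideal.Quotient.mk _ p) h =
      eval₂ (scalarAway k (coord k 2)) (affCoord k) p := by
  refine val_injective _ ?_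
  let L := Localization.Away (coord k 2)
  let z : L := algebraMap _ _ (coord k 2)
  have h1 : algebraMap (CoordRing k) L (Ideal.Quotient.mk _ p) =
      z ^ n * (eval₂ (scalarAway k (coord k 2)) (affCoord k) p).val := by
    change _ = z ^ n * algebraMap (Away (grading k) (coord k 2)) L _
    rw [eval₂_comp_left, ← eval₂_mul_of_isHomogeneous _ hp]
    have h2 (j : Fin 3) : z * (algebraMap (Away (grading k) (coord k 2)) L ∘ affCoord k) j =
        ((algebraMap (CoordRing k) L).comp (Ideal.Quotient.mk _)) (X j) :=
      (coord_eq_mul_val_affCoord j).symm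
    simp_rw [h2]
    exact ringHom_eq_eval₂ ((algebraMap (CoordRing k) L).comp (Ideal.Quotient.mk _)) _
      (fun a => rfl) p
  rw [Away.val_mk, Localization.mk_eq_mk', IsLocalization.mk'_eq_iff_eq_mul, h1, mul_comm]
  simp [z, L]

theorem exists_eval₂_affCoord_eq (a : Away (grading k) (coord k 2)) :
    ∃ p : MvPolynomial (Fin 3) k, eval₂ (scalarAway k (coord k 2)) (affCoord k) p = a := by
  obtain ⟨n, b, hb, rfl⟩ := Away.mk_surjective (grading k) (coord_mem k 2) a
  have hb' := hb
  rw [smul_eq_mul, mul_one] at hb'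
  obtain ⟨p, hp, rfl⟩ := hb'
  exact ⟨p, (away_mk_eq_eval₂ hp hb).symm⟩

/-- The universal property of the affine curve: a homomorphism out of the chart is a solution of the
equation. It comes from the map on the homogeneous coordinate ring that sends Z to 1. -/
theorem exists_lift_away {C : Type*} [CommRing C] (f : k →+* C) (x y : C)
    (hxy : y ^ 2 = x ^ 3 - x) : ∃ g : Away (grading k) (coord k 2) →+* C,
      (∀ a, g (scalarAway k _ a) = f a) ∧ g (affCoord k 0) = x ∧ g (affCoord k 1) = y := by
  let g₀ : CoordRing k →+* C := Ideal.Quotient.lift _ (eval₂Hom f ![x, y, 1]) (by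
    intro a ha
    obtain ⟨b, rfl⟩ := Ideal.mem_span_singleton.mp ha
    rw [map_mul]
    convert zero_mul _
    simp [cubic, hxy])
  have h0 (j : Fin 3) : g₀ (coord k j) = ![x, y, 1] j := by
    simp [g₀, coord]
  let g₁ : Localization.Away (coord k 2) →+* C :=
    Localization.awayLift g₀ (coord k 2) (by rw [h0]; exact isUnit_one)
  have h1 (a) : g₁ (algebraMap _ _ a) = g₀ a := IsLocalization.lift_eq _ _
  have h2 (j : Fin 3) : g₁ (affCoord k j).val = ![x, y, 1] j := by
    have := congrArg g₁ (coord_eq_mul_val_affCoord (k := k) j)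
    rw [map_mul, h1, h1, h0, h0] at this
    simpa using this.symm
  refine ⟨g₁.comp (algebraMap (Away (grading k) (coord k 2)) _), fun a => ?_, h2 0, h2 1⟩
  change g₁ (scalarAway k _ a).val = _
  rw [val_scalarAway, h1]
  exact (Ideal.Quotient.lift_mk ..).trans (eval₂_C ..)

theorem affCoord_two : affCoord k 2 = 1 := by
  refine val_injective _ ?_
  rw [affCoord, Away.val_mk, val_one]
  exact (Localization.mk_eq_mk_iff.mpr (Localization.r_iff_exists.mpr ⟨1, by simp⟩)).trans
    Localization.mk_one

theorem affCoord_eq : affCoord k 1 ^ 2 = affCoord k 0 ^ 3 - affCoord k 0 := by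
  have h := away_mk_eq_eval₂ (cubic_mem k) (mk_mem_quotGrading (cubic_mem k))
  have h0 : Ideal.Quotient.mk (cubicIdeal k) (cubic k) = 0 :=
    Ideal.Quotient.eq_zero_iff_mem.mpr (Ideal.mem_span_singleton_self _)
  have h1 : eval₂ (scalarAway k (coord k 2)) (affCoord k) (cubic k) = 0 := by
    rw [← h]
    refine val_injective _ ?_
    rw [Away.val_mk, h0, Localization.mk_zero, val_zero]
  simp only [cubic, eval₂_add, eval₂_sub, eval₂_mul, eval₂_pow, eval₂_X, affCoord_two] at h1
  linear_combination h1

end CoordRing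

end ZQuot

namespace ZQuot

/-! ### Comparison with the Weierstrass coordinate ring -/

section Weierstrass

open WeierstrassCurve.Affine

variable (K : Type*) [Field K]

/-- The Weierstrass equation `y² = x³ - x`. -/
def weierstrass : WeierstrassCurve.Affine K := ⟨0, 0, 0, -1, 0⟩

theorem mk_Y_sq : CoordinateRing.mk (weierstrass K) Polynomial.X ^ 2 =
    CoordinateRing.mk (weierstrass K) (Polynomial.C Polynomial.X) ^ 3 -
      CoordinateRing.mk (weierstrass K) (Polynomial.C Polynomial.X) := by
  have h : CoordinateRing.mk (weierstrass K) (weierstrass K).polynomial = 0 := AdjoinRoot.mk_self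
  have e : (weierstrass K).polynomial = Polynomial.X ^ 2 - (Polynomial.C Polynomial.X ^ 3 -
      Polynomial.C Polynomial.X) := by
    simp [weierstrass, WeierstrassCurve.Affine.polynomial]
    ring
  have h' := (congrArg (CoordinateRing.mk (weierstrass K)) e).symm.trans h
  rw [map_sub, map_pow, map_sub, map_pow] at h'
  linear_combination h'

variable {K}

/-- The equation of the curve lowers the degree in `y` to at most one. -/
theorem exists_eval₂_add_mul {B : Type*} [CommRing B] (f : K →+* B) {x y : B}
    (hxy : y ^ 2 = x ^ 3 - x) {σ : Type*} (v : σ → B) (hv : ∀ j, v j = x ∨ v j = y ∨ v j = 1)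
    (p : MvPolynomial σ K) :
    ∃ P Q : Polynomial K, MvPolynomial.eval₂ f v p = P.eval₂ f x + Q.eval₂ f x * y := by
  induction p using MvPolynomial.induction_on with
  | C a => exact ⟨.C a, 0, by simp⟩
  | add p q hp hq =>
    obtain ⟨P, Q, h⟩ := hp
    obtain ⟨P', Q', h'⟩ := hq
    refine ⟨P + P', Q + Q', ?_⟩
    simp only [MvPolynomial.eval₂_add, Polynomial.eval₂_add, h, h']
    ring
  | mul_X p j hp =>
    obtain ⟨P, Q, h⟩ := hp
    rw [MvPolynomial.eval₂_mul, MvPolynomial.eval₂_X, h]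
    obtain hj | hj | hj := hv j
    · refine ⟨P * .X, Q * .X, ?_⟩
      simp only [Polynomial.eval₂_mul, Polynomial.eval₂_X, hj]
      ring
    · refine ⟨Q * (.X ^ 3 - .X), P, ?_⟩
      simp only [Polynomial.eval₂_mul, Polynomial.eval₂_X, Polynomial.eval₂_sub,
        Polynomial.eval₂_pow, hj]
      linear_combination (Q.eval₂ f x) * hxy
    · exact ⟨P, Q, by rw [hj, mul_one]⟩

/-- The map `g` sends P(x) + Q(x) y to the element with coordinates P, Q in the basis 1, Y of the
Weierstrass coordinate ring. Hence `g` is injective, and its target is a domain. -/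
theorem isDomain_of_lift_weierstrass {B : Type*} [CommRing B] (f : K →+* B) {x y : B}
    (hB : ∀ b, ∃ P Q : Polynomial K, b = P.eval₂ f x + Q.eval₂ f x * y)
    (g : B →+* CoordinateRing (weierstrass K))
    (hf : ∀ a, g (f a) = CoordinateRing.mk _ (.C (.C a)))
    (hx : g x = CoordinateRing.mk _ (.C .X)) (hy : g y = CoordinateRing.mk _ .X) : IsDomain B := by
  have hP (P : Polynomial K) : g (P.eval₂ f x) = P • (1 : CoordinateRing (weierstrass K)) := by
    rw [Polynomial.hom_eval₂, CoordinateRing.smul, mul_one, hx]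
    have h : ((CoordinateRing.mk (weierstrass K)).comp Polynomial.C) =
      Polynomial.eval₂RingHom (g.comp f) (CoordinateRing.mk _ (.C .X)) :=
      Polynomial.ringHom_ext (fun a => by simp [hf]) (by simp)
    exact (DFunLike.congr_fun h P).symm
  refine Function.Injective.isDomain g ((injective_iff_map_eq_zero g).mpr fun b hb => ?_)
  obtain ⟨P, Q, rfl⟩ := hB b
  rw [map_add, map_mul, hP, hP, hy, smul_mul_assoc, one_mul] at hb
  obtain ⟨rfl, rfl⟩ := CoordinateRing.smul_basis_eq_zero hb
  simp

end Weierstrass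

/-! ### Geometric integrality of the curve -/

section Chart

open MvPolynomial HomogeneousLocalization TensorProduct

variable {k : Type u} [Field k]

/-- Elements of the base change still have the form P(x) + Q(x) y, now with P, Q over K, so it
embeds in the Weierstrass coordinate ring over K. That K is an arbitrary extension of k is what
geometric integrality demands. -/
theorem isDomain_tensor_away (K : Type u) [Field K] [Algebra k K] :
    letI := (scalarAway k (coord k 2)).toAlgebra
    IsDomain (Away (grading k) (coord k 2) ⊗[k] K) := by
  let A := Away (grading k) (coord k 2)
  let : Algebra k A := (scalarAway k (coord k 2)).toAlgebra
  let W := WeierstrassCurve.Affine.CoordinateRing (weierstrass K)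
  let f : K →+* W := (algebraMap (Polynomial K) W).comp Polynomial.C
  obtain ⟨g, hg, hx, hy⟩ := exists_lift_away (f.comp (algebraMap k K)) _ _ (mk_Y_sq K)
  let : Algebra k W := (f.comp (algebraMap k K)).toAlgebra
  let gA : A →ₐ[k] W := { g with commutes' := hg }
  let fA : K →ₐ[k] W := { f with commutes' := fun _ => rfl }
  let G := Algebra.TensorProduct.productMap gA fA
  let x : A ⊗[k] K := affCoord k 0 ⊗ₜ 1
  let y : A ⊗[k] K := affCoord k 1 ⊗ₜ 1
  let ι : K →+* A ⊗[k] K := Algebra.TensorProduct.includeRight.toRingHom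
  let ιA : A →+* A ⊗[k] K := Algebra.TensorProduct.includeLeftRingHom
  have hxy : y ^ 2 = x ^ 3 - x := by
    have := congrArg ιA (affCoord_eq (k := k))
    rwa [map_pow, map_sub, map_pow] at this
  refine isDomain_of_lift_weierstrass ι (x := x) (y := y) (fun b => ?_) G.toRingHom ?_ ?_ ?_
  · suffices h : ∃ p : MvPolynomial (Fin 3) K, b = eval₂ ι ![x, y, 1] p by
      obtain ⟨p, rfl⟩ := h
      exact exists_eval₂_add_mul ι hxy _ (by intro j; fin_cases j <;> simp) p
    induction b using TensorProduct.induction_on with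
    | zero => exact ⟨0, by simp⟩
    | add a b ha hb =>
      obtain ⟨p, rfl⟩ := ha
      obtain ⟨q, rfl⟩ := hb
      exact ⟨p + q, by simp⟩
    | tmul a c =>
      obtain ⟨p, rfl⟩ := exists_eval₂_affCoord_eq a
      refine ⟨map (algebraMap k K) p * C c, ?_⟩
      have h1 : eval₂ (scalarAway k (coord k 2)) (affCoord k) p ⊗ₜ[k] c =
        ιA (eval₂ (scalarAway k (coord k 2)) (affCoord k) p) * ι c := by
        simp [ιA, ι]
      rw [h1, eval₂_mul, eval₂_C, eval₂_map, eval₂_comp_left]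
      have h2 : ι.comp (algebraMap k K) = ιA.comp (scalarAway k (coord k 2)) :=
        RingHom.ext fun r => (Algebra.TensorProduct.tmul_one_eq_one_tmul r).symm
      have h3 : ιA ∘ affCoord k = ![x, y, 1] := by
        ext j
        fin_cases j
        · rfl
        · rfl
        · exact (congrArg ιA affCoord_two).trans (map_one ιA)
      rw [h2, h3]
  · exact fun a => (Algebra.TensorProduct.productMap_right_apply ..)
  · exact (Algebra.TensorProduct.productMap_left_apply ..).trans hx
  · exact (Algebra.TensorProduct.productMap_left_apply ..).trans hy

variable (k)

/-- The affine chart of the curve where a homogeneous coordinate does not vanish. -/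
abbrev chart (j : Fin 3) : (Proj (grading k)).Opens := Proj.basicOpen (grading k) (coord k j)

theorem isAffineOpen_chart (j : Fin 3) : IsAffineOpen (chart k j) :=
  Proj.isAffineOpen_basicOpen _ _ (coord_mem k j) one_pos

/-- On the curve X³ = Z (Y² + X Z), so Z ≠ 0 wherever X ≠ 0 and the chart of X is redundant. -/
theorem chart_sup_chart : chart k 1 ⊔ chart k 2 = ⊤ := by
  have h : ⨆ j, Proj.basicOpen (grading k) (coord k j) = ⊤ := by
    refine Proj.iSup_basicOpen_eq_top' _ _ (fun j => ⟨1, coord_mem k j⟩)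
      (top_le_iff.mp fun a _ => ?_)
    obtain ⟨p, rfl⟩ := Ideal.Quotient.mk_surjective a
    induction p using MvPolynomial.induction_on with
    | C a => exact Subalgebra.algebraMap_mem _ (algebraMap k (grading k 0) a)
    | add p q hp hq =>
      exact (map_add (Ideal.Quotient.mk (cubicIdeal k)) p q).symm ▸ add_mem (hp trivial) (hq trivial)
    | mul_X p j hp =>
      exact (map_mul (Ideal.Quotient.mk (cubicIdeal k)) p (X j)).symm ▸ mul_mem (hp trivial)
        (Algebra.subset_adjoin ⟨j, rfl⟩)
  have h0 : chart k 0 ≤ chart k 2 := by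
    rw [chart, ← Proj.basicOpen_pow _ _ 3 (by norm_num)]
    refine Proj.basicOpen_mono _ _ _ ⟨coord k 1 ^ 2 + coord k 0 * coord k 2, ?_⟩
    have : Ideal.Quotient.mk (cubicIdeal k) (cubic k) = 0 :=
      Ideal.Quotient.eq_zero_iff_mem.mpr (Ideal.mem_span_singleton_self _)
    simp only [cubic, map_add, map_sub, map_mul, map_pow] at this
    simp only [coord]
    linear_combination -this
  refine top_le_iff.mp (h.ge.trans (iSup_le fun j => ?_))
  fin_cases j
  · exact h0.trans le_sup_right
  · exact le_sup_left
  · exact le_sup_right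

/-- The inclusion of an affine chart of the curve. -/
abbrev chartι (j : Fin 3) : Spec (.of (Away (grading k) (coord k j))) ⟶ Proj (grading k) :=
  Proj.awayι (grading k) (coord k j) (coord_mem k j) one_pos

theorem range_chartι (j : Fin 3) : Set.range (chartι k j) = chart k j :=
  congrArg SetLike.coe (Proj.opensRange_awayι (grading k) (coord k j) (coord_mem k j) one_pos)

instance isIntegral_chart (j : Fin 3) : IsIntegral (Spec (.of (Away (grading k) (coord k j)))) := by
  have := isDomain_away k _ (coord_ne_zero k j)
  infer_instance

theorem chart_inf_nonempty : (chart k 1 ⊓ chart k 2 : Set (Proj (grading k))).Nonempty := by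
  have h := Proj.opensRange_awayι (grading k) (coord k 1 * coord k 2)
    (SetLike.mul_mem_graded (coord_mem k 1) (coord_mem k 2)) two_pos
  have := isDomain_away k _ (mul_ne_zero (coord_ne_zero k 1) (coord_ne_zero k 2))
  rw [Proj.basicOpen_mul] at h
  exact (congrArg (fun U : (Proj (grading k)).Opens => (U : Set (Proj (grading k))).Nonempty)
    h).mp (Set.range_nonempty _)

/-- The chart Y ≠ 0 is irreducible and meets the chart Z ≠ 0, so each of its nonempty open subsets
does; the two charts cover the curve. -/
instance isDominant_chartι : IsDominant (chartι k 2) := by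
  refine ⟨?_⟩
  rw [DenseRange, range_chartι, dense_iff_inter_open]
  rintro W hW ⟨x, hx⟩
  obtain hx1 | hx2 : x ∈ chart k 1 ∨ x ∈ chart k 2 := by
    have : x ∈ chart k 1 ⊔ chart k 2 := chart_sup_chart k ▸ trivial
    exact this
  · obtain ⟨a, rfl⟩ := (range_chartι k 1).ge hx1
    obtain ⟨y, hy1, hy2⟩ := chart_inf_nonempty k
    obtain ⟨b, rfl⟩ := (range_chartι k 1).ge hy1
    obtain ⟨c, hc1, hc2⟩ := nonempty_preirreducible_inter
      (hW.preimage (chartι k 1).continuous) ((chart k 2).isOpen.preimage (chartι k 1).continuous)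
      ⟨a, hx⟩ ⟨b, hy2⟩
    exact ⟨_, hc1, hc2⟩
  · exact ⟨x, hx, hx2⟩

instance isReduced_curve : IsReduced (Proj (grading k)) := by
  have h (f : CoordRing k) : _root_.IsReduced (Away (grading k) f) :=
    isReduced_of_injective (algebraMap (Away (grading k) f) (Localization.Away f))
      (val_injective (𝒜 := grading k) (.powers f))
  have (i : (Proj.affineOpenCover (grading k)).openCover.I₀) :
      IsReduced ((Proj.affineOpenCover (grading k)).openCover.X i) := by
    have := h i.2
    exact inferInstanceAs (IsReduced (Spec (.of (Away (grading k) i.2.1))))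
  exact .of_openCover _ (Proj.affineOpenCover (grading k)).openCover

theorem irreducibleSpace_of_isDominant {X Y : Scheme.{u}} (f : X ⟶ Y) [IsDominant f]
    [IrreducibleSpace X] : IrreducibleSpace Y := by
  have h := ((IrreducibleSpace.isIrreducible_univ X).image f f.continuous.continuousOn).closure
  rw [Set.image_univ, f.denseRange.closure_range] at h
  exact (irreducibleSpace_def Y).mpr h

theorem chartι_curveToSpec (j : Fin 3) : chartι k j ≫ curveToSpec k =
    Spec.map (CommRingCat.ofHom (scalarAway k (coord k j))) := by
  rw [chartι, curveToSpec, Proj.awayι_toSpecZero_assoc, ← Spec.map_comp]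
  rfl

theorem isIntegral_of_isPullback_chart {K : Type u} [Field K] (y : Spec (.of K) ⟶ Spec (.of k))
    {P : Scheme.{u}} {p : P ⟶ Spec (.of (Away (grading k) (coord k 2)))} {q : P ⟶ Spec (.of K)}
    (h : IsPullback p q (chartι k 2 ≫ curveToSpec k) y) : IsIntegral P := by
  obtain ⟨φ, rfl⟩ := Spec.map_surjective y
  let : Algebra k K := φ.hom.toAlgebra
  let : Algebra k (Away (grading k) (coord k 2)) := (scalarAway k (coord k 2)).toAlgebra
  have hd : IsDomain (Away (grading k) (coord k 2) ⊗[k] K) := isDomain_tensor_away K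
  rw [chartι_curveToSpec] at h
  have : IsIntegral (Spec (.of (Away (grading k) (coord k 2) ⊗[k] K))) := inferInstance
  exact .of_isIso (h.isoPullback ≪≫ pullbackSpecIso k (Away (grading k) (coord k 2)) K).inv

/-- The curve is reduced, so its dense chart is scheme-theoretically dense. This survives the flat
base change to K, where the chart is integral, and integrality spreads from the chart to the whole.
-/
instance geometricallyIntegral_curveToSpec : GeometricallyIntegral (curveToSpec k) := by
  refine ⟨fun K _ y Z fst snd hZ => ?_⟩
  have : Flat y := inferInstance
  have : Flat fst := MorphismProperty.of_isPullback hZ.flip ‹_›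
  have := IsSchemeTheoreticallyDominant.of_isDominant (chartι k 2)
  have hP := isIntegral_of_isPullback_chart k y
    ((IsPullback.of_hasPullback (chartι k 2) fst).paste_vert hZ)
  have := IsSchemeTheoreticallyDominant.isReduced (pullback.snd (chartι k 2) fst)
  have : IrreducibleSpace Z := irreducibleSpace_of_isDominant (pullback.snd (chartι k 2) fst)
  exact isIntegral_of_irreducibleSpace_of_isReduced _

end Chart

end ZQuot

namespace ZQuot

/-! ### Scalars as functions -/

section Scalar

variable {k : Type u} [Field k] {X Y : Over (Spec (CommRingCat.of k))}

/-- The scalars as functions on an open subset of a `k`-scheme. -/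
def scalar (V : X.left.Opens) : k →+* Γ(X.left, V) :=
  (X.hom.appLE ⊤ V (le_preimage_top X.hom V)).hom.comp (Scheme.ΓSpecIso (.of k)).inv.hom

theorem res_scalar {V W : X.left.Opens} (e : W ≤ V) (a : k) :
    X.left.presheaf.map (homOfLE e).op (scalar V a) = scalar W a := by
  have := congr($(Scheme.Hom.appLE_map X.hom (le_preimage_top X.hom V) (homOfLE e).op)
    ((Scheme.ΓSpecIso (.of k)).inv a))
  exact this

theorem appLE_appLE_top {X Y S : Scheme.{u}} (f : X ⟶ Y) {g : Y ⟶ S} {h : X ⟶ S} (w : f ≫ g = h)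
    {V : Y.Opens} {W : X.Opens} (e : W ≤ f ⁻¹ᵁ V) :
    g.appLE ⊤ V (le_preimage_top g V) ≫ f.appLE V W e = h.appLE ⊤ W (le_preimage_top h W) := by
  subst w
  exact Scheme.Hom.appLE_comp_appLE ..

theorem appLE_scalar (f : X ⟶ Y) {V : Y.left.Opens} {W : X.left.Opens} (e : W ≤ f.left ⁻¹ᵁ V)
    (a : k) : f.left.appLE V W e (scalar V a) = scalar W a :=
  congr($(appLE_appLE_top f.left (Over.w f) e) ((Scheme.ΓSpecIso (.of k)).inv a))

theorem specMap_scalar {V : X.left.Opens} (hV : IsAffineOpen V) :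
    Spec.map (CommRingCat.ofHom (scalar V)) = hV.fromSpec ≫ X.hom := by
  have h := fromSpec_comp_eq_specMap X.hom hV (CommRingCat.ofHom (scalar V)) (𝟙 _)
    (Category.comp_id _).symm
  exact (h.trans (congrArg (· ≫ _) (Spec.map_id _))).trans (Category.id_comp _) |>.symm

end Scalar

/-! ### Coordinate functions on the affine chart and the action of τ -/

section Sections

open MvPolynomial HomogeneousLocalization

variable {k : Type u} [Field k]

theorem fromSpec_basicOpen_eq {A σ : Type u} [CommRing A] [SetLike σ A] [AddSubgroupClass σ A]
    (𝒜 : ℕ → σ) [GradedRing 𝒜] {f : A} {m : ℕ} (hf : f ∈ 𝒜 m) (hm : 0 < m) :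
    (Proj.isAffineOpen_basicOpen 𝒜 f hf hm).fromSpec =
      Spec.map (Proj.awayToSection 𝒜 f) ≫ Proj.awayι 𝒜 f hf hm := by
  have hU := Proj.isAffineOpen_basicOpen 𝒜 f hf hm
  have h : hU.isoSpec.hom ≫ Spec.map (Proj.awayToSection 𝒜 f) =
      (Proj.basicOpenIsoSpec 𝒜 f hf hm).hom := by
    rw [IsAffineOpen.isoSpec_hom]
    rfl
  rw [← Iso.eq_inv_comp, ← Iso.comp_inv_eq] at h
  rw [IsAffineOpen.fromSpec, Proj.awayι, ← h, Category.assoc]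

variable (k) in
/-- The affine chart `Z ≠ 0` of the curve. -/
def affineChart : (curve k).left.Opens := chart k 2

variable (k) in
/-- The identification of degree zero fractions with functions on the affine chart. -/
def sectionHom : Away (grading k) (coord k 2) →+* Γ((curve k).left, affineChart k) :=
  (Proj.awayToSection (grading k) (coord k 2)).hom

variable (k) in
/-- The coordinate functions `x = X / Z` and `y = Y / Z` (and `1 = Z / Z`) on the affine chart. -/
def coordSection (j : Fin 3) : Γ((curve k).left, affineChart k) := sectionHom k (affCoord k j)

theorem bijective_sectionHom : Function.Bijective (sectionHom k) := by
  have h := Proj.basicOpenIsoAway_hom (grading k) (coord k 2) (coord_mem k 2) one_pos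
  have h' := ConcreteCategory.bijective_of_isIso
    (Proj.basicOpenIsoAway (grading k) (coord k 2) (coord_mem k 2) one_pos).hom
  rw [h] at h'
  exact h'

theorem sectionHom_scalarAway (a : k) :
    sectionHom k (scalarAway k (coord k 2) a) = scalar (affineChart k) a := by
  have h1 := specMap_scalar (X := curve k) (isAffineOpen_chart k 2)
  have h2 : Spec.map (CommRingCat.ofHom (scalar (X := curve k) (chart k 2))) =
      Spec.map (CommRingCat.ofHom (scalarAway k (coord k 2)) ≫
        Proj.awayToSection (grading k) (coord k 2)) := by
    rw [Spec.map_comp]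
    refine h1.trans ?_
    rw [← chartι_curveToSpec, ← Category.assoc]
    exact congrArg (· ≫ curveToSpec k) (fromSpec_basicOpen_eq (grading k) (coord_mem k 2) one_pos)
  exact congr($(Spec.map_injective h2) a).symm

theorem coordSection_two : coordSection k 2 = 1 := by
  rw [coordSection, affCoord_two, map_one]

theorem coordSection_eq :
    coordSection k 1 ^ 2 = coordSection k 0 ^ 3 - coordSection k 0 := by
  simp only [coordSection]
  rw [← map_pow, affCoord_eq, map_sub, map_pow]

theorem exists_eval₂_coordSection_eq (s : Γ((curve k).left, affineChart k)) :
    ∃ p : MvPolynomial (Fin 3) k, eval₂ (scalar (affineChart k)) (coordSection k) p = s := by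
  obtain ⟨a, rfl⟩ := bijective_sectionHom.surjective s
  obtain ⟨p, rfl⟩ := exists_eval₂_affCoord_eq a
  refine ⟨p, ?_⟩
  rw [eval₂_comp_left, show (sectionHom k).comp (scalarAway k (coord k 2)) =
    scalar (affineChart k) from RingHom.ext sectionHom_scalarAway]
  rfl

theorem exists_lift_section {C : Type*} [CommRing C] (f : k →+* C) (x y : C)
    (hxy : y ^ 2 = x ^ 3 - x) : ∃ g : Γ((curve k).left, affineChart k) →+* C,
      (∀ a, g (scalar _ a) = f a) ∧ g (coordSection k 0) = x ∧ g (coordSection k 1) = y := by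
  obtain ⟨g, hf, hx, hy⟩ := exists_lift_away f x y hxy
  let e := RingEquiv.ofBijective (sectionHom k) bijective_sectionHom
  have he (a) : e.symm (sectionHom k a) = a := e.symm_apply_apply a
  refine ⟨g.comp e.symm, fun a => ?_, ?_, ?_⟩
  · rw [← hf, ← sectionHom_scalarAway]
    exact congrArg g (he _)
  · exact (congrArg g (he _)).trans hx
  · exact (congrArg g (he _)).trans hy

section Tau

variable (c : k) (hc : c ^ 2 = -1)

theorem coordHom_coord : coordHom c hc (coord k 0) = -coord k 0 ∧
    coordHom c hc (coord k 1) = algebraMap k _ c * coord k 1 ∧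
    coordHom c hc (coord k 2) = coord k 2 := by
  refine ⟨?_, ?_, ?_⟩ <;> simp only [coord, coordHom_mk, substHom, aeval_X]
  · exact map_neg (Ideal.Quotient.mk (cubicIdeal k)) (X 0)
  · exact map_mul (Ideal.Quotient.mk (cubicIdeal k)) (C c) (X 1)
  · rfl

theorem tauProj_preimage_chart_one : tauProj c hc ⁻¹ᵁ chart k 1 = chart k 1 := by
  have hC : IsUnit (algebraMap k (CoordRing k) c) :=
    (IsUnit.of_mul_eq_one _ (mul_neg_eq hc)).map _
  rw [chart, tauProj, Proj.map_preimage_basicOpen, (coordHom_coord c hc).2.1]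
  refine le_antisymm (Proj.basicOpen_mono _ _ _ (dvd_mul_left _ _)) (Proj.basicOpen_mono _ _ _ ?_)
  exact (hC.mul_left_dvd).mpr dvd_rfl

theorem tauProj_preimage_chart_two : tauProj c hc ⁻¹ᵁ chart k 2 = chart k 2 := by
  rw [chart, tauProj, Proj.map_preimage_basicOpen, (coordHom_coord c hc).2.2]

/-- The images `s'`, `t'` are variables with equations so that known values, such as the image Z of
Z, can be used without transport along equalities of opens. -/
theorem appLE_map_awayToSection {s s' t t' : CoordRing k} (hs : s ∈ grading k 1)
    (hs' : s' ∈ grading k 1) (ht : t ∈ grading k 1) (ht' : t' ∈ grading k 1)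
    (hss : coordHom c hc s = s') (htt : coordHom c hc t = t')
    (e : Proj.basicOpen (grading k) s' ≤ tauProj c hc ⁻¹ᵁ Proj.basicOpen (grading k) s) :
    (tauProj c hc).appLE _ _ e (Proj.awayToSection (grading k) s (Away.mk _ hs 1 t ht)) =
      Proj.awayToSection (grading k) s' (Away.mk _ hs' 1 t' ht') := by
  subst hss htt
  have h := congr($(Proj.awayToSection_comp_appLE (coordHom c hc) (irrelevant_le c hc) hs)
    (Away.mk _ hs 1 t ht))
  refine h.trans (congrArg (Proj.awayToSection (grading k) (coordHom c hc s)) ?_)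
  exact Away.map_mk ..

theorem tau_preimage_affineChart :
    (tau c hc).hom.left ⁻¹ᵁ affineChart k = affineChart k := tauProj_preimage_chart_two c hc

theorem tau_coordSection_zero (e) :
    (tau c hc).hom.left.appLE (affineChart k) (affineChart k) e (coordSection k 0) =
      -coordSection k 0 := by
  have h0 := (coordHom_coord c hc).1
  refine (appLE_map_awayToSection c hc (coord_mem k 2) (coord_mem k 2) (coord_mem k 0)
    (h0 ▸ (coordHom c hc).map_mem (coord_mem k 0)) (coordHom_coord c hc).2.2 h0 e).trans ?_
  refine Eq.trans ?_ (map_neg (sectionHom k) (affCoord k 0))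
  refine congrArg (sectionHom k) (val_injective _ ?_)
  rw [Away.val_mk, val_neg, affCoord, Away.val_mk, Localization.neg_mk]

theorem tau_coordSection_one (e) :
    (tau c hc).hom.left.appLE (affineChart k) (affineChart k) e (coordSection k 1) =
      scalar _ c * coordSection k 1 := by
  have h0 := (coordHom_coord c hc).2.1
  refine (appLE_map_awayToSection c hc (coord_mem k 2) (coord_mem k 2) (coord_mem k 1)
    (h0 ▸ (coordHom c hc).map_mem (coord_mem k 1)) (coordHom_coord c hc).2.2 h0 e).trans ?_
  rw [← sectionHom_scalarAway]
  refine Eq.trans ?_ (map_mul (sectionHom k) _ (affCoord k 1))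
  refine congrArg (sectionHom k) (val_injective _ ?_)
  rw [Away.val_mk, val_mul, val_scalarAway, affCoord, Away.val_mk,
    ← Localization.mk_one_eq_algebraMap, Localization.mk_mul, one_mul]

end Tau

instance finiteType_coordRing : Algebra.FiniteType (grading k 0) (CoordRing k) := by
  have : IsScalarTower k (grading k 0) (CoordRing k) :=
    IsScalarTower.of_algebraMap_eq (R := k) (S := grading k 0) (A := CoordRing k) fun _ => rfl
  exact Algebra.FiniteType.of_restrictScalars_finiteType k _ _

theorem surjective_algebraMap_grading_zero :
    Function.Surjective (algebraMap k (grading k 0)) := by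
  rintro ⟨_, p, hp, rfl⟩
  have hp' : p = C (p.coeff 0) := totalDegree_eq_zero_iff_eq_C.mp
    (Nat.le_zero.mp (IsHomogeneous.totalDegree_le hp))
  refine ⟨p.coeff 0, Subtype.ext ?_⟩
  exact congrArg (Ideal.Quotient.mk (cubicIdeal k)) hp'.symm

variable (k) in
theorem isVariety_curve : IsVariety (curve k) where
  integral :=
    show IsIntegral (Proj (grading k)) from
      GeometricallyIntegral.isIntegral_of_subsingleton (curveToSpec k)
  separated := by
    change IsSeparated (curveToSpec k)
    unfold curveToSpec
    infer_instance
  locallyOfFiniteType := by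
    change LocallyOfFiniteType (curveToSpec k)
    have : IsClosedImmersion (Spec.map (CommRingCat.ofHom (algebraMap k (grading k 0)))) :=
      IsClosedImmersion.spec_of_surjective _ surjective_algebraMap_grading_zero
    unfold curveToSpec
    infer_instance
  quasiCompact := by
    change QuasiCompact (curveToSpec k)
    unfold curveToSpec
    infer_instance

end Sections

/-! ### Powers of the curve are varieties -/

section Power

variable {S : Scheme.{u}}

theorem IsVariety.of_iso {X Y : Over S} (e : X ≅ Y) (hX : IsVariety X) : IsVariety Y := by
  have hi := hX.integral
  have h1 := hX.separated
  have h2 := hX.locallyOfFiniteType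
  have h3 := hX.quasiCompact
  have aux {X Y : Scheme.{u}} (e : X ≅ Y) {f : X ⟶ S} {g : Y ⟶ S} (h : e.inv ≫ f = g)
      [IsIntegral X] [IsSeparated f] [LocallyOfFiniteType f] [QuasiCompact f] :
      IsIntegral Y ∧ IsSeparated g ∧ LocallyOfFiniteType g ∧ QuasiCompact g := by
    subst h
    exact ⟨.of_isIso e.hom, inferInstance, inferInstance, inferInstance⟩
  obtain ⟨h, h', h'', h'''⟩ := aux (X := X.left) (Y := Y.left)
    ((Over.forget S).mapIso e) (Over.w e.inv)
  exact ⟨h, h', h'', h'''⟩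

theorem isVariety_id [IsIntegral S] : IsVariety (Over.mk (𝟙 S)) :=
  ⟨‹IsIntegral S›, inferInstanceAs (IsSeparated (𝟙 S)),
    inferInstanceAs (LocallyOfFiniteType (𝟙 S)), inferInstanceAs (QuasiCompact (𝟙 S))⟩

theorem IsVariety.pullback {k : Type u} [Field k] {X Y : Scheme.{u}} (f : X ⟶ Spec (.of k))
    (g : Y ⟶ Spec (.of k))
    (hX : IsVariety (Over.mk f)) (hY : IsVariety (Over.mk g)) [GeometricallyIntegral f] :
    IsVariety (Over.mk (pullback.fst f g ≫ f)) := by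
  have hf1 : IsSeparated f := hX.separated
  have hf2 : LocallyOfFiniteType f := hX.locallyOfFiniteType
  have hf3 : QuasiCompact f := hX.quasiCompact
  have hg1 : IsSeparated g := hY.separated
  have hg2 : LocallyOfFiniteType g := hY.locallyOfFiniteType
  have hg3 : QuasiCompact g := hY.quasiCompact
  have : IsIntegral Y := hY.integral
  have : IsLocallyNoetherian Y := LocallyOfFiniteType.isLocallyNoetherian g
  have : Flat f := inferInstance
  have : UniversallyOpen f := inferInstance
  exact ⟨inferInstanceAs (IsIntegral (Limits.pullback f g)),
    inferInstanceAs (IsSeparated (pullback.fst f g ≫ f)),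
    inferInstanceAs (LocallyOfFiniteType (pullback.fst f g ≫ f)),
    inferInstanceAs (QuasiCompact (pullback.fst f g ≫ f))⟩

/-- Quantifying over all limit cones, not only the chosen product, lets the induction split off one
factor and compare the cones afterwards. -/
theorem IsVariety.of_isLimit {k : Type u} [Field k] {E : Over (Spec (.of k))} (hE : IsVariety E)
    [GeometricallyIntegral E.hom] :
    ∀ (n : ℕ) (c : Fan fun _ : Fin n => E), IsLimit c → IsVariety c.pt
  | 0, c, hc => by
    have ht : IsTerminal c.pt := IsTerminal.ofUniqueHom
      (fun Y => hc.lift (Fan.mk Y fun j => j.elim0))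
      fun Y m => hc.hom_ext fun ⟨j⟩ => j.elim0
    exact .of_iso (ht.uniqueUpToIso Over.mkIdTerminal).symm isVariety_id
  | n + 1, c, hc => by
    let := Over.cartesianMonoidalCategory (Spec (CommRingCat.of k))
    obtain ⟨c₁, hc₁⟩ : ∃ c₁ : Fan fun _ : Fin n => E, Nonempty (IsLimit c₁) :=
      ⟨_, ⟨productIsProduct _⟩⟩
    have h := extendFanIsLimit (fun _ => E) (c₁ := c₁) hc₁.some
      (CartesianMonoidalCategory.tensorProductIsBinaryProduct E c₁.pt)
    refine .of_iso (h.conePointUniqueUpToIso hc) ?_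
    exact IsVariety.pullback E.hom c₁.pt.hom hE (IsVariety.of_isLimit hE n c₁ hc₁.some)

theorem isVariety_curvePow (k : Type u) [Field k] (n : ℕ) : IsVariety (curvePow k n) :=
  have : GeometricallyIntegral (curve k).hom := geometricallyIntegral_curveToSpec k
  (isVariety_curve k).of_isLimit n _ (productIsProduct _)

end Power

end ZQuot

namespace ZQuot

/-! ### Products of affine opens -/

section Box

theorem hom_ext_of_closure_eq_top {T : Scheme.{u}} {R : CommRingCat.{u}} {ι : Type*}
    {A : ι → CommRingCat.{u}} (φ : ∀ j, A j ⟶ R)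
    (hφ : Subring.closure (⋃ j, Set.range (φ j)) = ⊤) {a b : T ⟶ Spec R}
    (h : ∀ j, a ≫ Spec.map (φ j) = b ≫ Spec.map (φ j)) : a = b := by
  have key (j : ι) : φ j ≫ (Scheme.ΓSpecIso R).inv ≫ a.appTop =
      φ j ≫ (Scheme.ΓSpecIso R).inv ≫ b.appTop := by
    have h1 := congrArg (fun f => (Scheme.ΓSpecIso (A j)).inv ≫ Scheme.Hom.appTop f) (h j)
    simp only [Scheme.Hom.comp_appTop] at h1
    rwa [← Scheme.ΓSpecIso_inv_naturality_assoc, ← Scheme.ΓSpecIso_inv_naturality_assoc] at h1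
  have h2 : (Scheme.ΓSpecIso R).inv ≫ a.appTop = (Scheme.ΓSpecIso R).inv ≫ b.appTop := by
    refine CommRingCat.hom_ext (RingHom.eq_of_eqOn_set_top fun r _ => ?_)
    have hr : r ∈ Subring.closure (⋃ j, Set.range (φ j)) := hφ ▸ trivial
    refine RingHom.eqOn_set_closure (fun s hs => ?_) hr
    obtain ⟨j, t, rfl⟩ := Set.mem_iUnion.mp hs
    exact congr($(key j) t)
  exact ext_to_Spec h2

theorem toSpecΓ_specMap_fromSpec {X Y : Scheme.{u}} (f : X ⟶ Y) {U : Y.Opens} (hU : IsAffineOpen U)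
    {V : X.Opens} (e : V ≤ f ⁻¹ᵁ U) {B : CommRingCat.{u}} (ρ : B ⟶ Γ(X, V)) (σ : Γ(Y, U) ⟶ B)
    (h : σ ≫ ρ = f.appLE U V e) :
    (V.toSpecΓ ≫ Spec.map ρ) ≫ Spec.map σ ≫ hU.fromSpec = V.ι ≫ f := by
  rw [Category.assoc, ← Spec.map_comp_assoc, h, Scheme.Opens.toSpecΓ_SpecMap_appLE_assoc,
    hU.toSpecΓ_fromSpec, Scheme.Hom.resLE_comp_ι]

theorem toSpecΓ_specMap_comp {X : Scheme.{u}} {k : CommRingCat.{u}} (f : X ⟶ Spec k)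
    {V : X.Opens} {B : CommRingCat.{u}} (ρ : B ⟶ Γ(X, V)) (σ : k ⟶ B)
    (h : σ ≫ ρ = (Scheme.ΓSpecIso k).inv ≫ f.appLE ⊤ V (le_preimage_top f V)) :
    (V.toSpecΓ ≫ Spec.map ρ) ≫ Spec.map σ = V.ι ≫ f := by
  have h1 := toSpecΓ_specMap_fromSpec f (isAffineOpen_top _) (le_preimage_top f V) ρ
    ((Scheme.ΓSpecIso k).hom ≫ σ) (by rw [Category.assoc, h, Iso.hom_inv_id_assoc])
  rw [← h1, IsAffineOpen.fromSpec_top, Scheme.isoSpec_Spec_inv, ← Spec.map_comp,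
    Iso.inv_hom_id_assoc]

theorem bijective_of_isIso_specMap {A B : CommRingCat.{u}} (ρ : A ⟶ B) [IsIso (Spec.map ρ)] :
    Function.Bijective ρ := by
  obtain ⟨σ, hσ⟩ := Spec.map_surjective (inv (Spec.map ρ))
  have h1 : ρ ≫ σ = 𝟙 A := Spec.map_injective (by rw [Spec.map_comp, hσ, Spec.map_id]; simp)
  have h2 : σ ≫ ρ = 𝟙 B := Spec.map_injective (by rw [Spec.map_comp, hσ, Spec.map_id]; simp)
  have : IsIso ρ := ⟨σ, h1, h2⟩
  exact ConcreteCategory.bijective_of_isIso ρ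

variable {k : Type u} [Field k] {ι : Type} [Finite ι] (F : ι → Over (Spec (CommRingCat.of k)))
  (U : ∀ j, (F j).left.Opens)

/-- The open subset of a product cut out by open subsets of the factors. -/
def box : (∏ᶜ F).left.Opens :=
  ⟨{x | ∀ j, (Pi.π F j).left x ∈ U j}, by
    simp only [Set.ofPred_forall]
    exact isOpen_iInter_of_finite fun j => ((Pi.π F j).left ⁻¹ᵁ U j).isOpen⟩

theorem box_le (j : ι) : box F U ≤ (Pi.π F j).left ⁻¹ᵁ U j := fun _ hx => hx j

/-- Functions on a factor as functions on the product. -/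
def boxInc (j : ι) : Γ((F j).left, U j) →+* Γ((∏ᶜ F).left, box F U) :=
  ((Pi.π F j).left.appLE (U j) (box F U) (box_le F U j)).hom

theorem boxInc_scalar (j : ι) (a : k) : boxInc F U j (scalar (U j) a) = scalar (box F U) a :=
  appLE_scalar (Pi.π F j) _ a

variable {F U}

theorem exists_lift_pi (hU : ∀ j, IsAffineOpen (U j)) {C : CommRingCat.{u}} (f : .of k ⟶ C)
    (g : ∀ j, Γ((F j).left, U j) ⟶ C) (hg : ∀ j, CommRingCat.ofHom (scalar (U j)) ≫ g j = f) :
    ∃ Q : Spec C ⟶ (∏ᶜ F).left, Q ≫ (∏ᶜ F).hom = Spec.map f ∧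
      ∀ j, Q ≫ (Pi.π F j).left = Spec.map (g j) ≫ (hU j).fromSpec := by
  let q (j : ι) : Over.mk (Spec.map f) ⟶ F j := Over.homMk (Spec.map (g j) ≫ (hU j).fromSpec) (by
    rw [Category.assoc]
    refine (congrArg (_ ≫ ·) (specMap_scalar (hU j)).symm).trans ?_
    exact (Spec.map_comp _ _).symm.trans (congrArg Spec.map (hg j)))
  let Q := Pi.lift q
  refine ⟨Q.left, Over.w Q, fun j => ?_⟩
  have := congrArg CommaMorphism.left (Pi.lift_π q j)
  exact this

variable (F U) in
/-- The subring generated by the functions on the factors and the scalars. -/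
def boxRing : Subring Γ((∏ᶜ F).left, box F U) :=
  Subring.closure (⋃ j : Option ι, j.elim (Set.range (scalar (box F U)))
    fun j => Set.range (boxInc F U j))

theorem boxInc_mem (j : ι) (s) : boxInc F U j s ∈ boxRing F U :=
  Subring.subset_closure (Set.mem_iUnion.mpr ⟨some j, s, rfl⟩)

theorem scalar_mem_boxRing (a : k) : scalar (box F U) a ∈ boxRing F U :=
  Subring.subset_closure (Set.mem_iUnion.mpr ⟨none, a, rfl⟩)

variable (F U) in
/-- The inclusions of the functions on the factors and of the scalars. -/
def boxGen : ∀ j : Option ι, (j.elim (.of k) fun j => Γ((F j).left, U j)) ⟶ .of (boxRing F U)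
  | none => CommRingCat.ofHom ((scalar (box F U)).codRestrict _ scalar_mem_boxRing)
  | some j => CommRingCat.ofHom ((boxInc F U j).codRestrict _ (boxInc_mem j))

theorem closure_boxGen : Subring.closure (⋃ j, Set.range (boxGen F U j)) = ⊤ := by
  refine eq_top_iff.mpr fun r _ => ?_
  have h : (Subring.closure (⋃ j, Set.range (boxGen F U j))).map (boxRing F U).subtype =
      boxRing F U := by
    rw [RingHom.map_closure]
    refine congrArg Subring.closure ?_
    rw [Set.image_iUnion]
    refine Set.iUnion_congr fun j => ?_
    rw [← Set.range_comp]
    cases j <;> rfl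
  obtain ⟨s, hs, hsr⟩ := Subring.mem_map.mp (h.ge r.2)
  exact Subtype.ext hsr ▸ hs

theorem pi_hom_ext {T : Scheme.{u}} {a b : T ⟶ (∏ᶜ F).left} (h : a ≫ (∏ᶜ F).hom = b ≫ (∏ᶜ F).hom)
    (hj : ∀ j, a ≫ (Pi.π F j).left = b ≫ (Pi.π F j).left) : a = b := by
  let a' : Over.mk (a ≫ (∏ᶜ F).hom) ⟶ ∏ᶜ F := Over.homMk a
  let b' : Over.mk (a ≫ (∏ᶜ F).hom) ⟶ ∏ᶜ F := Over.homMk b h.symm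
  have : a' = b' := Pi.hom_ext _ _ fun j => Over.OverMorphism.ext (hj j)
  exact congrArg CommaMorphism.left this

/-- Let R be the subring generated by the functions on the factors and the scalars. The universal
property gives Spec R → ∏ F, a monomorphism because R is generated in this way, with image inside
the box V. The canonical map V → Spec R is inverse to it. Hence V is affine with ring of functions
R. Including the scalars takes care of the empty product. -/
theorem isAffineOpen_box_and_boxRing_eq_top (hU : ∀ j, IsAffineOpen (U j)) :
    IsAffineOpen (box F U) ∧ boxRing F U = ⊤ := by
  obtain ⟨Q, hQ, hQj⟩ := exists_lift_pi hU (boxGen F U none) (fun j => boxGen F U (some j))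
    fun j => CommRingCat.hom_ext (RingHom.ext fun a => Subtype.ext (boxInc_scalar F U j a))
  let V := box F U
  let ρ : CommRingCat.of (boxRing F U) ⟶ Γ((∏ᶜ F).left, V) :=
    CommRingCat.ofHom (boxRing F U).subtype
  let p : V.toScheme ⟶ Spec (.of (boxRing F U)) := V.toSpecΓ ≫ Spec.map ρ
  have hmono : Mono Q := ⟨fun a b hab => by
    refine hom_ext_of_closure_eq_top (boxGen F U) closure_boxGen fun j => ?_
    cases j with
    | none =>
      have h := congrArg (· ≫ (∏ᶜ F).hom) hab
      simp only [Category.assoc, hQ] at h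
      exact h
    | some j =>
      have h := congrArg (· ≫ (Pi.π F j).left) hab
      simp only [Category.assoc, hQj] at h
      rwa [← Category.assoc, ← Category.assoc, cancel_mono] at h⟩
  have hpQ : p ≫ Q = V.ι := by
    refine pi_hom_ext ?_ fun j => ?_
    · refine (Category.assoc _ _ _).trans ((congrArg (p ≫ ·) hQ).trans ?_)
      exact toSpecΓ_specMap_comp (∏ᶜ F).hom ρ (boxGen F U none) rfl
    · refine (Category.assoc _ _ _).trans ((congrArg (p ≫ ·) (hQj j)).trans ?_)
      exact toSpecΓ_specMap_fromSpec _ (hU j) (box_le F U j) ρ (boxGen F U (some j)) rfl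
  have hrange : Set.range Q ⊆ Set.range V.ι := by
    rw [Scheme.Opens.range_ι]
    rintro _ ⟨x, rfl⟩ j
    have h : (Pi.π F j).left (Q x) = (hU j).fromSpec (Spec.map (boxGen F U (some j)) x) :=
      congr($(hQj j) x)
    rw [h]
    exact (hU j).range_fromSpec.le ⟨_, rfl⟩
  let q := IsOpenImmersion.lift V.ι Q hrange
  have hq : q ≫ V.ι = Q := IsOpenImmersion.lift_fac ..
  have hpq : p ≫ q = 𝟙 _ := by rw [← cancel_mono V.ι, Category.assoc, hq, hpQ, Category.id_comp]
  have hqp : q ≫ p = 𝟙 _ := by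
    rw [← cancel_mono Q, Category.assoc, hpQ, hq, Category.id_comp]
  have hp : IsIso p := ⟨q, hpq, hqp⟩
  have hV : IsAffineOpen V := .of_isIso p
  refine ⟨hV, ?_⟩
  have : IsIso (hV.isoSpec.hom ≫ Spec.map ρ) := by rwa [IsAffineOpen.isoSpec_hom]
  have : IsIso (Spec.map ρ) := IsIso.of_isIso_comp_left hV.isoSpec.hom (Spec.map ρ)
  refine eq_top_iff.mpr fun s _ => ?_
  obtain ⟨t, rfl⟩ := (bijective_of_isIso_specMap ρ).surjective s
  exact t.2

end Box

end ZQuot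

namespace ZQuot

/-! ### Homomorphisms out of, and endomorphisms of, a box -/

section BoxLift

variable {k : Type u} [Field k] {ι : Type} [Finite ι] {F : ι → Over (Spec (CommRingCat.of k))}
  {U : ∀ j, (F j).left.Opens}

theorem exists_lift_box (hU : ∀ j, IsAffineOpen (U j)) {C : Type u} [CommRing C] (f : k →+* C)
    (g : ∀ j, Γ((F j).left, U j) →+* C) (hg : ∀ j a, g j (scalar (U j) a) = f a) :
    ∃ G : Γ((∏ᶜ F).left, box F U) →+* C, ∀ j s, G (boxInc F U j s) = g j s := by
  obtain ⟨Q, hQ, hQj⟩ := exists_lift_pi hU (CommRingCat.ofHom f) (fun j => CommRingCat.ofHom (g j))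
    fun j => CommRingCat.hom_ext (RingHom.ext (hg j))
  have hV := (isAffineOpen_box_and_boxRing_eq_top (F := F) hU).1
  have hrange : Set.range Q ⊆ Set.range hV.fromSpec := by
    rw [hV.range_fromSpec]
    rintro _ ⟨x, rfl⟩ j
    have h : (Pi.π F j).left (Q x) = (hU j).fromSpec (Spec.map (CommRingCat.ofHom (g j)) x) :=
      congr($(hQj j) x)
    rw [h]
    exact (hU j).range_fromSpec.le ⟨_, rfl⟩
  obtain ⟨G, hG⟩ := Spec.map_surjective (IsOpenImmersion.lift hV.fromSpec Q hrange)
  have hGQ : Spec.map G ≫ hV.fromSpec = Q := by rw [hG, IsOpenImmersion.lift_fac]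
  refine ⟨G.hom, fun j s => ?_⟩
  have h1 : (Pi.π F j).left.appLE (U j) (box F U) (box_le F U j) ≫ G = CommRingCat.ofHom (g j) := by
    refine Spec.map_injective ((cancel_mono (hU j).fromSpec).mp ?_)
    rw [Spec.map_comp, Category.assoc, (hU j).SpecMap_appLE_fromSpec _ hV, reassoc_of% hGQ, hQj]
  exact congr($h1 s)

variable (φ : ∏ᶜ F ⟶ ∏ᶜ F) (f : ∀ j, F j ⟶ F j) (hφ : ∀ j, φ ≫ Pi.π F j = Pi.π F j ≫ f j)

include hφ

theorem preimage_box (hf : ∀ j, (f j).left ⁻¹ᵁ U j = U j) : φ.left ⁻¹ᵁ box F U = box F U := by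
  ext x
  refine forall_congr' fun j => ?_
  have h : (Pi.π F j).left (φ.left x) = (f j).left ((Pi.π F j).left x) :=
    congr($(congrArg CommaMorphism.left (hφ j)) x)
  exact (iff_of_eq (congrArg (· ∈ U j) h)).trans
    (iff_of_eq (congrArg ((Pi.π F j).left x ∈ ·) (hf j)))

theorem appLE_boxInc (e : box F U ≤ φ.left ⁻¹ᵁ box F U) (j : ι) (e' : U j ≤ (f j).left ⁻¹ᵁ U j)
    (s : Γ((F j).left, U j)) : φ.left.appLE (box F U) (box F U) e (boxInc F U j s) =
      boxInc F U j ((f j).left.appLE (U j) (U j) e' s) := by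
  have aux {X Y : Scheme.{u}} {p : X ⟶ Y} {a : X ⟶ X} {b : Y ⟶ Y} (w : a ≫ p = p ≫ b)
      {V : X.Opens} {W : Y.Opens} (h₁ : V ≤ p ⁻¹ᵁ W) (h₂ : V ≤ a ⁻¹ᵁ V) (h₃ : W ≤ b ⁻¹ᵁ W) :
      p.appLE W V h₁ ≫ a.appLE V V h₂ = b.appLE W W h₃ ≫ p.appLE W V h₁ := by
    rw [Scheme.Hom.appLE_comp_appLE, Scheme.Hom.appLE_comp_appLE]
    simp only [w]
  exact congr($(aux (congrArg CommaMorphism.left (hφ j)) (box_le F U j) e e') s)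

end BoxLift

/-! ### Automorphisms acting factor by factor -/

section Factorwise

section MapIso

variable {C : Type*} [Category* C] {ι : Type*} {E : ι → C} [HasProductsOfShape ι C]

theorem mapIso_hom_π (f : ∀ j, E j ≅ E j) (j : ι) :
    (Pi.mapIso f).hom ≫ Pi.π E j = Pi.π E j ≫ (f j).hom := by
  simp

theorem mapIso_refl : Pi.mapIso (fun j => Iso.refl (E j)) = Iso.refl (∏ᶜ E) := by
  ext
  simp

theorem mapIso_trans (f g : ∀ j, E j ≅ E j) :
    Pi.mapIso (fun j => f j ≪≫ g j) = Pi.mapIso f ≪≫ Pi.mapIso g := by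
  ext
  simp

end MapIso

/-- Preceding the product map with the diagonal and following it with a projection recovers each
component. -/
theorem mapIso_injective {C : Type*} [Category* C] {ι : Type*} {E : C}
    [HasProductsOfShape ι C] :
    Function.Injective fun f : ι → (E ≅ E) => (Pi.mapIso f : ∏ᶜ (fun _ => E) ≅ ∏ᶜ fun _ => E) := by
  intro f g h
  funext j
  have key (f : ι → (E ≅ E)) :
      Pi.lift (fun _ => 𝟙 E) ≫ (Pi.mapIso f).hom ≫ Pi.π (fun _ => E) j = (f j).hom := by
    simp
  refine Iso.ext ?_
  rw [← key f, ← key g]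
  exact congrArg (fun e : ∏ᶜ (fun _ => E) ≅ ∏ᶜ fun _ => E =>
    Pi.lift (fun _ => 𝟙 E) ≫ e.hom ≫ Pi.π (fun _ => E) j) h

variable {k : Type u} [Field k] {n : ℕ}

variable (k n) in
/-- `factorwise` as a group homomorphism. -/
def factorwiseHom : (Fin n → Aut (curve k)) →* Aut (curvePow k n) where
  toFun := factorwise
  map_one' := mapIso_refl
  map_mul' f g := mapIso_trans g f

theorem injective_factorwiseHom : Function.Injective (factorwiseHom k n) := mapIso_injective

end Factorwise

/-! ### The order of τ -/

section TauOrder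

variable {k : Type u} [Field k] (c : k) (hc : c ^ 2 = -1)

theorem coordHom_comp_self : (coordHom c hc).comp (coordHom c hc) =
    (coordHom (-c) (neg_sq_eq hc)).comp (coordHom (-c) (neg_sq_eq hc)) := by
  have : (substHom c).comp (substHom c) = (substHom (-c)).comp (substHom (-c)) := by
    ext1 j
    fin_cases j <;> simp [substHom]
  refine DFunLike.ext _ _ fun x => ?_
  obtain ⟨p, rfl⟩ := Ideal.Quotient.mk_surjective x
  exact congrArg (Ideal.Quotient.mk (cubicIdeal k)) (DFunLike.congr_fun this p)

/-- The inverse of τ is the same substitution with -c for c. Both have the same square, as c enters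
that only through c², so τ² = τ⁻². -/
theorem tau_pow_four : tau c hc ^ 4 = 1 := by
  have h : tau c hc * tau c hc = (tau c hc)⁻¹ * (tau c hc)⁻¹ := by
    refine Iso.ext (Over.OverMorphism.ext ?_)
    change tauProj c hc ≫ tauProj c hc =
      tauProj (-c) (neg_sq_eq hc) ≫ tauProj (-c) (neg_sq_eq hc)
    rw [tauProj, tauProj, ← Proj.map_comp, ← Proj.map_comp]
    congr 1
    exact coordHom_comp_self c hc
  have h' : tau c hc ^ 4 = (tau c hc * tau c hc) * (tau c hc * tau c hc) := by
    rw [← pow_two, ← pow_two, ← pow_mul]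
  rw [h']
  nth_rw 1 [h]
  group

theorem coordSection_one_ne_zero : coordSection k 1 ≠ 0 := by
  intro h
  obtain ⟨g, -, -, hy⟩ := exists_lift_section
    ((algebraMap (Polynomial k) (WeierstrassCurve.Affine.CoordinateRing (weierstrass k))).comp
      Polynomial.C) _ _ (mk_Y_sq k)
  rw [h, map_zero] at hy
  have := WeierstrassCurve.Affine.CoordinateRing.smul_basis_eq_zero (W' := weierstrass k)
    (p := 0) (q := 1) (by rw [← hy, zero_smul, smul_zero, add_zero])
  exact one_ne_zero this.2

/-- τ² multiplies y by c² = -1, so τ² = 1 would force 2 y = 0, whereas 2 is invertible and y ≠ 0. -/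
theorem tau_sq_ne_one (h2 : (2 : k) ≠ 0) : tau c hc ^ 2 ≠ 1 := by
  intro h
  have e := (tau_preimage_affineChart c hc).ge
  have hcomp : (tau c hc).hom.left ≫ (tau c hc).hom.left = 𝟙 _ :=
    congrArg (fun g : Aut (curve k) => g.hom.left) ((pow_two _).symm.trans h)
  have aux {Y : Scheme.{u}} {g : Y ⟶ Y} (hg : g = 𝟙 Y) {V : Y.Opens} (e : V ≤ g ⁻¹ᵁ V)
      (s : Γ(Y, V)) : g.appLE V V e s = s := by
    subst hg
    rw [Scheme.Hom.appLE]
    exact congr($(Y.presheaf.map_id _) s)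
  have aux' {Y : Scheme.{u}} {t : Y ⟶ Y} (ht : t ≫ t = 𝟙 Y) {V : Y.Opens} (e : V ≤ t ⁻¹ᵁ V)
      (s : Γ(Y, V)) : t.appLE V V e (t.appLE V V e s) = s := by
    rw [← CommRingCat.comp_apply, Scheme.Hom.appLE_comp_appLE]
    exact aux ht _ s
  have h1 := aux' hcomp e (coordSection k 1)
  rw [tau_coordSection_one c hc e] at h1
  have h3 := (map_mul ((tau c hc).hom.left.appLE (affineChart k) (affineChart k) e).hom
    (scalar _ c) (coordSection k 1)).symm.trans h1
  have h4 : ((tau c hc).hom.left.appLE (affineChart k) (affineChart k) e).hom (scalar _ c) =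
    scalar _ c := appLE_scalar (tau c hc).hom e c
  have h5 : ((tau c hc).hom.left.appLE (affineChart k) (affineChart k) e).hom (coordSection k 1) =
    scalar _ c * coordSection k 1 := tau_coordSection_one c hc e
  rw [h4, h5, ← mul_assoc, ← map_mul, ← pow_two, hc, map_neg, map_one] at h3
  have h6 : scalar (affineChart k) 2 * coordSection k 1 = 0 := by
    rw [map_ofNat]
    linear_combination -h3
  have h7 := congrArg (scalar (affineChart k) 2⁻¹ * ·) h6
  simp only [← mul_assoc, ← map_mul, inv_mul_cancel₀ h2, map_one, one_mul, mul_zero] at h7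
  exact coordSection_one_ne_zero h7

theorem orderOf_tau (h2 : (2 : k) ≠ 0) : orderOf (tau c hc) = 4 :=
  orderOf_eq_prime_pow (p := 2) (n := 1) (by simpa using tau_sq_ne_one c hc h2)
    (by simpa using tau_pow_four c hc)

end TauOrder

end ZQuot

namespace ZQuot

/-! ### The structure of the group -/

section Group

section ZModFour

variable {G : Type*} [Group G] {g : G} (hg : g ^ 4 = 1)

/-- The homomorphism `a ↦ g ^ a` from the integers modulo four, for `g ^ 4 = 1`. -/
def zmodFourHom : Multiplicative (ZMod 4) →* G :=
  AddMonoidHom.toMultiplicativeLeft (ZMod.lift 4 ⟨zmultiplesHom _ (Additive.ofMul g), by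
    change (4 : ℤ) • Additive.ofMul g = 0
    rw [← ofMul_zpow]
    exact congrArg Additive.ofMul ((zpow_ofNat g 4).trans hg)⟩)

theorem zmodFourHom_intCast (z : ℤ) : zmodFourHom hg (.ofAdd (z : ZMod 4)) = g ^ z :=
  congrArg Additive.toMul (ZMod.lift_coe 4 _ z)

theorem injective_zmodFourHom (h : orderOf g = 4) : Function.Injective (zmodFourHom hg) := by
  rw [injective_iff_map_eq_one]
  intro a ha
  obtain ⟨z, hz⟩ := ZMod.intCast_surjective a.toAdd
  have ha' : a = .ofAdd (z : ZMod 4) := congrArg Multiplicative.ofAdd hz.symm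
  rw [ha', zmodFourHom_intCast, ← orderOf_dvd_iff_zpow_eq_one, h] at ha
  rw [ha', (ZMod.intCast_zmod_eq_zero_iff_dvd z 4).mpr (by exact_mod_cast ha), ofAdd_zero]

end ZModFour

variable {k : Type u} [Field k] (c : k) (hc : c ^ 2 = -1) (m : ℕ)

/-- The exponent `a` modulo four is sent to the power `τ ^ a`. -/
def tauPow : Multiplicative (ZMod 4) →* Aut (curve k) := zmodFourHom (tau_pow_four c hc)

theorem tauPow_one : tauPow c hc (.ofAdd 1) = tau c hc := by
  have h := zmodFourHom_intCast (tau_pow_four c hc) 1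
  rwa [zpow_one, Int.cast_one] at h

theorem injective_tauPow (h2 : (2 : k) ≠ 0) : Function.Injective (tauPow c hc) :=
  injective_zmodFourHom _ (orderOf_tau c hc h2)

/-- The vector `(a₁, …, aₘ)` acts as `(τ ^ a₁, …, τ ^ aₘ, τ ^ (a₁ + ⋯ + aₘ))`. -/
def vectorHom : Multiplicative (Fin m → ZMod 4) →* (Fin (m + 1) → Aut (curve k)) where
  toFun v l := tauPow c hc (.ofAdd (Fin.lastCases (∑ j, v.toAdd j) v.toAdd l))
  map_one' := by
    funext l
    refine Fin.lastCases ?_ (fun j => ?_) l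
    · simp
    · simp
  map_mul' v w := by
    funext l
    refine Fin.lastCases ?_ (fun j => ?_) l
    · simp [Finset.sum_add_distrib]
    · simp

theorem injective_vectorHom (h2 : (2 : k) ≠ 0) : Function.Injective (vectorHom c hc m) := by
  intro v w h
  refine Multiplicative.toAdd.injective (funext fun j => ?_)
  have := injective_tauPow c hc h2 (congrFun h j.castSucc)
  simpa using this

theorem vectorHom_single (j : Fin m) : vectorHom c hc m (.ofAdd (Pi.single j 1)) = fun l =>
    if l = j.castSucc ∨ (l : ℕ) + 1 = m + 1 then tau c hc else 1 := by
  funext l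
  refine Fin.lastCases ?_ (fun j' => ?_) l
  · simp [vectorHom, tauPow_one]
  · have h : (j' : ℕ) ≠ m := j'.2.ne
    by_cases hj : j' = j
    · subst hj
      simp [vectorHom, tauPow_one]
    · have h' : j'.castSucc ≠ j.castSucc := fun h => hj (Fin.castSucc_injective _ h)
      simp [vectorHom, h', h, hj]

/-- The standard basis vectors generate (ℤ/4)^m and are sent to the generators of the group. -/
theorem groupH_eq_range :
    groupH (m + 1) c hc = ((factorwiseHom k (m + 1)).comp (vectorHom c hc m)).range := by
  refine le_antisymm ((Subgroup.closure_le _).mpr ?_) ?_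
  · rintro _ ⟨j, hj, rfl⟩
    refine ⟨.ofAdd (Pi.single ⟨j, by omega⟩ 1), ?_⟩
    exact congrArg factorwise (vectorHom_single c hc m ⟨j, by omega⟩)
  · rintro _ ⟨v, rfl⟩
    change v ∈ (groupH (m + 1) c hc).comap ((factorwiseHom k (m + 1)).comp (vectorHom c hc m))
    have hv : v = ∏ j, (Multiplicative.ofAdd (Pi.single j (1 : ZMod 4) : Fin m → ZMod 4)) ^
        (v.toAdd j).val := by
      refine Multiplicative.toAdd.injective (funext fun l => ?_)
      rw [toAdd_prod, Finset.sum_apply]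
      simp [toAdd_pow, Pi.single_apply]
    rw [hv]
    refine Subgroup.prod_mem _ fun j _ => Subgroup.pow_mem _ (Subgroup.mem_comap.mpr ?_) _
    refine Subgroup.subset_closure ⟨j.castSucc, by simp, ?_⟩
    exact congrArg factorwise (vectorHom_single c hc m j)

theorem nonempty_groupH_mulEquiv (h2 : (2 : k) ≠ 0) :
    Nonempty (groupH (m + 1) c hc ≃* Multiplicative (Fin m → ZMod 4)) := by
  rw [groupH_eq_range]
  exact ⟨(MonoidHom.ofInjective
    (f := (factorwiseHom k (m + 1)).comp (vectorHom c hc m))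
    (injective_factorwiseHom.comp (injective_vectorHom c hc m h2))).symm⟩

theorem card_groupH (h2 : (2 : k) ≠ 0) : Nat.card (groupH (m + 1) c hc) = 4 ^ m := by
  rw [Nat.card_congr (nonempty_groupH_mulEquiv c hc m h2).some.toEquiv]
  simp [Nat.card_eq_fintype_card]

theorem finite_groupH (h2 : (2 : k) ≠ 0) : Finite (groupH (m + 1) c hc) :=
  Finite.of_equiv _ (nonempty_groupH_mulEquiv c hc m h2).some.symm.toEquiv

end Group

/-! ### Invariance is checked on generators -/

section Closure

variable {S : Scheme.{u}} {X : Over S} {G : Set (Aut X)} {V : X.left.Opens}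

theorem isInvariantOpen_closure (hV : ∀ g ∈ G, g.hom.left ⁻¹ᵁ V = V) :
    IsInvariantOpen (Subgroup.closure G) V := by
  intro h hh
  induction hh using Subgroup.closure_induction with
  | mem g hg => exact hV g hg
  | one => rfl
  | mul g h _ _ hg hh =>
    have : (g * h).hom.left ⁻¹ᵁ V = h.hom.left ⁻¹ᵁ g.hom.left ⁻¹ᵁ V := rfl
    rw [this, hg, hh]
  | inv g _ hg =>
    have h1 : g.inv.left ⁻¹ᵁ g.hom.left ⁻¹ᵁ V = V := by
      have : g.inv.left ≫ g.hom.left = 𝟙 _ := congrArg CommaMorphism.left g.inv_hom_id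
      rw [← Scheme.Hom.comp_preimage, this]
      rfl
    rw [hg] at h1
    exact h1

theorem mem_invariants_closure {hV : IsInvariantOpen (Subgroup.closure G) V} {s : Γ(X.left, V)}
    (h : ∀ g (hg : g ∈ G), pull hV ⟨g, Subgroup.subset_closure hg⟩ s = s) : s ∈ invariants hV := by
  rw [mem_invariants]
  rintro ⟨g, hg⟩
  induction hg using Subgroup.closure_induction with
  | mem g hg => exact h g hg
  | one => exact pull_one hV s
  | mul g h hg' hh' hg hh =>
    have := pull_mul hV ⟨g, hg'⟩ ⟨h, hh'⟩ s
    rw [hg, hh] at this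
    exact this
  | inv g hg' hg =>
    have := pull_mul hV ⟨g, hg'⟩ ⟨g, hg'⟩⁻¹ s
    rw [mul_inv_cancel, hg, pull_one] at this
    exact this.symm

end Closure

end ZQuot

namespace ZQuot

/-! ### Rings of fractions inside a given ring -/

section Fractions

variable {R A : Type*} [CommRing R] [CommRing A] (θ : R →+* A)

/-- The elements of `A` which become images of elements of `R` after multiplication with a power
of the image of `h`. -/
def fractions (h : R) : Subring A where
  carrier := {b | ∃ (n : ℕ) (r : R), θ h ^ n * b = θ r}
  one_mem' := ⟨0, 1, by simp⟩
  zero_mem' := ⟨0, 0, by simp⟩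
  mul_mem' := by
    rintro a b ⟨n, r, hr⟩ ⟨l, q, hq⟩
    exact ⟨n + l, r * q, by rw [map_mul, ← hr, ← hq]; ring⟩
  add_mem' := by
    rintro a b ⟨n, r, hr⟩ ⟨l, q, hq⟩
    exact ⟨n + l, h ^ l * r + h ^ n * q, by simp only [map_mul, map_add, map_pow, ← hr, ← hq]; ring⟩
  neg_mem' := by
    rintro a ⟨n, r, hr⟩
    exact ⟨n, -r, by rw [map_neg, ← hr]; ring⟩

theorem map_mem_fractions (h r : R) : θ r ∈ fractions θ h := ⟨0, r, by simp⟩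

/-- The elements of `A` which are fractions of images of elements of `R`. -/
def unitFractions : Subring A where
  carrier := {b | ∃ q p : R, IsUnit (θ q) ∧ θ q * b = θ p}
  one_mem' := ⟨1, 1, by simp⟩
  zero_mem' := ⟨1, 0, by simp⟩
  mul_mem' := by
    rintro a b ⟨q, p, hu, h⟩ ⟨q', p', hu', h'⟩
    exact ⟨q * q', p * p', by rw [map_mul]; exact hu.mul hu', by
      simp only [map_mul, ← h, ← h']; ring⟩
  add_mem' := by
    rintro a b ⟨q, p, hu, h⟩ ⟨q', p', hu', h'⟩
    exact ⟨q * q', q' * p + q * p', by rw [map_mul]; exact hu.mul hu', by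
      simp only [map_mul, map_add, ← h, ← h']; ring⟩
  neg_mem' := by
    rintro a ⟨q, p, hu, h⟩
    exact ⟨q, -p, hu, by rw [map_neg, ← h]; ring⟩

theorem map_mem_unitFractions (r : R) : θ r ∈ unitFractions θ := ⟨1, r, by simp⟩

variable {θ}

theorem mem_unitFractions_of_mul_eq {q b : A} (hq : q ∈ unitFractions θ) (hu : IsUnit q)
    (h : q * b ∈ unitFractions θ) : b ∈ unitFractions θ := by
  obtain ⟨q₁, p₁, hu₁, h₁⟩ := hq
  obtain ⟨q₂, p₂, hu₂, h₂⟩ := h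
  refine ⟨q₂ * p₁, p₂ * q₁, ?_, ?_⟩
  · rw [map_mul, ← h₁]
    exact hu₂.mul (hu₁.mul hu)
  · rw [map_mul, map_mul, ← h₁, ← h₂]
    ring

/-- The product of the individual denominators is a common one. This passes from arbitrary
invertible denominators to powers of a single element, as a localization chart needs. -/
theorem exists_forall_mem_fractions {ι : Type*} [Finite ι] (b : ι → A)
    (hb : ∀ j, b j ∈ unitFractions θ) : ∃ h, IsUnit (θ h) ∧ ∀ j, b j ∈ fractions θ h := by
  classical
  cases nonempty_fintype ι
  choose q p hu h using hb
  refine ⟨∏ j, q j, ?_, fun j => ⟨1, p j * ∏ l ∈ Finset.univ.erase j, q l, ?_⟩⟩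
  · rw [map_prod]
    exact IsUnit.prod_univ_iff.mpr hu
  · rw [← Finset.mul_prod_erase _ _ (Finset.mem_univ j), pow_one, map_mul, map_mul, ← h]
    ring

end Fractions

/-! ### Invariants by averaging over the group -/

section Average

open MvPolynomial

variable {A G : Type*} [CommRing A] [Group G] [Finite G] {ρ : G → A →+* A}
  (hρ : ∀ g h a, ρ (g * h) a = ρ h (ρ g a)) {ι : Type*} {B : Subring A}
  (hB : ∀ b ∈ B, ∀ g, ρ g b = b)

include hρ hB

/-- If `A` is generated over a ring `B` of invariants by eigenvectors `y j`, whose `d`-th powers lie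
in `B` and which are separated by the group, then every invariant lies in `B`. -/
theorem mem_of_invariant {y : ι → A} {d : ℕ} {z : A} (hd : ∀ j, y j ^ d ∈ B) (hz : z ∈ B)
    (hzd : ∀ e : ℕ, ¬ d ∣ e → IsUnit (1 - z ^ e))
    (hy : ∀ j, ∃ g, ρ g (y j) = z * y j ∧ ∀ l ≠ j, ρ g (y l) = y l)
    (hgen : Subring.closure (B ∪ Set.range y) = ⊤) (hcard : ∃ b ∈ B, b * (Nat.card G : A) = 1)
    {a : A} (ha : ∀ g, ρ g a = a) : a ∈ B := by
  classical
  cases nonempty_fintype G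
  let av (a : A) : A := ∑ g, ρ g a
  have av_smul (b : A) (hb : b ∈ B) (a : A) : av (b * a) = b * av a := by
    simp only [av, map_mul, hB b hb, Finset.mul_sum]
  have av_act (g : G) (a : A) : av (ρ g a) = av a := by
    simp only [av, ← hρ]
    exact Fintype.sum_equiv (Equiv.mulLeft g) _ _ fun h => rfl
  have av_mem (b : A) (hb : b ∈ B) : av b ∈ B := by
    simp only [av, hB b hb]
    exact sum_mem fun _ _ => hb
  have hmon (e : ι →₀ ℕ) : av (e.prod fun j l => y j ^ l) ∈ B := by
    by_cases he : ∀ j, d ∣ e j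
    · refine av_mem _ (prod_mem fun j _ => ?_)
      obtain ⟨l, hl⟩ := he j
      simp only [hl, pow_mul]
      exact pow_mem (hd j) l
    · push Not at he
      obtain ⟨j, hj⟩ := he
      obtain ⟨g, hgj, hgl⟩ := hy j
      have hjs : j ∈ e.support := Finsupp.mem_support_iff.mpr fun h => hj (h ▸ dvd_zero d)
      have h1 : ρ g (e.prod fun j l => y j ^ l) = z ^ e j * e.prod fun j l => y j ^ l := by
        rw [Finsupp.prod, map_prod, ← Finset.mul_prod_erase _ _ hjs,
          ← Finset.mul_prod_erase _ (fun j => y j ^ e j) hjs, map_pow, hgj, mul_pow, mul_assoc]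
        congr 2
        refine Finset.prod_congr rfl fun l hl => ?_
        rw [map_pow, hgl l (Finset.ne_of_mem_erase hl)]
      -- The element g multiplies the monomial by z^(e_j) without changing its average, so 1 -
      -- z^(e_j) kills the average; it is a unit because d does not divide e_j.
      have h2 := av_act g (e.prod fun j l => y j ^ l)
      rw [h1, av_smul _ (pow_mem hz _)] at h2
      have h3 : (1 - z ^ e j) * av (e.prod fun j l => y j ^ l) = 0 := by rw [sub_mul, h2]; ring
      rw [(hzd _ hj).mul_right_eq_zero.mp h3]
      exact zero_mem B
  have hav (p : MvPolynomial ι B) : av (eval₂ B.subtype y p) ∈ B := by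
    induction p using MvPolynomial.induction_on' with
    | monomial e b =>
      rw [eval₂_monomial]
      exact av_smul _ b.2 _ ▸ mul_mem b.2 (hmon e)
    | add p q hp hq =>
      have : av (eval₂ B.subtype y (p + q)) =
          av (eval₂ B.subtype y p) + av (eval₂ B.subtype y q) := by
        simp only [av, eval₂_add, map_add, Finset.sum_add_distrib]
      exact this ▸ add_mem hp hq
  have hle : Subring.closure (B ∪ Set.range y) ≤ (eval₂Hom B.subtype y).range := by
    refine Subring.closure_le.mpr (Set.union_subset (fun b hb => ⟨C ⟨b, hb⟩, by simp⟩) ?_)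
    rintro _ ⟨j, rfl⟩
    exact ⟨X j, by simp⟩
  obtain ⟨p, hp⟩ := hle (hgen ▸ trivial : a ∈ Subring.closure (B ∪ Set.range y))
  have h1 : av a ∈ B := hp ▸ hav p
  have h2 : av a = (Nat.card G : A) * a := by
    simp only [av, ha, Finset.sum_const, Finset.card_univ, nsmul_eq_mul, Nat.card_eq_fintype_card]
  obtain ⟨b, hb, hbc⟩ := hcard
  have h3 : a = b * av a := by rw [h2, ← mul_assoc, hbc, one_mul]
  exact h3 ▸ mul_mem hb h1

end Average

/-! ### The parameters s, w, x_1², …, x_m² -/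

section Parametrization

open MvPolynomial

variable {k A : Type*} [Field k] [CommRing A] {m : ℕ}

/-- The parameters `s`, `w` and `x j ^ 2` for `1 ≤ j ≤ m`. -/
def params (s w : A) (x : Fin (m + 1) → A) : Fin (m + 2) → A :=
  Fin.cons s (Fin.cons w fun j => x j.succ ^ 2)

/-- The homomorphism from the polynomial ring given by the parameters. -/
def paramHom (σ : k →+* A) (s w : A) (x : Fin (m + 1) → A) :
    MvPolynomial (ULift (Fin (m + 2))) k →+* A :=
  eval₂Hom σ fun l => params s w x l.down

variable (σ : k →+* A) (s w : A) (x : Fin (m + 1) → A)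

theorem paramHom_C (a : k) : paramHom σ s w x (C a) = σ a := eval₂Hom_C ..

theorem paramHom_zero : paramHom σ s w x (X ⟨0⟩) = s := eval₂Hom_X' ..

theorem paramHom_one : paramHom σ s w x (X ⟨1⟩) = w := eval₂Hom_X' ..

theorem paramHom_succ (j : Fin m) : paramHom σ s w x (X ⟨j.succ.succ⟩) = x j.succ ^ 2 :=
  eval₂Hom_X' ..

variable {σ s w x}

theorem params_mem {B : Subring A} (hB : ∀ p, paramHom σ s w x p ∈ B) :
    s ∈ B ∧ w ∈ B ∧ (∀ j : Fin m, x j.succ ^ 2 ∈ B) ∧ ∀ a, σ a ∈ B :=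
  ⟨(paramHom_zero σ s w x).subst (motive := (· ∈ B)) (hB _),
    (paramHom_one σ s w x).subst (motive := (· ∈ B)) (hB _),
    fun j => (paramHom_succ σ s w x j).subst (motive := (· ∈ B)) (hB _),
    fun a => (paramHom_C σ s w x a).subst (motive := (· ∈ B)) (hB _)⟩

variable {y : Fin (m + 1) → A} {x' y' : A}

/-- Insert x' = s ∏ x_j and y' = w ∏ y_j in the equation of the last factor, use ∏ y_j² = ∏ x_j ∏
(x_j² - 1), and cancel ∏ x_j. -/
theorem relation_of_curve (hxy : ∀ j, y j ^ 2 = x j ^ 3 - x j) (hxy' : y' ^ 2 = x' ^ 3 - x')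
    (hs : s * ∏ j, x j = x') (hw : w * ∏ j, y j = y') (hu : IsUnit (∏ j, x j)) :
    w ^ 2 * ∏ j, (x j ^ 2 - 1) = s * (s ^ 2 * ∏ j, x j ^ 2 - 1) := by
  have h1 : (∏ j, y j) ^ 2 = (∏ j, x j) * ∏ j, (x j ^ 2 - 1) := by
    rw [← Finset.prod_pow, ← Finset.prod_mul_distrib]
    exact Finset.prod_congr rfl fun j _ => by rw [hxy]; ring
  refine hu.mul_left_cancel ?_
  rw [← hs, ← hw] at hxy'
  rw [Finset.prod_pow]
  linear_combination hxy' - w ^ 2 * h1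

/-- The relation has degree one in x_0². Solving for x_0² is the step that makes the quotient
rational. -/
theorem denom_mul_of_relation
    (h : w ^ 2 * ∏ j, (x j ^ 2 - 1) = s * (s ^ 2 * ∏ j, x j ^ 2 - 1)) :
    (w ^ 2 * ∏ j : Fin m, (x j.succ ^ 2 - 1) - s ^ 3 * ∏ j : Fin m, x j.succ ^ 2) * x 0 ^ 2 =
      w ^ 2 * ∏ j : Fin m, (x j.succ ^ 2 - 1) - s := by
  rw [Fin.prod_univ_succ, Fin.prod_univ_succ] at h
  linear_combination h

variable (hxy : ∀ j, y j ^ 2 = x j ^ 3 - x j) (hxy' : y' ^ 2 = x' ^ 3 - x')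
  (hs : s * ∏ j, x j = x') (hw : w * ∏ j, y j = y')
  (hf : IsUnit ((∏ j, y j) ^ 4 * y' ^ 4 * (x' ^ 2 - x 0 ^ 2)))

include hxy hf

theorem isUnit_coords (j : Fin (m + 1)) : IsUnit (y j) ∧ IsUnit (x j) ∧ IsUnit (x j ^ 2 - 1) := by
  have h1 : IsUnit (∏ j, y j) :=
    (isUnit_pow_iff four_ne_zero).mp (isUnit_of_mul_isUnit_left (isUnit_of_mul_isUnit_left hf))
  have h2 := IsUnit.prod_univ_iff.mp h1 j
  have h3 : x j * (x j ^ 2 - 1) = y j ^ 2 := by rw [hxy]; ring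
  have h4 := h3 ▸ h2.pow 2
  exact ⟨h2, isUnit_of_mul_isUnit_left h4, isUnit_of_mul_isUnit_right h4⟩

omit hf in
theorem y_pow_four (j : Fin (m + 1)) : y j ^ 4 = x j ^ 2 * (x j ^ 2 - 1) ^ 2 := by
  linear_combination (y j ^ 2 + x j ^ 3 - x j) * hxy j

include hxy' hs hw

theorem sq_zero_mem_unitFractions : x 0 ^ 2 ∈ unitFractions (paramHom σ s w x) := by
  have hux : IsUnit (∏ j, x j) :=
    IsUnit.prod_univ_iff.mpr fun j => (isUnit_coords hxy hf j).2.1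
  have hrel := relation_of_curve hxy hxy' hs hw hux
  have hden := denom_mul_of_relation hrel
  have hx' : x' ^ 2 = s ^ 2 * (x 0 ^ 2 * ∏ j : Fin m, x j.succ ^ 2) := by
    rw [← hs, mul_pow, ← Finset.prod_pow, Fin.prod_univ_succ]
  have hy' : IsUnit y' :=
    (isUnit_pow_iff four_ne_zero).mp (isUnit_of_mul_isUnit_right (isUnit_of_mul_isUnit_left hf))
  have hus : IsUnit s := by
    have h : x' * (x' ^ 2 - 1) = y' ^ 2 := by rw [hxy']; ring
    exact isUnit_of_mul_isUnit_left (hs ▸ isUnit_of_mul_isUnit_left (h ▸ hy'.pow 2))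
  -- The denominator D of x_0² satisfies D (x_0² - 1) x_0² = s (x'² - x_0²), and this is why x'² -
  -- x_0² is a factor of the function to be inverted.
  have hu : IsUnit (w ^ 2 * ∏ j : Fin m, (x j.succ ^ 2 - 1) -
      s ^ 3 * ∏ j : Fin m, x j.succ ^ 2) := by
    have h : (w ^ 2 * ∏ j : Fin m, (x j.succ ^ 2 - 1) - s ^ 3 * ∏ j : Fin m, x j.succ ^ 2) *
        ((x 0 ^ 2 - 1) * x 0 ^ 2) = s * (x' ^ 2 - x 0 ^ 2) := by
      linear_combination x 0 ^ 2 * hden - s * hx'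
    exact isUnit_of_mul_isUnit_left (h ▸ hus.mul (isUnit_of_mul_isUnit_right hf))
  obtain ⟨hms, hmw, hmx, -⟩ := params_mem (map_mem_unitFractions (paramHom σ s w x))
  have hP := prod_mem (t := Finset.univ) fun j (_ : j ∈ Finset.univ) => sub_mem (hmx j) (one_mem _)
  refine mem_unitFractions_of_mul_eq (sub_mem (mul_mem (pow_mem hmw 2) hP)
    (mul_mem (pow_mem hms 3) (prod_mem fun j _ => hmx j))) hu ?_
  rw [hden]
  exact sub_mem (mul_mem (pow_mem hmw 2) hP) hms

/-- A single denominator `h` is chosen for the y_j⁴, for the inverses of x_j² - 1 and for the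
inverse of the discriminant. Then x_j = y_j² (x_j² - 1)⁻¹, x' = s ∏ x_j and y' = w ∏ y_j lie in the
ring generated by the y_j over the fractions. -/
theorem exists_fractions_eq_top (hgen : ∀ a : A, ∃ n : ℕ,
      ((∏ j, y j) ^ 4 * y' ^ 4 * (x' ^ 2 - x 0 ^ 2)) ^ n * a ∈
        Subring.closure (Set.range σ ∪ Set.range x ∪ Set.range y ∪ {x', y'})) :
    ∃ h, IsUnit (paramHom σ s w x h) ∧ (∀ j, y j ^ 4 ∈ fractions (paramHom σ s w x) h) ∧
      Subring.closure (fractions (paramHom σ s w x) h ∪ Set.range y) = ⊤ := by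
  set θ := paramHom σ s w x with hθ
  have hm0 : x 0 ^ 2 ∈ unitFractions θ := sq_zero_mem_unitFractions hxy hxy' hs hw hf
  obtain ⟨hms, hmw, hmx', -⟩ := params_mem (map_mem_unitFractions θ)
  have hmx (j : Fin (m + 1)) : x j ^ 2 ∈ unitFractions θ := Fin.cases hm0 hmx' j
  have hmx1 (j : Fin (m + 1)) : x j ^ 2 - 1 ∈ unitFractions θ := sub_mem (hmx j) (one_mem _)
  have hmy (j : Fin (m + 1)) : y j ^ 4 ∈ unitFractions θ :=
    y_pow_four hxy j ▸ mul_mem (hmx j) (pow_mem (hmx1 j) 2)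
  have hmf : (∏ j, y j) ^ 4 * y' ^ 4 * (x' ^ 2 - x 0 ^ 2) ∈ unitFractions θ := by
    rw [← hs, ← hw, mul_pow, mul_pow, ← Finset.prod_pow, ← Finset.prod_pow]
    have h1 := prod_mem (t := Finset.univ) fun j (_ : j ∈ Finset.univ) => hmy j
    have h2 := prod_mem (t := Finset.univ) fun j (_ : j ∈ Finset.univ) => hmx j
    exact mul_mem (mul_mem h1 (mul_mem (pow_mem hmw 4) h1))
      (sub_mem (mul_mem (pow_mem hms 2) h2) hm0)
  choose v hv using fun j => (isUnit_coords hxy hf j).2.2.exists_right_inv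
  obtain ⟨b, hb⟩ := hf.exists_right_inv
  have hmv (j) : v j ∈ unitFractions θ := mem_unitFractions_of_mul_eq (hmx1 j)
    (isUnit_coords hxy hf j).2.2 ((hv j).symm.subst (motive := (· ∈ unitFractions θ)) (one_mem _))
  have hmb : b ∈ unitFractions θ := mem_unitFractions_of_mul_eq hmf hf
    (hb.symm.subst (motive := (· ∈ unitFractions θ)) (one_mem _))
  obtain ⟨h, hh, hall⟩ := exists_forall_mem_fractions (θ := θ)
    (Sum.elim (Sum.elim v fun j => y j ^ 4) fun _ : Unit => b) (by
      rintro ((j | j) | j)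
      exacts [hmv j, hmy j, hmb])
  refine ⟨h, hh, fun j => hall (.inl (.inr j)), eq_top_iff.mpr fun a _ => ?_⟩
  set T := Subring.closure (fractions θ h ∪ Set.range y : Set A) with hT
  have hBT : fractions θ h ≤ T := fun a ha => Subring.subset_closure (.inl ha)
  obtain ⟨hsT, hwT, -, hσT⟩ := params_mem (fun p => hBT (map_mem_fractions θ h p))
  have hyT (j) : y j ∈ T := Subring.subset_closure (.inr ⟨j, rfl⟩)
  have hxT (j) : x j ∈ T := by
    have : x j = y j ^ 2 * v j := by linear_combination (- v j) * hxy j - x j * hv j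
    exact this ▸ mul_mem (pow_mem (hyT j) 2) (hBT (hall (.inl (.inl j))))
  have hle : Subring.closure (Set.range σ ∪ Set.range x ∪ Set.range y ∪ {x', y'}) ≤ T := by
    refine Subring.closure_le.mpr ?_
    rintro _ (((⟨a, rfl⟩ | ⟨j, rfl⟩) | ⟨j, rfl⟩) | rfl | rfl)
    · exact hσT a
    · exact hxT j
    · exact hyT j
    · exact hs ▸ mul_mem hsT (prod_mem fun j _ => hxT j)
    · exact hw ▸ mul_mem hwT (prod_mem fun j _ => hyT j)
  obtain ⟨n, hn⟩ := hgen a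
  have ha : a = b ^ n * (((∏ j, y j) ^ 4 * y' ^ 4 * (x' ^ 2 - x 0 ^ 2)) ^ n * a) := by
    rw [← mul_assoc, ← mul_pow, mul_comm b, hb, one_pow, one_mul]
  rw [ha]
  exact mul_mem (pow_mem (hBT (hall (.inr ()))) n) (hle hn)

end Parametrization

end ZQuot

namespace ZQuot

/-! ### Algebraic independence of the parameters -/

section GenericPoint

open MvPolynomial

/-- With y_j a fourth root of v_j (v_j - 1)² and x_j = y_j²/(v_j - 1), both x_j² = v_j and the
equation of the curve follow. The relation `h` is then the equation for the last factor. -/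
theorem exists_curve_points {L : Type*} [Field L] [IsAlgClosed L] {m : ℕ} {s w : L}
    {v : Fin (m + 1) → L} (hv : ∀ j, v j ≠ 0) (hv1 : ∀ j, v j - 1 ≠ 0) (hw : w ≠ 0)
    (hsv : s ^ 2 * ∏ j, v j ≠ v 0)
    (h : w ^ 2 * ∏ j, (v j - 1) = s * (s ^ 2 * ∏ j, v j - 1)) :
    ∃ x y : Fin (m + 1) → L, (∀ j, x j ^ 2 = v j) ∧ (∀ j, y j ^ 2 = x j ^ 3 - x j) ∧
      (w * ∏ j, y j) ^ 2 = (s * ∏ j, x j) ^ 3 - s * ∏ j, x j ∧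
      (∏ j, y j) ^ 4 * (w * ∏ j, y j) ^ 4 * ((s * ∏ j, x j) ^ 2 - x 0 ^ 2) ≠ 0 := by
  choose y hy using fun j => IsAlgClosed.exists_pow_nat_eq (v j * (v j - 1) ^ 2) four_pos
  let x (j : Fin (m + 1)) : L := y j ^ 2 / (v j - 1)
  have hx (j) : x j ^ 2 = v j := by
    have h4 : (y j ^ 2) ^ 2 = v j * (v j - 1) ^ 2 := by rw [← hy]; ring
    simp only [x, div_pow]
    rw [h4, mul_div_cancel_right₀ _ (pow_ne_zero 2 (hv1 j))]
  have hxy (j) : y j ^ 2 = x j * (x j ^ 2 - 1) := by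
    rw [hx, div_mul_cancel₀ _ (hv1 j)]
  have hy0 (j) : y j ≠ 0 := fun h0 => by
    have := hy j
    rw [h0, zero_pow four_ne_zero] at this
    exact mul_ne_zero (hv j) (pow_ne_zero 2 (hv1 j)) this.symm
  have hP : (∏ j, y j) ^ 2 = (∏ j, x j) * ∏ j, (v j - 1) := by
    rw [← Finset.prod_pow, ← Finset.prod_mul_distrib]
    exact Finset.prod_congr rfl fun j _ => by rw [hxy, hx]
  have hQ : (∏ j, x j) ^ 2 = ∏ j, v j := by
    rw [← Finset.prod_pow]
    exact Finset.prod_congr rfl fun j _ => hx j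
  have hyP : ∏ j, y j ≠ 0 := Finset.prod_ne_zero_iff.mpr fun j _ => hy0 j
  refine ⟨x, y, hx, fun j => by rw [hxy]; ring, ?_, ?_⟩
  · rw [mul_pow, hP]
    linear_combination (∏ j, x j) * h - s ^ 3 * (∏ j, x j) * hQ
  · refine mul_ne_zero (mul_ne_zero (pow_ne_zero 4 hyP) (pow_ne_zero 4 (mul_ne_zero hw hyP))) ?_
    rw [mul_pow, hQ, hx]
    exact sub_ne_zero.mpr hsv

/-- The generic point of affine space lifts, over an algebraic closure, to a point of the power of
the curve with the given parameters. -/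
theorem exists_generic_point (k : Type u) [Field k] (m : ℕ) :
    ∃ (L : Type u) (_ : Field L) (σ : k →+* L) (x y : Fin (m + 1) → L) (s w : L),
      (∀ j, y j ^ 2 = x j ^ 3 - x j) ∧
      (w * ∏ j, y j) ^ 2 = (s * ∏ j, x j) ^ 3 - s * ∏ j, x j ∧
      (∏ j, y j) ^ 4 * (w * ∏ j, y j) ^ 4 * ((s * ∏ j, x j) ^ 2 - x 0 ^ 2) ≠ 0 ∧
      Function.Injective
        (paramHom σ s w x : MvPolynomial (ULift.{u} (Fin (m + 2))) k →+* L) := by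
  let P := MvPolynomial (ULift.{u} (Fin (m + 2))) k
  let L := AlgebraicClosure (FractionRing P)
  let ι : P →+* L := (algebraMap (FractionRing P) L).comp (algebraMap P (FractionRing P))
  have hι : Function.Injective ι :=
    (algebraMap (FractionRing P) L).injective.comp (IsFractionRing.injective P (FractionRing P))
  -- The specialization s = 0, w = 1, t_j = 0 takes the value ±1 on w, t_j - 1, N, D and s² ∏ t_j -
  -- 1, which shows that none of them vanishes.
  let ev : P →+* k := eval (fun l => if l = ⟨1⟩ then 1 else 0)
  have hev {p : P} (hp : ev p ≠ 0) : ι p ≠ 0 := fun h =>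
    hp (by rw [(map_eq_zero_iff ι hι).mp h, map_zero])
  have ev0 : ev (X ⟨0⟩) = 0 := (eval_X _).trans (by simp)
  have ev1 : ev (X ⟨1⟩) = 1 := (eval_X _).trans (by simp)
  have evs (j : Fin m) : ev (X ⟨j.succ.succ⟩) = 0 := by
    have : j.succ.succ ≠ 1 := fun h => Fin.succ_ne_zero j (Fin.succ_injective _ h)
    exact (eval_X _).trans (by simp [this])
  let s := ι (X ⟨0⟩)
  let w := ι (X ⟨1⟩)
  let t (j : Fin m) := ι (X ⟨j.succ.succ⟩)
  -- N / D is the value of x_0² forced by `denom_mul_of_relation`.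
  let N := w ^ 2 * ∏ j, (t j - 1) - s
  let D := w ^ 2 * ∏ j, (t j - 1) - s ^ 3 * ∏ j, t j
  have hw : w ≠ 0 := hev (by rw [ev1]; exact one_ne_zero)
  have hs : s ≠ 0 := (map_ne_zero_iff ι hι).mpr (X_ne_zero _)
  have ht (j) : t j ≠ 0 := (map_ne_zero_iff ι hι).mpr (X_ne_zero _)
  have ht1 (j) : t j - 1 ≠ 0 := by
    have : ι (X ⟨j.succ.succ⟩ - 1) ≠ 0 := hev (by simp [evs])
    simpa [t] using this
  have hN : N ≠ 0 := by
    have : ι (X ⟨1⟩ ^ 2 * ∏ j : Fin m, (X ⟨j.succ.succ⟩ - 1) - X ⟨0⟩) ≠ 0 :=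
      hev (by simp [evs, ev0, ev1])
    simpa [N, t, s, w] using this
  have hD : D ≠ 0 := by
    have : ι (X ⟨1⟩ ^ 2 * ∏ j : Fin m, (X ⟨j.succ.succ⟩ - 1) -
        X ⟨0⟩ ^ 3 * ∏ j : Fin m, X ⟨j.succ.succ⟩) ≠ 0 := hev (by simp [evs, ev0, ev1])
    simpa [D, t, s, w] using this
  have hsQ : s ^ 2 * ∏ j, t j - 1 ≠ 0 := by
    have : ι (X ⟨0⟩ ^ 2 * ∏ j : Fin m, X ⟨j.succ.succ⟩ - 1) ≠ 0 := hev (by simp [ev0])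
    simpa [t, s] using this
  have hND : N / D * D = N := div_mul_cancel₀ _ hD
  have hND0 : N / D ≠ 0 := div_ne_zero hN hD
  have hND1 : N / D - 1 ≠ 0 := by
    intro h
    have : N = D := by rw [← hND, sub_eq_zero.mp h, one_mul]
    refine mul_ne_zero hs hsQ ?_
    simp only [N, D] at this
    linear_combination this
  obtain ⟨x, y, hx, h1, h2, h3⟩ := exists_curve_points (s := s) (w := w)
    (v := Fin.cons (N / D) t) (Fin.cases hND0 ht) (Fin.cases hND1 ht1) hw (by
      rw [Fin.prod_univ_succ]
      simp only [Fin.cons_zero, Fin.cons_succ]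
      intro h
      refine mul_ne_zero hND0 hsQ ?_
      linear_combination h) (by
      rw [Fin.prod_univ_succ, Fin.prod_univ_succ]
      simp only [Fin.cons_zero, Fin.cons_succ]
      have : N / D * (w ^ 2 * ∏ j, (t j - 1) - s ^ 3 * ∏ j, t j) =
        w ^ 2 * ∏ j, (t j - 1) - s := hND
      linear_combination this)
  refine ⟨L, inferInstance, ι.comp C, x, y, s, w, h1, h2, h3, ?_⟩
  have : paramHom (ι.comp C) s w x = ι := by
    refine MvPolynomial.ringHom_ext (fun a => paramHom_C ..) ?_
    rintro ⟨l⟩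
    refine Fin.cases (paramHom_zero ..) (Fin.cases (paramHom_one ..) fun j => ?_) l
    rw [paramHom_succ, hx]
    rfl
  exact (congrArg (fun f : P →+* L => Function.Injective f) this).mpr hι

end GenericPoint

end ZQuot

namespace ZQuot

/-! ### The action on the power of the curve and its affine charts -/

section Power

variable {k : Type u} [Field k] {n : ℕ}

/-- The open subset `U₁ × ⋯ × Uₙ` of the power of the curve. -/
def powBox (U : Fin n → (curve k).left.Opens) : (curvePow k n).left.Opens :=
  box (fun _ => curve k) U

theorem isAffineOpen_powBox {U : Fin n → (curve k).left.Opens} (hU : ∀ j, IsAffineOpen (U j)) :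
    IsAffineOpen (powBox U) :=
  (isAffineOpen_box_and_boxRing_eq_top (F := fun _ => curve k) hU).1

theorem isAffineOpen_inf_of_isVariety {k : CommRingCat.{u}} {X : Over (Spec k)} (hX : IsVariety X)
    (V W : X.left.Opens) (hV : IsAffineOpen V) (hW : IsAffineOpen W) : IsAffineOpen (V ⊓ W) := by
  have := hX.separated
  have : X.left.IsSeparated := ⟨by
    rw [← terminal.comp_from X.hom]
    infer_instance⟩
  exact hV.inf hW

variable (c : k) (hc : c ^ 2 = -1)

/-- The generator of the group which acts by `τ` on the factors `j` and `n - 1`. -/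
def generator (n : ℕ) (j : Fin n) : Aut (curvePow k n) :=
  factorwise fun l => if l = j ∨ (l : ℕ) + 1 = n then tau c hc else 1

theorem generator_π (j l : Fin n) :
    (generator c hc n j).hom ≫ Pi.π (fun _ => curve k) l = Pi.π (fun _ => curve k) l ≫
      (if l = j ∨ (l : ℕ) + 1 = n then tau c hc else 1 : Aut (curve k)).hom :=
  mapIso_hom_π (E := fun _ : Fin n => curve k)
    (fun l => (if l = j ∨ (l : ℕ) + 1 = n then tau c hc else 1 : Aut (curve k))) l

theorem generator_mem {j : Fin n} (hj : (j : ℕ) + 1 < n) :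
    generator c hc n j ∈ groupH n c hc := Subgroup.subset_closure ⟨j, hj, rfl⟩

theorem generator_preimage_powBox {U : Fin n → (curve k).left.Opens}
    (hU : ∀ j, (tau c hc).hom.left ⁻¹ᵁ U j = U j) (j : Fin n) :
    (generator c hc n j).hom.left ⁻¹ᵁ powBox U = powBox U := by
  refine preimage_box (F := fun _ => curve k) (generator c hc n j).hom _
    (generator_π c hc j) fun l => ?_
  have key (f : Aut (curve k)) (hf : f = tau c hc ∨ f = 1) :
      f.hom.left ⁻¹ᵁ U l = U l := by
    rcases hf with rfl | rfl
    exacts [hU l, rfl]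
  exact key _ (ite_eq_or_eq ..)

theorem isInvariantOpen_powBox {U : Fin n → (curve k).left.Opens}
    (hU : ∀ j, (tau c hc).hom.left ⁻¹ᵁ U j = U j) :
    IsInvariantOpen (groupH n c hc) (powBox U) := by
  refine isInvariantOpen_closure ?_
  rintro _ ⟨j, -, rfl⟩
  exact generator_preimage_powBox c hc hU j

/-- For each factor one of the τ-stable affine charts Y ≠ 0 and Z ≠ 0 contains the projection of
`x`; the product of these choices is the required open. -/
theorem exists_isInvariantOpen_isAffineOpen (x : (curvePow k n).left) :
    ∃ V : (curvePow k n).left.Opens,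
      x ∈ V ∧ IsInvariantOpen (groupH n c hc) V ∧ IsAffineOpen V := by
  have key (a : (curve k).left) : ∃ U : (curve k).left.Opens, a ∈ U ∧
      (tau c hc).hom.left ⁻¹ᵁ U = U ∧ IsAffineOpen U := by
    have ha : a ∈ chart k 1 ⊔ chart k 2 := chart_sup_chart k ▸ trivial
    rcases ha with ha | ha
    · exact ⟨chart k 1, ha, tauProj_preimage_chart_one c hc, isAffineOpen_chart k 1⟩
    · exact ⟨chart k 2, ha, tauProj_preimage_chart_two c hc, isAffineOpen_chart k 2⟩
  choose U hxU hU hUa using fun j : Fin n => key ((Pi.π (fun _ : Fin n => curve k) j).left x)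
  exact ⟨powBox U, hxU, isInvariantOpen_powBox c hc hU, isAffineOpen_powBox hUa⟩

theorem exists_isQuotient_curvePow [Finite (groupH n c hc)] :
    ∃ (Z : Over (Spec (CommRingCat.of k))) (π : curvePow k n ⟶ Z), IsQuotient (groupH n c hc) π :=
  exists_isQuotient (isAffineOpen_inf_of_isVariety (isVariety_curvePow k n))
    (exists_isInvariantOpen_isAffineOpen c hc)

variable (k n) in
/-- The product of the affine charts. -/
def affineBox : (curvePow k n).left.Opens := powBox fun _ => affineChart k

variable (k n) in
theorem isAffineOpen_affineBox : IsAffineOpen (affineBox k n) :=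
  isAffineOpen_powBox fun _ => isAffineOpen_chart k 2

theorem isInvariantOpen_affineBox : IsInvariantOpen (groupH n c hc) (affineBox k n) :=
  isInvariantOpen_powBox c hc fun _ => tau_preimage_affineChart c hc

variable (k) in
/-- The pullback of functions on the affine chart of the factor `l`. -/
def factorInc (l : Fin n) : Γ((curve k).left, affineChart k) →+*
    Γ((curvePow k n).left, affineBox k n) :=
  boxInc (fun _ => curve k) (fun _ => affineChart k) l

theorem factorInc_scalar (l : Fin n) (a : k) :
    factorInc k l (scalar _ a) = scalar (affineBox k n) a := boxInc_scalar ..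

variable (k) in
/-- The coordinate function `x` on the factor `l`. -/
def xCoord (l : Fin n) : Γ((curvePow k n).left, affineBox k n) := factorInc k l (coordSection k 0)

variable (k) in
/-- The coordinate function `y` on the factor `l`. -/
def yCoord (l : Fin n) : Γ((curvePow k n).left, affineBox k n) := factorInc k l (coordSection k 1)

theorem yCoord_sq (l : Fin n) : yCoord k l ^ 2 = xCoord k l ^ 3 - xCoord k l := by
  rw [yCoord, xCoord, ← map_pow, coordSection_eq, map_sub, map_pow]

theorem closure_coords : Subring.closure (Set.range (scalar (affineBox k n)) ∪
    Set.range (xCoord k) ∪ Set.range (yCoord k)) = ⊤ := by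
  set T := Subring.closure (Set.range (scalar (affineBox k n)) ∪
    Set.range (xCoord k) ∪ Set.range (yCoord k)) with hT
  have h := (isAffineOpen_box_and_boxRing_eq_top (F := fun _ : Fin n => curve k)
    (fun _ => isAffineOpen_chart k 2)).2
  refine eq_top_iff.mpr (h.symm.trans_le (Subring.closure_le.mpr (Set.iUnion_subset ?_)))
  rintro (_ | l)
  · rintro _ ⟨a, rfl⟩
    exact Subring.subset_closure (.inl (.inl ⟨a, rfl⟩))
  · rintro _ ⟨s, rfl⟩
    obtain ⟨p, rfl⟩ := exists_eval₂_coordSection_eq s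
    change factorInc k l _ ∈ T
    have hs (a : k) : factorInc k l (scalar _ a) ∈ T := by
      rw [factorInc_scalar]
      exact Subring.subset_closure (.inl (.inl ⟨a, rfl⟩))
    induction p using MvPolynomial.induction_on with
    | C a =>
      rw [MvPolynomial.eval₂_C]
      exact hs a
    | add p q hp hq =>
      rw [MvPolynomial.eval₂_add, map_add]
      exact add_mem hp hq
    | mul_X p i hp =>
      rw [MvPolynomial.eval₂_mul, MvPolynomial.eval₂_X, map_mul]
      refine mul_mem hp ?_
      fin_cases i
      · exact Subring.subset_closure (.inl (.inr ⟨l, rfl⟩))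
      · exact Subring.subset_closure (.inr ⟨l, rfl⟩)
      · change factorInc k l (coordSection k 2) ∈ T
        rw [coordSection_two, map_one]
        exact one_mem T

/-- The values on scalars are read off from some factor, whence the condition 0 < n in that clause.
-/
theorem exists_lift_affineBox {C : Type u} [CommRing C] (f : k →+* C) (x y : Fin n → C)
    (hxy : ∀ l, y l ^ 2 = x l ^ 3 - x l) : ∃ G : Γ((curvePow k n).left, affineBox k n) →+* C,
      (0 < n → ∀ a, G (scalar _ a) = f a) ∧ (∀ l, G (xCoord k l) = x l) ∧
        ∀ l, G (yCoord k l) = y l := by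
  choose g hg hx hy using fun l => exists_lift_section f (x l) (y l) (hxy l)
  obtain ⟨G, hG⟩ := exists_lift_box (F := fun _ : Fin n => curve k)
    (fun _ => isAffineOpen_chart k 2) f g hg
  refine ⟨G, fun hn a => ?_, fun l => (hG l _).trans (hx l), fun l => (hG l _).trans (hy l)⟩
  exact (congrArg G (factorInc_scalar ⟨0, hn⟩ a).symm).trans ((hG ⟨0, hn⟩ _).trans (hg _ a))

section Action

variable (hV : IsInvariantOpen (groupH n c hc) (affineBox k n)) {j : Fin n}
  (hj : (j : ℕ) + 1 < n) (l : Fin n)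

theorem pull_generator_factorInc (s : Γ((curve k).left, affineChart k)) (f : Aut (curve k))
    (hf : (if l = j ∨ (l : ℕ) + 1 = n then tau c hc else 1) = f)
    (e : affineChart k ≤ f.hom.left ⁻¹ᵁ affineChart k) :
    pull hV ⟨generator c hc n j, generator_mem c hc hj⟩ (factorInc k l s) =
      factorInc k l (f.hom.left.appLE _ _ e s) := by
  subst hf
  exact appLE_boxInc (F := fun _ : Fin n => curve k) (generator c hc n j).hom _
    (generator_π c hc j) (hV _ (generator_mem c hc hj)).ge l e s

theorem pull_generator_of_ne (hl : ¬ (l = j ∨ (l : ℕ) + 1 = n))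
    (s : Γ((curve k).left, affineChart k)) :
    pull hV ⟨generator c hc n j, generator_mem c hc hj⟩ (factorInc k l s) = factorInc k l s := by
  rw [pull_generator_factorInc c hc hV hj l s 1 (if_neg hl) le_rfl]
  refine congrArg (factorInc k l) ?_
  have aux {Y : Scheme.{u}} {V : Y.Opens} (e : V ≤ 𝟙 Y ⁻¹ᵁ V) (s : Γ(Y, V)) :
      (𝟙 Y : Y ⟶ Y).appLE V V e s = s := by
    rw [Scheme.Hom.appLE]
    exact congr($(Y.presheaf.map_id _) s)
  exact aux _ s

theorem pull_generator_xCoord (hl : l = j ∨ (l : ℕ) + 1 = n) :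
    pull hV ⟨generator c hc n j, generator_mem c hc hj⟩ (xCoord k l) = -xCoord k l := by
  rw [xCoord, pull_generator_factorInc c hc hV hj l _ _ (if_pos hl)
    (tau_preimage_affineChart c hc).ge, tau_coordSection_zero, map_neg]

theorem pull_generator_yCoord (hl : l = j ∨ (l : ℕ) + 1 = n) :
    pull hV ⟨generator c hc n j, generator_mem c hc hj⟩ (yCoord k l) =
      scalar _ c * yCoord k l := by
  rw [yCoord, pull_generator_factorInc c hc hV hj l _ _ (if_pos hl)
    (tau_preimage_affineChart c hc).ge, tau_coordSection_one, map_mul, factorInc_scalar]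

end Action

end Power

end ZQuot

namespace ZQuot

/-! ### Eigenvectors and eigenvalues -/

section Eigen

/-- The element `s` is a quotient of two eigenvectors with the same eigenvalue `z`. -/
theorem map_eq_self_of_mul_prod_eq {A ι : Type*} [CommRing A] [Fintype ι] {P : A →+* A}
    {x : ι → A} {x' s z : A} {j : ι} (hj : P (x j) = z * x j) (hl : ∀ l ≠ j, P (x l) = x l)
    (hx' : P x' = z * x') (hs : s * ∏ l, x l = x') (hu : IsUnit (∏ l, x l)) (hz : IsUnit z) :
    P s = s := by
  classical
  have h1 : P (∏ l, x l) = z * ∏ l, x l := by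
    rw [map_prod, ← Finset.mul_prod_erase _ _ (Finset.mem_univ j),
      ← Finset.mul_prod_erase _ x (Finset.mem_univ j), hj, mul_assoc]
    congr 2
    exact Finset.prod_congr rfl fun l h => hl l (Finset.ne_of_mem_erase h)
  have h2 := congrArg P hs
  rw [map_mul, h1, hx', ← hs] at h2
  refine (hz.mul hu).mul_right_cancel ?_
  linear_combination h2

/-- As 2 ≠ 0, c² = -1 differs from 1, so c has order exactly 4 and 1 - c^e is a nonzero scalar. -/
theorem isUnit_one_sub_map_pow {k A : Type*} [Field k] [CommRing A] (σ : k →+* A)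
    (h2 : (2 : k) ≠ 0) {c : k} (hc : c ^ 2 = -1) {e : ℕ} (he : ¬ 4 ∣ e) :
    IsUnit (1 - σ c ^ e) := by
  have h4 : orderOf c = 4 := by
    refine orderOf_eq_prime_pow (p := 2) (n := 1) ?_ ?_
    · rw [pow_one, hc]
      intro h
      exact h2 (by linear_combination -h)
    · norm_num
      linear_combination (c ^ 2 - 1) * hc
  have : (1 : k) - c ^ e ≠ 0 := fun h =>
    he (h4 ▸ orderOf_dvd_of_pow_eq_one (sub_eq_zero.mp h).symm)
  simpa using this.isUnit.map σ

end Eigen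

section Extend

variable {Y : Scheme.{u}} {V W : Y.Opens}

theorem exists_extend_basicOpen (hV : IsAffineOpen V) (f : Γ(Y, V)) (hW : W = Y.basicOpen f)
    (e : W ≤ V) {C : Type*} [CommRing C] (G : Γ(Y, V) →+* C) (hG : IsUnit (G f)) :
    ∃ G' : Γ(Y, W) →+* C, ∀ s, G' (Y.presheaf.map (homOfLE e).op s) = G s := by
  subst hW
  have := hV.isLocalization_basicOpen f
  exact ⟨IsLocalization.Away.lift f hG, fun s => IsLocalization.Away.lift_eq f hG s⟩

end Extend

/-! ### The open set where the parameters are defined -/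

section Chart

variable {k : Type u} [Field k] (c : k) (hc : c ^ 2 = -1)

theorem mem_invariants_groupH {n : ℕ} {V : (curvePow k n).left.Opens}
    {hV : IsInvariantOpen (groupH n c hc) V} {s : Γ((curvePow k n).left, V)}
    (h : ∀ (j : Fin n) (hj : (j : ℕ) + 1 < n),
      pull hV ⟨generator c hc n j, generator_mem c hc hj⟩ s = s) : s ∈ invariants hV := by
  refine mem_invariants_closure (hV := hV) ?_
  rintro _ ⟨j, hj, rfl⟩
  exact h j hj

theorem pull_scalar {n : ℕ} {V : (curvePow k n).left.Opens}
    (hV : IsInvariantOpen (groupH n c hc) V) (g : groupH n c hc) (a : k) :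
    pull hV g (scalar V a) = scalar V a := appLE_scalar g.1.hom _ a

variable (k) in
/-- The function whose nonvanishing defines the open subset on which the parameters are defined. -/
def discriminant (m : ℕ) : Γ((curvePow k (m + 2)).left, affineBox k (m + 2)) :=
  (∏ j : Fin (m + 1), yCoord k j.castSucc) ^ 4 * yCoord k (Fin.last (m + 1)) ^ 4 *
    (xCoord k (Fin.last (m + 1)) ^ 2 - xCoord k (Fin.castSucc 0) ^ 2)

theorem discriminant_mem_invariants (m : ℕ)
    (hV : IsInvariantOpen (groupH (m + 2) c hc) (affineBox k (m + 2))) :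
    discriminant k m ∈ invariants hV := by
  have hx (l) : xCoord k l ^ 2 ∈ invariants hV := by
    refine mem_invariants_groupH c hc fun j hj => ?_
    rw [map_pow]
    by_cases hl : l = j ∨ (l : ℕ) + 1 = m + 2
    · rw [pull_generator_xCoord c hc hV hj l hl, neg_sq]
    · rw [xCoord, pull_generator_of_ne c hc hV hj l hl]
  have hy (l) : yCoord k l ^ 4 ∈ invariants hV := by
    refine mem_invariants_groupH c hc fun j hj => ?_
    rw [map_pow]
    by_cases hl : l = j ∨ (l : ℕ) + 1 = m + 2
    · have h4 : c ^ 4 = 1 := by linear_combination (c ^ 2 - 1) * hc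
      rw [pull_generator_yCoord c hc hV hj l hl, mul_pow, ← map_pow, h4, map_one, one_mul]
    · rw [yCoord, pull_generator_of_ne c hc hV hj l hl]
  rw [discriminant, ← Finset.prod_pow]
  exact mul_mem (mul_mem (prod_mem fun j _ => hy _) (hy _)) (sub_mem (hx _) (hx _))

theorem closure_coords_succ (m : ℕ) : Subring.closure (Set.range (scalar (affineBox k (m + 1))) ∪
    Set.range (fun j : Fin m => xCoord k j.castSucc) ∪
    Set.range (fun j : Fin m => yCoord k j.castSucc) ∪
    {xCoord k (Fin.last m), yCoord k (Fin.last m)}) = ⊤ := by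
  refine eq_top_iff.mpr (closure_coords.symm.trans_le (Subring.closure_mono ?_))
  rintro _ ((⟨a, rfl⟩ | ⟨l, rfl⟩) | ⟨l, rfl⟩)
  · exact .inl (.inl (.inl ⟨a, rfl⟩))
  · exact Fin.lastCases (.inr (.inl rfl)) (fun j => .inl (.inl (.inr ⟨j, rfl⟩))) l
  · exact Fin.lastCases (.inr (.inr rfl)) (fun j => .inl (.inr ⟨j, rfl⟩)) l

/-- The generic point, seen as a homomorphism on the functions of the affine box. It shows that the
discriminant is not zero and carries the independence of the parameters. -/
theorem exists_lift_discriminant (k : Type u) [Field k] (m : ℕ) : ∃ (L : Type u) (_ : Field L)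
    (σ : k →+* L) (x : Fin (m + 1) → L) (s w : L)
    (G : Γ((curvePow k (m + 2)).left, affineBox k (m + 2)) →+* L),
    (∀ a, G (scalar _ a) = σ a) ∧ (∀ j : Fin (m + 1), G (xCoord k j.castSucc) = x j) ∧
    G (xCoord k (Fin.last _)) = s * ∏ j : Fin (m + 1), G (xCoord k j.castSucc) ∧
    G (yCoord k (Fin.last _)) = w * ∏ j : Fin (m + 1), G (yCoord k j.castSucc) ∧
    G (discriminant k m) ≠ 0 ∧ Function.Injective
      (paramHom σ s w x : MvPolynomial (ULift.{u} (Fin (m + 2))) k →+* L) := by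
  obtain ⟨L, _, σ, x, y, s, w, hxy, hxy', hf, hinj⟩ := exists_generic_point k m
  obtain ⟨G, hσ, hx, hy⟩ := exists_lift_affineBox (n := m + 2) σ
    (Fin.lastCases (s * ∏ j, x j) x) (Fin.lastCases (w * ∏ j, y j) y) fun l =>
      Fin.lastCases (by simpa using hxy') (fun j => by simpa using hxy j) l
  have hx1 := hx (Fin.last _)
  have hy1 := hy (Fin.last _)
  have hx2 (j : Fin (m + 1)) := hx j.castSucc
  have hy2 (j : Fin (m + 1)) := hy j.castSucc
  simp only [Fin.lastCases_last, Fin.lastCases_castSucc] at hx1 hy1 hx2 hy2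
  refine ⟨L, _, σ, x, s, w, G, hσ (Nat.succ_pos _), hx2, ?_, ?_, ?_, hinj⟩
  · simp only [hx1, hx2]
  · simp only [hy1, hy2]
  · simpa only [discriminant, map_mul, map_sub, map_pow, map_prod, hx1, hx2, hy1, hy2] using hf

end Chart

end ZQuot

namespace ZQuot

/-! ### The chart of invariants and rationality -/

section Chart

open MvPolynomial

variable {k : Type u} [Field k] (h2 : (2 : k) ≠ 0) (c : k) (hc : c ^ 2 = -1) (m : ℕ)

theorem nonempty_basicOpen_discriminant :
    Nonempty ((curvePow k (m + 2)).left.basicOpen (discriminant k m)) := by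
  have := (isVariety_curvePow k (m + 2)).integral
  obtain ⟨L, _, _, _, _, _, G, -, -, -, -, hG, -⟩ := exists_lift_discriminant k m
  have h : (curvePow k (m + 2)).left.basicOpen (discriminant k m) ≠ ⊥ := fun h =>
    hG (by rw [(basicOpen_eq_bot_iff (X := (curvePow k (m + 2)).left) _).mp h, map_zero])
  obtain ⟨x, hx⟩ := (TopologicalSpace.Opens.ne_bot_iff_nonempty _).mp h
  exact ⟨⟨x, hx⟩⟩

variable {c m} {W : (curvePow k (m + 2)).left.Opens}
  (hW : IsInvariantOpen (groupH (m + 2) c hc) W)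
  (hWd : W = (curvePow k (m + 2)).left.basicOpen (discriminant k m)) (e : W ≤ affineBox k (m + 2))

-- The heart of the proof: on D(`discriminant`) the parameters are invariant, as is checked on
-- generators; they are independent, by evaluation at the generic point; and by averaging every
-- invariant is a fraction in them.
include h2 hWd e in
theorem exists_isInvariantChart :
    ∃ (θ : MvPolynomial (ULift.{u} (Fin (m + 2))) k →+* Γ((curvePow k (m + 2)).left, W))
      (h : MvPolynomial (ULift.{u} (Fin (m + 2))) k), IsInvariantChart hW θ h ∧
        ∀ a, θ (C a) = scalar W a := by
  have hVa := isAffineOpen_affineBox k (m + 2)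
  have hV := isInvariantOpen_affineBox (n := m + 2) c hc
  let r := ((curvePow k (m + 2)).left.presheaf.map (homOfLE e).op).hom
  have hr (g s) : pull hW g (r s) = r (pull hV g s) := pull_res hV hW e g s
  have hσ (a : k) : r (scalar _ a) = scalar W a := res_scalar e a
  let x (j : Fin (m + 1)) := r (xCoord k j.castSucc)
  let y (j : Fin (m + 1)) := r (yCoord k j.castSucc)
  let x' := r (xCoord k (Fin.last _))
  let y' := r (yCoord k (Fin.last _))
  have hcurve (l) : r (yCoord k l) ^ 2 = r (xCoord k l) ^ 3 - r (xCoord k l) := by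
    rw [← map_pow, yCoord_sq, map_sub, map_pow]
  have hxy (j) : y j ^ 2 = x j ^ 3 - x j := hcurve _
  have hxy' : y' ^ 2 = x' ^ 3 - x' := hcurve _
  have hrd : r (discriminant k m) = (∏ j, y j) ^ 4 * y' ^ 4 * (x' ^ 2 - x 0 ^ 2) := by
    simp only [discriminant, map_mul, map_sub, map_pow, map_prod, x, y, x', y']
  have hf : IsUnit ((∏ j, y j) ^ 4 * y' ^ 4 * (x' ^ 2 - x 0 ^ 2)) :=
    hrd ▸ isUnit_res_basicOpen _ hWd e
  have hux : IsUnit (∏ j, x j) := IsUnit.prod_univ_iff.mpr fun j => (isUnit_coords hxy hf j).2.1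
  have huy : IsUnit (∏ j, y j) := IsUnit.prod_univ_iff.mpr fun j => (isUnit_coords hxy hf j).1
  obtain ⟨s, hs⟩ : ∃ s, s * ∏ j, x j = x' := by
    obtain ⟨v, hv⟩ := hux.exists_left_inv
    exact ⟨x' * v, by rw [mul_assoc, hv, mul_one]⟩
  obtain ⟨w, hw⟩ : ∃ w, w * ∏ j, y j = y' := by
    obtain ⟨v, hv⟩ := huy.exists_left_inv
    exact ⟨y' * v, by rw [mul_assoc, hv, mul_one]⟩
  have hlt (j : Fin (m + 1)) : ((j.castSucc : Fin (m + 2)) : ℕ) + 1 < m + 2 :=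
    Nat.add_lt_add_right j.2 1
  let gen (j : Fin (m + 1)) : groupH (m + 2) c hc :=
    ⟨generator c hc (m + 2) j.castSucc, generator_mem c hc (hlt j)⟩
  have hne (j l : Fin (m + 1)) (hl : l ≠ j) :
      ¬ (l.castSucc = j.castSucc ∨ ((l.castSucc : Fin (m + 2)) : ℕ) + 1 = m + 2) := by
    rintro (h | h)
    exacts [hl (Fin.castSucc_injective _ h), (hlt l).ne h]
  have hgx (j) : pull hW (gen j) (x j) = -1 * x j := by
    rw [hr, pull_generator_xCoord c hc hV (hlt j) _ (.inl rfl), map_neg, neg_one_mul]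
  have hgy (j) : pull hW (gen j) (y j) = scalar W c * y j := by
    rw [hr, pull_generator_yCoord c hc hV (hlt j) _ (.inl rfl), map_mul, hσ]
  have hgx' (j) : pull hW (gen j) x' = -1 * x' := by
    rw [hr, pull_generator_xCoord c hc hV (hlt j) _ (.inr rfl), map_neg, neg_one_mul]
  have hgy' (j) : pull hW (gen j) y' = scalar W c * y' := by
    rw [hr, pull_generator_yCoord c hc hV (hlt j) _ (.inr rfl), map_mul, hσ]
  have hgxl (j l) (hl : l ≠ j) : pull hW (gen j) (x l) = x l := by
    exact (hr _ _).trans (congrArg r (pull_generator_of_ne c hc hV (hlt j) _ (hne j l hl) _))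
  have hgyl (j l) (hl : l ≠ j) : pull hW (gen j) (y l) = y l := by
    exact (hr _ _).trans (congrArg r (pull_generator_of_ne c hc hV (hlt j) _ (hne j l hl) _))
  have hcu : IsUnit (scalar W c) := (IsUnit.of_mul_eq_one _ (mul_neg_eq hc)).map _
  let θ : MvPolynomial (ULift.{u} (Fin (m + 2))) k →+* Γ((curvePow k (m + 2)).left, W) :=
    paramHom (scalar W) s w x
  have hgθ (j) : (pull hW (gen j)).comp θ = θ := by
    refine MvPolynomial.ringHom_ext (fun a => ?_) ?_
    · rw [RingHom.comp_apply, paramHom_C, pull_scalar]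
    · rintro ⟨l⟩
      rw [RingHom.comp_apply]
      refine Fin.cases ?_ (Fin.cases ?_ fun l => ?_) l
      · rw [paramHom_zero]
        exact map_eq_self_of_mul_prod_eq (hgx j) (hgxl j) (hgx' j) hs hux isUnit_one.neg
      · exact (congrArg _ (paramHom_one ..)).trans ((map_eq_self_of_mul_prod_eq (hgy j) (hgyl j)
          (hgy' j) hw huy hcu).trans (paramHom_one ..).symm)
      · rw [paramHom_succ, map_pow]
        by_cases hl : l.succ = j
        · rw [hl, hgx, neg_one_mul, neg_sq]
        · rw [hgxl j _ hl]
  have hθinv (p) : θ p ∈ invariants hW := by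
    refine mem_invariants_groupH c hc fun j hj => ?_
    exact DFunLike.congr_fun (hgθ ⟨j, by omega⟩) p
  have hθinj : Function.Injective θ := by
    obtain ⟨L, _, σ, xL, sL, wL, G, hGσ, hGx, hGx', hGy', hGd, hinj⟩ := exists_lift_discriminant k m
    -- The generic point lies on D(`discriminant`). Evaluation there turns θ into the injective
    -- `paramHom` of that point, so θ is injective.
    obtain ⟨G', hG'⟩ := exists_extend_basicOpen hVa (discriminant k m) hWd e G hGd.isUnit
    replace hG' (s) : G' (r s) = G s := hG' s
    have hcomp : G'.comp θ = paramHom σ sL wL xL := by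
      refine MvPolynomial.ringHom_ext (fun a => ?_) ?_
      · rw [RingHom.comp_apply, paramHom_C, paramHom_C, ← hσ, hG', hGσ]
      · rintro ⟨l⟩
        rw [RingHom.comp_apply]
        refine Fin.cases ?_ (Fin.cases ?_ fun l => ?_) l
        · rw [paramHom_zero, paramHom_zero]
          refine (hux.map G').mul_right_cancel ?_
          rw [← map_mul, hs, hG', hGx', map_prod]
          simp only [x, hG']
        · refine (congrArg _ (paramHom_one ..)).trans (Eq.trans ?_ (paramHom_one ..).symm)
          refine (huy.map G').mul_right_cancel ?_
          rw [← map_mul, hw, hG', hGy', map_prod]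
          simp only [y, hG']
        · rw [paramHom_succ, paramHom_succ, map_pow, hG', hGx]
    refine Function.Injective.of_comp (f := G') ?_
    rw [← RingHom.coe_comp, hcomp]
    exact hinj
  have hgen (a) : ∃ n : ℕ, ((∏ j, y j) ^ 4 * y' ^ 4 * (x' ^ 2 - x 0 ^ 2)) ^ n * a ∈
      Subring.closure (Set.range (scalar W) ∪ Set.range x ∪ Set.range y ∪ {x', y'}) := by
    obtain ⟨n, t, ht⟩ := exists_res_eq_pow_mul hVa (discriminant k m) hWd e a
    refine ⟨n, ?_⟩
    rw [← hrd]
    refine Eq.subst (motive := (· ∈ _)) ht ?_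
    have ht' : t ∈ _ := (closure_coords_succ (k := k) (m + 1)).ge trivial
    have := (Subring.mem_map (f := r)).mpr ⟨t, ht', rfl⟩
    rw [RingHom.map_closure] at this
    refine Subring.closure_mono ?_ this
    rintro _ ⟨_, ((⟨a, rfl⟩ | ⟨j, rfl⟩) | ⟨j, rfl⟩) | rfl | rfl, rfl⟩
    · exact .inl (.inl (.inl ⟨a, (hσ a).symm⟩))
    · exact .inl (.inl (.inr ⟨j, rfl⟩))
    · exact .inl (.inr ⟨j, rfl⟩)
    · exact .inr (.inl rfl)
    · exact .inr (.inr rfl)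
  obtain ⟨h, hh, hy4, htop⟩ := exists_fractions_eq_top hxy hxy' hs hw hf hgen
  have := finite_groupH c hc (m + 1) h2
  refine ⟨θ, h, ⟨hθinv, hθinj, hh, fun a ha => ?_⟩, paramHom_C _ _ _ _⟩
  have hσB (a : k) : scalar W a ∈ fractions θ h :=
    (paramHom_C (scalar W) s w x a).subst (motive := (· ∈ fractions θ h)) (map_mem_fractions θ h _)
  refine mem_of_invariant (ρ := pull hW) (pull_mul hW) (B := fractions θ h) ?_ (y := y) (d := 4)
    (z := scalar W c) hy4 (hσB c) (fun e he => isUnit_one_sub_map_pow _ h2 hc he)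
    (fun j => ⟨gen j, hgy j, hgyl j⟩) htop ⟨scalar W ((4 ^ (m + 1))⁻¹), hσB _, ?_⟩ ha
  -- A fraction is invariant because its numerator and denominator are and the denominator is a
  -- unit.
  · rintro b ⟨n, q, hb⟩ g
    have h1 := congrArg (pull hW g) hb
    rw [map_mul, map_pow, hθinv h g, hθinv q g, ← hb] at h1
    exact (hh.pow n).mul_left_cancel h1
  · have h4 : (4 : k) ^ (m + 1) ≠ 0 := pow_ne_zero _ (by
      have : (4 : k) = 2 * 2 := by norm_num
      rw [this]
      exact mul_ne_zero h2 h2)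
    rw [card_groupH c hc (m + 1) h2, ← map_natCast (scalar W), ← map_mul]
    push_cast
    rw [inv_mul_cancel₀ h4, map_one]

include h2 in
theorem birationalOver_affineSpace {Z : Over (Spec (CommRingCat.of k))}
    {π : curvePow k (m + 2) ⟶ Z} (hq : IsQuotient (groupH (m + 2) c hc) π) :
    Scheme.BirationalOver Z.hom
      (𝔸(ULift.{u} (Fin (m + 2)); Spec (CommRingCat.of k)) ↘ Spec (CommRingCat.of k)) := by
  have hX := isVariety_curvePow k (m + 2)
  have := hX.integral
  have := finite_groupH c hc (m + 1) h2
  have hV := isInvariantOpen_affineBox (n := m + 2) c hc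
  have hW := hV.basicOpen (discriminant_mem_invariants c hc m hV)
  have hWa := (isAffineOpen_affineBox k (m + 2)).basicOpen (discriminant k m)
  have := nonempty_basicOpen_discriminant (k := k) m
  obtain ⟨θ, h, hθ, hC⟩ := exists_isInvariantChart h2 hc hW rfl (Scheme.basicOpen_le ..)
  have h1 := hq.birationalOver (isAffineOpen_inf_of_isVariety hX) C hθ hC hWa
  exact h1.trans (Scheme.Hom.birationalOver
    (AffineSpace.SpecIso (ULift.{u} (Fin (m + 2))) (.of k)).inv _ _
    (AffineSpace.SpecIso_inv_over _))

end Chart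

end ZQuot
end


theorem mainTheorem11 (k : Type u) [Field k] (h2 : (2 : k) ≠ 0) (i : k) (hi : i ^ 2 = -1)
    (n : ℕ) (hn : 2 ≤ n) :
    Nonempty (ZQuot.groupH n i hi ≃* Multiplicative (Fin (n - 1) → ZMod 4)) ∧
    (∃ (Z : Over (Spec (CommRingCat.of k))) (π : ZQuot.curvePow k n ⟶ Z),
      ZQuot.IsQuotient (ZQuot.groupH n i hi) π) ∧
    ∀ (Z : Over (Spec (CommRingCat.of k))) (π : ZQuot.curvePow k n ⟶ Z),
      ZQuot.IsQuotient (ZQuot.groupH n i hi) π →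
        ZQuot.IsVariety Z ∧
        Scheme.BirationalOver Z.hom
          (𝔸(ULift.{u} (Fin n); Spec (CommRingCat.of k)) ↘ Spec (CommRingCat.of k)) := by
  -- Two factors play special roles: the last one, which gives s and w, and factor 0, whose x_0² is
  -- eliminated; m counts the others.
  obtain ⟨m, rfl⟩ := Nat.exists_eq_add_of_le' hn
  have := ZQuot.finite_groupH i hi (m + 1) h2
  exact ⟨ZQuot.nonempty_groupH_mulEquiv i hi (m + 1) h2, ZQuot.exists_isQuotient_curvePow i hi,
    fun Z π hq => ⟨hq.isVariety (ZQuot.isVariety_curvePow k _),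
      ZQuot.birationalOver_affineSpace h2 hi hq⟩⟩
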